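/- Let $\mathbb K$ be a field of characteristic zero, $n$ an integer and $m\ge 0$. Consider finite connected graphs with $v\ge 1$ numbered vertices and $e$ numbered edges, multiple edges allowed, in which every edge $a$ has an intrinsic orientation from $\Gamma_-(a)$ to $\Gamma_+(a)\ne\Gamma_-(a)$ and, for each of $m$ colours, a further orientation, such that no colour has an oriented cycle; all vertices are at least 2-valent and at least one is at least 3-valent. Such a graph has degree $(v-1)n+(1-n)e$. The differential is $\delta\Gamma=\sum_t c_t(\Gamma)$ over all edges $t$: after moving the vertex $\Gamma_+(t)$ and the edge $t$ to the last places (with the sign of the vertex permutation if $n$ is odd, of the edge permutation if $n$ is even), they are deleted and the edges at $\Gamma_+(t)$ are reconnected to $\Gamma_-(t)$; the result counts as $0$ if it has a loop or an oriented cycle of some colour. A 2-valent vertex is *passing in a colour* if it is the head of one of its edges and the tail of the other one in that colour, and *passing* if it is so in every colour. The complex $\mathrm O_m\mathrm{GC}_n$ is spanned by these graphs, modulo the relations that permuting vertices and reversing the intrinsic orientation of an edge are odd and permuting edges is even for $n$ odd (permuting edges is odd and the two others are even for $n$ even), and modulo the graphs with at least one passing vertex. Let $k\ge0$. In $\mathrm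 O_{k+1}\mathrm{GC}_n$ a vertex is *weakly passing* if it is 2-valent and passing in the colours $1,\dots,k$ but not in the colour $k+1$; the other vertices are skeleton vertices, and the strings of edges and weakly passing vertices between skeleton vertices are the skeleton edges. A skeleton edge is *solid* if it is a single edge. The two kinds of skeleton edges of length 2 (middle vertex a sink, respectively a source, in the colour $k+1$, with all else the same, the intrinsic orientations of the two edges being those of the colour $k+1$) are replaced by their half-difference, the *dotted* edge, and their half-sum. Let $\mathrm O_{k+1}\mathrm{fGCc}^\dagger_n\subset\mathrm O_{k+1}\mathrm{GC}_n$ be the subcomplex spanned by graphs having at least one skeleton edge that is such a half-sum or has length at least 3, and let $$\mathrm O_{k+1}\mathrm{sGC}'_n:=\mathrm O_{k+1}\mathrm{GC}_n/\mathrm O_{k+1}\mathrm{fGCc}^\dagger_n .$$ As a graded space it is spanned by the graphs all of whose skeleton edges are solid or dotted. A *tadpole* is a dotted edge from a skeleton vertex to itself; a *multiple edge* is a set of more than one solid or dotted edges connecting the same two different skeleton vertices. Let $n$ be odd. Then: 1. The graphs with at least one tadpole span a subcomplex of $\mathrm O_1\mathrm{sGC}'_n$. This subcomplex is acyclic, and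 the projection of $\mathrm O_1\mathrm{sGC}'_n$ to the quotient $\mathrm O_1\mathrm{sGC}^{\mathrm{notadp}}_n$ by it is a quasi-isomorphism. 2. For $k\ge1$ put $\mathrm O_{k+1}\mathrm{sGC}^{\mathrm{notadp}}_n:=\mathrm O_{k+1}\mathrm{sGC}'_n$ (there are no tadpoles in this case). For every $k\ge0$ the graphs with at least one multiple edge span a subcomplex of $\mathrm O_{k+1}\mathrm{sGC}^{\mathrm{notadp}}_n$. This subcomplex is acyclic, and the projection of $\mathrm O_{k+1}\mathrm{sGC}^{\mathrm{notadp}}_n$ to the quotient $\mathrm O_{k+1}\mathrm{sGC}_n$ by it is a quasi-isomorphism. -/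

import Mathlib

open CategoryTheory

noncomputable section

namespace OrientedGraphComplex

universe u

/-! ### Labelled graphs with `m` colours -/

/-- A labelled multigraph with vertex set `Fin v` and edge set `Fin e`. The edge `a` has the
intrinsic orientation from `src a` to `tgt a`; its orientation in the colour `c` agrees with the
intrinsic one if `ori c a = true` and is opposite to it if `ori c a = false`. -/
structure ColGraph (m v e : ℕ) where
  src : Fin e → Fin v
  tgt : Fin e → Fin v
  ori : Fin m → Fin e → Bool

namespace ColGraph

variable {m k v e : ℕ}

/-- The vertex at which the edge `a` starts, in the colour `c`. -/
def tail (Γ : ColGraph m v e) (c : Fin m) (a : Fin e) : Fin v :=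
  if Γ.ori c a then Γ.src a else Γ.tgt a

/-- The vertex at which the edge `a` ends, in the colour `c`. -/
def head (Γ : ColGraph m v e) (c : Fin m) (a : Fin e) : Fin v :=
  if Γ.ori c a then Γ.tgt a else Γ.src a

/-- There is an oriented cycle in the colour `c`. -/
def HasCycle (Γ : ColGraph m v e) (c : Fin m) : Prop :=
  ∃ x, Relation.TransGen (fun y z => ∃ a, Γ.tail c a = y ∧ Γ.head c a = z) x x

/-- The number of half-edges at the vertex `x`. -/
def valence (Γ : ColGraph m v e) (x : Fin v) : ℕ :=
  (Finset.univ.filter fun a => Γ.src a = x).card + (Finset.univ.filter fun a => Γ.tgt a = x).card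

/-- The edge `a` joins the vertices `x` and `y` (in either direction). -/
def Joins (Γ : ColGraph m v e) (a : Fin e) (x y : Fin v) : Prop :=
  (Γ.src a = x ∧ Γ.tgt a = y) ∨ (Γ.src a = y ∧ Γ.tgt a = x)

/-- The graphs that span the complex of connected `m`-oriented graphs all of whose vertices are at
least 2-valent, at least one of them being at least 3-valent. -/
structure IsAdmissible (Γ : ColGraph m v e) : Prop where
  nonempty : 0 < v
  loopless : ∀ a, Γ.src a ≠ Γ.tgt a
  acyclic : ∀ c, ¬ Γ.HasCycle c
  connected : ∀ x y, Relation.EqvGen (fun p q => ∃ a, Γ.src a = p ∧ Γ.tgt a = q) x y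
  two_le_valence : ∀ x, 2 ≤ Γ.valence x
  exists_three_le_valence : ∃ x, 3 ≤ Γ.valence x

/-! #### The group actions -/

/-- The action of a permutation of the vertices. -/
def permVertices (σ : Equiv.Perm (Fin v)) (Γ : ColGraph m v e) : ColGraph m v e where
  src a := σ (Γ.src a)
  tgt a := σ (Γ.tgt a)
  ori := Γ.ori

/-- The action of a permutation of the edges. -/
def permEdges (σ : Equiv.Perm (Fin e)) (Γ : ColGraph m v e) : ColGraph m v e where
  src a := Γ.src (σ.symm a)
  tgt a := Γ.tgt (σ.symm a)
  ori c a := Γ.ori c (σ.symm a)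

/-- Reversal of the intrinsic orientation of the edge `t`. The coloured orientations, seen as
directions between the two end vertices, do not change. -/
def reverse (t : Fin e) (Γ : ColGraph m v e) : ColGraph m v e where
  src a := if a = t then Γ.tgt a else Γ.src a
  tgt a := if a = t then Γ.src a else Γ.tgt a
  ori c a := if a = t then !(Γ.ori c a) else Γ.ori c a

/-! #### Contraction of an edge -/

/-- The map on vertices that sends `p` to the same vertex as `x` and deletes the label `p`
(the labels after `p` are shifted down by one). -/
def mergeVertex (p x : Fin (v + 1)) (h : x ≠ p) (w : Fin (v + 1)) : Fin v :=
  if hw : w = p then (finSuccAboveEquiv p).symm ⟨x, h⟩ else (finSuccAboveEquiv p).symm ⟨w, hw⟩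

/-- Contraction of the edge `t`: the vertex `tgt t` and the edge `t` are deleted, and the edges at
`tgt t` are reconnected to `src t`. -/
def contract (Γ : ColGraph m (v + 1) (e + 1)) (t : Fin (e + 1)) (h : Γ.src t ≠ Γ.tgt t) :
    ColGraph m v e where
  src a := mergeVertex (Γ.tgt t) (Γ.src t) h (Γ.src (t.succAbove a))
  tgt a := mergeVertex (Γ.tgt t) (Γ.src t) h (Γ.tgt (t.succAbove a))
  ori c a := Γ.ori c (t.succAbove a)

/-! #### Passing and weakly passing vertices, and the skeleton -/

/-- `x` is the head of one edge and the tail of another one in the colour `c`. -/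
def PassesIn (Γ : ColGraph m v e) (c : Fin m) (x : Fin v) : Prop :=
  (∃ a, Γ.head c a = x) ∧ ∃ b, Γ.tail c b = x

/-- A 2-valent vertex that is passing in every colour. -/
def IsPassing (Γ : ColGraph m v e) (x : Fin v) : Prop :=
  Γ.valence x = 2 ∧ ∀ c, Γ.PassesIn c x

/-- A 2-valent vertex that is passing in every colour except the last one. -/
def IsWeaklyPassing (Γ : ColGraph (k + 1) v e) (x : Fin v) : Prop :=
  Γ.valence x = 2 ∧ (∀ c : Fin k, Γ.PassesIn c.castSucc x) ∧ ¬ Γ.PassesIn (Fin.last k) x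

/-- Reversal, in the last colour only, of the edges at the vertex `z`. At a 2-valent vertex it makes
no difference in the coinvariants whether the intrinsic orientations of the two edges are reversed
as well, since two reversals have sign `+1`. -/
def toggle (z : Fin v) (Γ : ColGraph (k + 1) v e) : ColGraph (k + 1) v e where
  src := Γ.src
  tgt := Γ.tgt
  ori c a := if c = Fin.last k ∧ (Γ.src a = z ∨ Γ.tgt a = z) then !(Γ.ori c a) else Γ.ori c a

/-- Some skeleton edge has length at least 3, i.e. some edge joins two weakly passing vertices. -/
def HasLongSkeletonEdge (Γ : ColGraph (k + 1) v e) : Prop :=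
  ∃ a, Γ.IsWeaklyPassing (Γ.src a) ∧ Γ.IsWeaklyPassing (Γ.tgt a)

/-- Some skeleton edge of length 2 is a tadpole: both edges at some weakly passing vertex `z`
go to the same vertex `x`. (An edge of length 1 is never a tadpole in an admissible graph.) -/
def HasTadpole (Γ : ColGraph (k + 1) v e) : Prop :=
  ∃ z x, Γ.IsWeaklyPassing z ∧ ∀ a, (Γ.src a = z ∨ Γ.tgt a = z) → Γ.Joins a z x

/-- The skeleton edges of length 1 between `x` and `y`: the edges joining `x` and `y`. -/
def solidEdges (Γ : ColGraph (k + 1) v e) (x y : Fin v) : Set (Fin e) :=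
  {a | Γ.Joins a x y}

/-- The skeleton edges of length 2 between `x` and `y` (for `x ≠ y`): the weakly passing vertices
joined by an edge to `x` and by an edge to `y`. -/
def dottedEdges (Γ : ColGraph (k + 1) v e) (x y : Fin v) : Set (Fin v) :=
  {z | Γ.IsWeaklyPassing z ∧ (∃ a, Γ.Joins a z x) ∧ ∃ a, Γ.Joins a z y}

/-- Two different skeleton vertices `x` and `y` are connected by more than one skeleton edge of
length 1 or 2. -/
def HasMultipleEdge (Γ : ColGraph (k + 1) v e) : Prop :=
  ∃ x y, x ≠ y ∧ ¬ Γ.IsWeaklyPassing x ∧ ¬ Γ.IsWeaklyPassing y ∧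
    2 ≤ (Γ.solidEdges x y).ncard + (Γ.dottedEdges x y).ncard

/-- If there are at least two colours, tadpoles are excluded by the absence of oriented cycles in
the first colour. -/
lemma not_hasTadpole (Γ : ColGraph (k + 2) v e) (h : Γ.IsAdmissible) : ¬ Γ.HasTadpole := by
  rintro ⟨z, x, hz, hx⟩
  obtain ⟨⟨a, ha⟩, ⟨b, hb⟩⟩ := hz.2.1 0
  refine h.acyclic _ ⟨z, Relation.TransGen.trans (b := x)
    (Relation.TransGen.single ⟨b, hb, ?_⟩) (Relation.TransGen.single ⟨a, ?_, ha⟩)⟩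
  · have h1 := h.loopless b
    have h2 := hx b
    unfold tail at hb
    unfold head
    unfold Joins at h2
    split_ifs at hb ⊢ <;> grind
  · have h1 := h.loopless a
    have h2 := hx a
    unfold head at ha
    unfold tail
    unfold Joins at h2
    split_ifs at ha ⊢ <;> grind

end ColGraph

/-! ### Subquotient complexes of a graded module with an operator of degree `-1` -/

section Subquotient

variable {K : Type u} [Field K] {M : Type u} [AddCommGroup M] [Module K M]

/-- The operator `δ` lowers degrees by one and makes `A ⧸ B` a complex. (`δ` need not square to
zero on `M` itself; `G d` is the part of degree `d`.) -/
structure IsSubquotientComplex (δ : M →ₗ[K] M) (G : ℤ → Submodule K M) (A B : Submodule K M) :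
    Prop where
  le : B ≤ A
  degree : ∀ i j, j + 1 = i → ∀ x ∈ G i, δ x ∈ G j
  stable_num : ∀ x ∈ A, δ x ∈ A
  stable_den : ∀ x ∈ B, δ x ∈ B
  sq_zero : ∀ x ∈ A, δ (δ x) ∈ B

variable {δ : M →ₗ[K] M} {G : ℤ → Submodule K M} {A B B' : Submodule K M}

/-- The part of `A ⧸ B` of degree `d`. -/
abbrev SubquotientPart (G : ℤ → Submodule K M) (A B : Submodule K M) (d : ℤ) : Type u :=
  ↥(A ⊓ G d) ⧸ B.submoduleOf (A ⊓ G d)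

/-- The differential of `A ⧸ B`, from degree `i` to degree `j = i - 1`. -/
def subquotientD (h : IsSubquotientComplex δ G A B) (i j : ℤ) (hij : j + 1 = i) :
    SubquotientPart G A B i →ₗ[K] SubquotientPart G A B j :=
  Submodule.mapQ _ _
    (δ.restrict fun x hx =>
      Submodule.mem_inf.2 ⟨h.stable_num x hx.1, h.degree i j hij x hx.2⟩)
    fun x hx => h.stable_den x.1 hx

open Classical in
/-- The complex `A ⧸ B`; its differential has degree `-1`. -/
def subquotientComplex (h : IsSubquotientComplex δ G A B) : ChainComplex (ModuleCat.{u} K) ℤ where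
  X d := ModuleCat.of K (SubquotientPart G A B d)
  d i j := if hij : j + 1 = i then ModuleCat.ofHom (subquotientD h i j hij) else 0
  shape i j hij := dif_neg hij
  d_comp_d' i j l hij hjl := by
    have hij' : j + 1 = i := hij
    have hjl' : l + 1 = j := hjl
    rw [dif_pos hij', dif_pos hjl', ← ModuleCat.ofHom_comp]
    have : subquotientD h j l hjl' ∘ₗ subquotientD h i j hij' = 0 := by
      refine Submodule.linearMap_qext _ (LinearMap.ext fun x => ?_)
      exact (Submodule.Quotient.mk_eq_zero _).2 (h.sq_zero x.1 x.2.1)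
    rw [this]
    rfl

/-- The canonical projection `A ⧸ B → A ⧸ B'` for `B ≤ B'`. -/
def subquotientProj (h : IsSubquotientComplex δ G A B) (h' : IsSubquotientComplex δ G A B')
    (hB : B ≤ B') : subquotientComplex h ⟶ subquotientComplex h' where
  f d := ModuleCat.ofHom (Submodule.factor (Submodule.comap_mono hB))
  comm' i j hij := by
    have hij' : j + 1 = i := hij
    simp only [subquotientComplex, dif_pos hij', ← ModuleCat.ofHom_comp]
    congr 1
    refine Submodule.linearMap_qext _ (LinearMap.ext fun x => ?_)
    rfl

/-- `M ⧸ B` and `M ⧸ A` are complexes, `A ⧸ B` is an acyclic subcomplex of the first one, and the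
quotient map `M ⧸ B → M ⧸ A` is a quasi-isomorphism. -/
def QuotientIsQuasiIso (δ : M →ₗ[K] M) (G : ℤ → Submodule K M) (B A : Submodule K M)
    (hBA : B ≤ A) : Prop :=
  ∃ (hB : IsSubquotientComplex δ G ⊤ B) (hA : IsSubquotientComplex δ G ⊤ A)
    (hAB : IsSubquotientComplex δ G A B),
    (subquotientComplex hAB).Acyclic ∧ QuasiIso (subquotientProj hB hA hBA)

end Subquotient

/-! ### Graded vector space and differential before taking coinvariants -/

/-- Admissible labelled graphs with any numbers of vertices and edges. -/
structure AdmGraph (m : ℕ) where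
  {numV : ℕ}
  {numE : ℕ}
  graph : ColGraph m numV numE
  adm : graph.IsAdmissible

/-- The degree `(v - 1) n + (1 - n) e` of a graph. -/
def AdmGraph.degree {m : ℕ} (n : ℤ) (Γ : AdmGraph m) : ℤ :=
  ((Γ.numV : ℤ) - 1) * n + (1 - n) * (Γ.numE : ℤ)

section Chains

variable (K : Type u) [Field K]

/-- Formal linear combinations of admissible labelled graphs. -/
abbrev Chains (m : ℕ) : Type u := AdmGraph m →₀ K

/-- The linear combinations of the graphs of degree `d`. -/
def degreePart (m : ℕ) (n d : ℤ) : Submodule K (Chains K m) :=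
  Finsupp.supported K K {Γ | Γ.degree n = d}

variable {K}

/-- The basis vector of an admissible graph. -/
def basisVec (K : Type u) [Field K] {m v e : ℕ} (Γ : ColGraph m v e) (h : Γ.IsAdmissible) :
    Chains K m :=
  Finsupp.single ⟨Γ, h⟩ 1

open Classical in
/-- The basis vector of a graph, or zero if the graph is not admissible. -/
def basisVecOrZero (K : Type u) [Field K] {m v e : ℕ} (Γ : ColGraph m v e) : Chains K m :=
  if h : Γ.IsAdmissible then basisVec K Γ h else 0

/-- The sign of moving the vertex `p` and the edge `t` to the last places: edges are odd for even
`n`, vertices are odd for odd `n`. -/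
def contractSign (K : Type u) [Field K] (n : ℤ) {v e : ℕ} (p : Fin (v + 1)) (t : Fin (e + 1)) : K :=
  if Even n then (-1) ^ (e - t.val) else (-1) ^ (v - p.val)

/-- The differential of a graph: the signed sum of the contractions of its edges. A contraction of
an admissible graph has no vertex of valence less than 2, so it can only fail to be admissible by
having an oriented cycle or a loop, and it counts as zero then. -/
def boundary (K : Type u) [Field K] (n : ℤ) {m : ℕ} :
    {v e : ℕ} → (Γ : ColGraph m v e) → Γ.IsAdmissible → Chains K m
  | v + 1, e + 1, Γ, h => ∑ t : Fin (e + 1),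
      contractSign K n (v := v) (e := e) (Γ.tgt t) t • basisVecOrZero K (Γ.contract t (h.loopless t))
  | 0, _, _, _ => 0
  | _ + 1, 0, _, _ => 0

/-- The differential, extended linearly. -/
def delta (K : Type u) [Field K] (m : ℕ) (n : ℤ) : Chains K m →ₗ[K] Chains K m :=
  Finsupp.linearCombination K fun Γ : AdmGraph m => boundary K n Γ.graph Γ.adm

/-! ### The relations -/

variable (K)

/-- The relations of the coinvariants: for `n` even, permuting edges multiplies by the sign, and
permuting vertices and reversing intrinsic orientations changes nothing; for `n` odd, permuting
vertices multiplies by the sign, reversing an intrinsic orientation multiplies by `-1`, and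
permuting edges changes nothing. -/
inductive SymRelator (m : ℕ) (n : ℤ) : Chains K m → Prop
  | vertices {v e : ℕ} (Γ : ColGraph m v e) (σ : Equiv.Perm (Fin v))
      (h : Γ.IsAdmissible) (h' : (Γ.permVertices σ).IsAdmissible) :
      SymRelator m n (basisVec K (Γ.permVertices σ) h' -
        (if Even n then 1 else ((Equiv.Perm.sign σ : ℤ) : K)) • basisVec K Γ h)
  | edges {v e : ℕ} (Γ : ColGraph m v e) (σ : Equiv.Perm (Fin e))
      (h : Γ.IsAdmissible) (h' : (Γ.permEdges σ).IsAdmissible) :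
      SymRelator m n (basisVec K (Γ.permEdges σ) h' -
        (if Even n then ((Equiv.Perm.sign σ : ℤ) : K) else 1) • basisVec K Γ h)
  | reversal {v e : ℕ} (Γ : ColGraph m v e) (t : Fin e)
      (h : Γ.IsAdmissible) (h' : (Γ.reverse t).IsAdmissible) :
      SymRelator m n (basisVec K (Γ.reverse t) h' -
        (if Even n then (1 : K) else -1) • basisVec K Γ h)

/-- `Chains K m ⧸ gcRel K m n` is `O_m GC_n`: coinvariants modulo the graphs with at least one
passing vertex. -/
def gcRel (m : ℕ) (n : ℤ) : Submodule K (Chains K m) :=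
  Submodule.span K {x | SymRelator K m n x} ⊔
    Submodule.span K {x | ∃ (v e : ℕ) (Γ : ColGraph m v e) (h : Γ.IsAdmissible),
      (∃ z, Γ.IsPassing z) ∧ x = basisVec K Γ h}

/-- The image of this subspace in `O_{k+1} GC_n` is the subcomplex spanned by the graphs with at
least one skeleton edge that is neither solid nor dotted, i.e. that has length at least 3 or is the
half-sum of the two kinds of skeleton edges of length 2 (the two kinds differ by reversing
both edges in the last colour). -/
def daggerRel (k : ℕ) : Submodule K (Chains K (k + 1)) :=
  Submodule.span K {x | ∃ (v e : ℕ) (Γ : ColGraph (k + 1) v e) (h : Γ.IsAdmissible),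
      Γ.HasLongSkeletonEdge ∧ x = basisVec K Γ h} ⊔
    Submodule.span K {x | ∃ (v e : ℕ) (Γ : ColGraph (k + 1) v e) (z : Fin v)
      (h : Γ.IsAdmissible) (h' : (Γ.toggle z).IsAdmissible),
      Γ.IsWeaklyPassing z ∧ x = (2⁻¹ : K) • (basisVec K Γ h + basisVec K (Γ.toggle z) h')}

/-- `Chains K (k + 1) ⧸ sgcRel K k n` is `O_{k+1} sGC'_n`. A skeleton edge of length 2 with its
middle vertex a sink in the last colour represents a dotted edge; with its middle vertex a source
it represents minus a dotted edge. -/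
def sgcRel (k : ℕ) (n : ℤ) : Submodule K (Chains K (k + 1)) :=
  gcRel K (k + 1) n ⊔ daggerRel K k

/-- The relations of the quotient of `O_{k+1} sGC'_n` by the graphs with at least one tadpole.
For `k ≥ 1` there are no such graphs, as a tadpole has an oriented cycle in the first colour. -/
def notadpRel (k : ℕ) (n : ℤ) : Submodule K (Chains K (k + 1)) :=
  sgcRel K k n ⊔
    Submodule.span K {x | ∃ (v e : ℕ) (Γ : ColGraph (k + 1) v e) (h : Γ.IsAdmissible),
      Γ.HasTadpole ∧ x = basisVec K Γ h}

/-- The relations of the further quotient by the graphs with at least one multiple edge. -/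
def nomulRel (k : ℕ) (n : ℤ) : Submodule K (Chains K (k + 1)) :=
  notadpRel K k n ⊔
    Submodule.span K {x | ∃ (v e : ℕ) (Γ : ColGraph (k + 1) v e) (h : Γ.IsAdmissible),
      Γ.HasMultipleEdge ∧ x = basisVec K Γ h}

lemma sgcRel_le_notadpRel (k : ℕ) (n : ℤ) : sgcRel K k n ≤ notadpRel K k n := le_sup_left

/-- For `k ≥ 1` the tadpole-free quotient is `O_{k+1} sGC'_n` itself. -/
lemma notadpRel_succ (k : ℕ) (n : ℤ) : notadpRel K (k + 1) n = sgcRel K (k + 1) n := by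
  refine le_antisymm (sup_le le_rfl (Submodule.span_le.2 ?_)) le_sup_left
  rintro x ⟨v, e, Γ, h, ht, -⟩
  exact absurd ht (Γ.not_hasTadpole h)

lemma notadpRel_le_nomulRel (k : ℕ) (n : ℤ) : notadpRel K k n ≤ nomulRel K k n := le_sup_left

end Chains

end OrientedGraphComplex

end

open CategoryTheory
noncomputable section
namespace OrientedGraphComplex
universe u

/-! ### Acyclicity from a triangular homotopy. -/

section Algebra

open Polynomial

variable {K : Type u} [Field K] {M : Type u} [AddCommGroup M] [Module K M]
  {δ : M →ₗ[K] M} {G : ℤ → Submodule K M} {A B : Submodule K M}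

/-! Both claims concern stable subspaces `B ≤ A` of the chains `M` for which `A ⧸ B` has to be
acyclic. The quasi-isomorphism then follows from the homology sequence of `0 → A ⧸ B → M ⧸ B → M ⧸ A
→ 0` (`quasiIso_subquotientProj`). Acyclicity comes from an operator `h` of degree `+1` preserving
`A` and `B` such that `Φ = δ h + h δ` acts, modulo `B`, on generators of `A` as a positive integer
plus generators of smaller rank. In characteristic zero every `x` in `A` is then carried into `B` by
some `p(Φ)` with `p(0) ≠ 0`. If `δ x ∈ B`, writing `p = X q + p(0)` shows that `x` is a boundary
modulo `B` (`exists_primitive_of_homotopy`).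

The computations are made with labelled graphs, modulo the relations. For odd `n` a permutation of
edges is free, while a transposition of vertices and a reversal of an edge cost `-1`. Contracting
two edges in the two possible orders removes two vertices in opposite orders, which gives `δ² = 0`
on coinvariants. At a 2-valent vertex the contractions of its two edges differ by the reversal of
the edge that remains. Hence they cancel if the vertex is passing, and for a weakly passing vertex
they cancel between a graph and its toggled version (`term_add_term`). So `δ` respects all relations
(`delta_sgcRel`).

Tadpoles: `h` pulls each tadpole out on a stem, that is, on a new edge whose new end carries the
tadpole. Contracting the stem gives the graph back, contracting an edge of the tadpole gives a loop,
and every other contraction commutes with pulling up to the sign `-1`, so it cancels against `h δ`.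
What remains are the tadpoles created by a contraction. Pulling them gives graphs with the original
number of vertices but more tadpoles. Thus `Φ` is the number of tadpoles plus terms of smaller rank,
the rank being the number of vertices that are not the middle of a tadpole.

Multiple edges: two dotted edges between the same vertices are exchanged by an odd permutation of
vertices, so such graphs vanish (`basisVecOrZero_mem_of_double_dotted`). There remain two parallel
solid edges, or a solid edge bypassed by a dotted one. Here `h` subdivides each solid edge that has
a solid parallel. In `δ h`, contracting the new half restores the graph, while contracting the old
half closes an oriented cycle in the last colour with the parallel edge. In `h δ`, contracting one
half of a bypass can produce two parallel solid edges, and subdividing either one returns the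
original graph with sign `+1` (`contractSign_smul_subdivide_of_mem`). At least one such contraction
is admissible (`admissible_contract_of_bypass`), so the diagonal entry is positive. Other new
parallel edges come from contracting an edge between two non-inner vertices, which lowers the number
of such vertices, the rank used here. The signs are compared on normalized representatives
(`induction_normalized`) and carried to all graphs by `IsTriangularAt.of_add_mem`. -/

lemma aeval_mem_of_stable {Φ : M →ₗ[K] M} {S : Submodule K M} (hS : ∀ x ∈ S, Φ x ∈ S)
    (p : K[X]) {x : M} (hx : x ∈ S) : aeval Φ p x ∈ S := by
  induction p using Polynomial.induction_on' with
  | add p q hp hq => simpa using S.add_mem hp hq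
  | monomial n a =>
    rw [aeval_monomial]
    refine S.smul_mem a ?_
    induction n with
    | zero => simpa using hx
    | succ n ih => rw [pow_succ']; exact hS _ ih

/-- Induction on the rank: if `p` carries `Φ (gen i) - n • gen i` into `B`, then `p * (X - n)` does
so for `gen i`, and its constant coefficient is still nonzero since `n ≠ 0` in characteristic zero.
Well-foundedness of `ℕ` replaces any finiteness assumption on the graded parts. -/
lemma exists_polynomial_aeval_mem {ι : Type*} (gen : ι → M) (rk : ι → ℕ) (Φ : M →ₗ[K] M)
    (hΦ : ∀ x ∈ B, Φ x ∈ B) [CharZero K]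
    (hgen : ∀ i, gen i ∈ B ∨ ∃ n : ℕ, n ≠ 0 ∧
      Φ (gen i) - (n : K) • gen i ∈ B ⊔ Submodule.span K (gen '' {j | rk j < rk i}))
    {x : M} (hx : x ∈ B ⊔ Submodule.span K (Set.range gen)) :
    ∃ p : K[X], p.coeff 0 ≠ 0 ∧ aeval Φ p x ∈ B := by
  -- For a sum the product of the two polynomials serves: polynomials in `Φ` commute and preserve
  -- `B`.
  have key : ∀ T : Set ι, (∀ i ∈ T, ∃ p : K[X], p.coeff 0 ≠ 0 ∧ aeval Φ p (gen i) ∈ B) →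
      ∀ x ∈ B ⊔ Submodule.span K (gen '' T), ∃ p : K[X], p.coeff 0 ≠ 0 ∧ aeval Φ p x ∈ B := by
    intro T hT x hx
    rw [← Submodule.span_eq B, ← Submodule.span_union] at hx
    induction hx using Submodule.span_induction with
    | mem x hx =>
      rcases hx with hx | ⟨i, hi, rfl⟩
      · exact ⟨1, by simp, by simpa using hx⟩
      · exact hT i hi
    | zero => exact ⟨1, by simp, by simp⟩
    | add x y _ _ ihx ihy =>
      obtain ⟨p, hp, hpx⟩ := ihx
      obtain ⟨q, hq, hqy⟩ := ihy
      refine ⟨p * q, by simp [mul_coeff_zero, hp, hq], ?_⟩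
      rw [map_add]
      refine B.add_mem ?_ ?_
      · rw [mul_comm, map_mul]
        exact aeval_mem_of_stable hΦ q hpx
      · rw [map_mul]
        exact aeval_mem_of_stable hΦ p hqy
    | smul a x _ ih =>
      obtain ⟨p, hp, hpx⟩ := ih
      exact ⟨p, hp, by rw [map_smul]; exact B.smul_mem a hpx⟩
  have hall : ∀ r : ℕ, ∀ i, rk i = r → ∃ p : K[X], p.coeff 0 ≠ 0 ∧ aeval Φ p (gen i) ∈ B := by
    intro r
    induction r using Nat.strong_induction_on with
    | _ r ih =>
      rintro i rfl
      rcases hgen i with h | ⟨n, hn, h⟩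
      · exact ⟨1, by simp, by simpa using h⟩
      · obtain ⟨p, hp, hpx⟩ := key {j | rk j < rk i} (fun j hj => ih _ hj j rfl) _ h
        refine ⟨p * (X - C (n : K)), ?_, ?_⟩
        · simp [mul_coeff_zero, hp, hn]
        · have e : aeval Φ (X - C (n : K)) (gen i) = Φ (gen i) - (n : K) • gen i := by
            rw [map_sub, aeval_X, aeval_C, LinearMap.sub_apply, Module.algebraMap_end_apply]
          rw [map_mul, Module.End.mul_apply, e]
          exact hpx
  refine key Set.univ (fun i _ => hall _ i rfl) x ?_
  rwa [Set.image_univ]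

/-- The algebraic form of acyclicity of `A ⧸ B`, from a homotopy `h` for which `δ h + h δ` is
triangular with nonzero diagonal entries. -/
lemma exists_primitive_of_homotopy [CharZero K] {ι : Type*} (gen : ι → M) (rk : ι → ℕ)
    (h : M →ₗ[K] M) (hAB : IsSubquotientComplex δ G A B) (hB : ∀ x ∈ B, h x ∈ B)
    (hA : ∀ x ∈ A, h x ∈ A) (hG : ∀ i j, j + 1 = i → ∀ x ∈ G j, h x ∈ G i)
    (hspan : A ≤ B ⊔ Submodule.span K (Set.range gen))
    (hgen : ∀ i, gen i ∈ B ∨ ∃ n : ℕ, n ≠ 0 ∧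
      δ (h (gen i)) + h (δ (gen i)) - (n : K) • gen i ∈
        B ⊔ Submodule.span K (gen '' {j | rk j < rk i}))
    (i j : ℤ) (hij : j + 1 = i) (x : M) (hx : x ∈ A) (hxG : x ∈ G j) (hδ : δ x ∈ B) :
    ∃ y ∈ A, y ∈ G i ∧ x - δ y ∈ B := by
  set Φ : M →ₗ[K] M := δ ∘ₗ h + h ∘ₗ δ with hΦdef
  have hΦ : ∀ y, Φ y = δ (h y) + h (δ y) := fun y => rfl
  obtain ⟨p, hp, hpx⟩ := exists_polynomial_aeval_mem (B := B) gen rk Φ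
    (fun y hy => B.add_mem (hAB.stable_den _ (hB _ hy)) (hB _ (hAB.stable_den _ hy)))
    hgen (hspan hx)
  -- With `w = q(Φ) x` one has `p(Φ) x = Φ w + p(0) x`, which can be solved for `x`.
  obtain ⟨q, hq⟩ : ∃ q : K[X], p = X * q + C (p.coeff 0) := ⟨p.divX, (X_mul_divX_add p).symm⟩
  -- The cycles of degree `j` modulo `B` are stable under `Φ`. Hence `w` is a cycle too, the term `h
  -- (δ w)` lies in `B`, and only `δ (h w)` is left of `Φ w`.
  set Z : Submodule K M := (A ⊓ B.comap δ) ⊓ G j with hZ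
  have hZst : ∀ y ∈ Z, Φ y ∈ Z := by
    rintro y ⟨⟨hyA, hyB⟩, hyG⟩
    have hyB : δ y ∈ B := hyB
    refine ⟨⟨A.add_mem (hAB.stable_num _ (hA _ hyA)) (hA _ (hAB.stable_num _ hyA)), ?_⟩, ?_⟩
    · change δ (Φ y) ∈ B
      rw [hΦ, map_add]
      exact B.add_mem (hAB.sq_zero _ (hA _ hyA)) (hAB.stable_den _ (hB _ hyB))
    · exact (G j).add_mem (hAB.degree _ _ hij _ (hG _ _ hij _ hyG))
        (hG j (j - 1) (by ring) _ (hAB.degree j (j - 1) (by ring) _ hyG))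
  have hw : aeval Φ q x ∈ Z := aeval_mem_of_stable hZst q ⟨⟨hx, hδ⟩, hxG⟩
  set w := aeval Φ q x with hwdef
  refine ⟨-(p.coeff 0)⁻¹ • h w, A.smul_mem _ (hA _ hw.1.1), (G i).smul_mem _ (hG _ _ hij _ hw.2), ?_⟩
  rw [hq] at hpx
  have e1 : aeval Φ (X * q + C (p.coeff 0)) x = Φ w + p.coeff 0 • x := by
    rw [map_add, map_mul]
    simp [Module.algebraMap_end_apply, hwdef]
  rw [e1, hΦ] at hpx
  have e2 : x - δ (-(p.coeff 0)⁻¹ • h w) =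
      (p.coeff 0)⁻¹ • ((δ (h w) + h (δ w) + p.coeff 0 • x) - h (δ w)) := by
    rw [map_smul, smul_sub, smul_add, smul_add, smul_smul, inv_mul_cancel₀ hp, one_smul, neg_smul]
    abel
  rw [e2]
  exact B.smul_mem _ (B.sub_mem hpx (hB _ hw.1.2))

lemma IsSubquotientComplex.of_top (hB : IsSubquotientComplex δ G ⊤ B)
    (hA : IsSubquotientComplex δ G ⊤ A) (hBA : B ≤ A) : IsSubquotientComplex δ G A B where
  le := hBA
  degree := hB.degree
  stable_num := hA.stable_den
  stable_den := hB.stable_den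
  sq_zero x _ := hB.sq_zero x trivial

lemma subquotientComplex_d_mk (h : IsSubquotientComplex δ G A B) (i j : ℤ) (hij : j + 1 = i)
    (x : ↥(A ⊓ G i)) :
    (subquotientComplex h).d i j (Submodule.Quotient.mk x) =
      (Submodule.Quotient.mk ⟨δ x.1, Submodule.mem_inf.2
        ⟨h.stable_num x.1 x.2.1, h.degree i j hij x.1 x.2.2⟩⟩ : SubquotientPart G A B j) := by
  simp only [subquotientComplex, dif_pos hij]
  rfl

lemma subquotientComplex_acyclic (hAB : IsSubquotientComplex δ G A B)
    (H : ∀ i j : ℤ, j + 1 = i → ∀ x ∈ A, x ∈ G j → δ x ∈ B → ∃ y ∈ A, y ∈ G i ∧ x - δ y ∈ B) :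
    (subquotientComplex hAB).Acyclic := by
  intro j
  rw [HomologicalComplex.exactAt_iff' _ (j + 1) j (j - 1) (by simp) (by simp),
    ShortComplex.moduleCat_exact_iff]
  intro x hx
  obtain ⟨x, rfl⟩ := Submodule.Quotient.mk_surjective _ x
  have hx' := hx
  change (subquotientComplex hAB).d j (j - 1) (Submodule.Quotient.mk x) = 0 at hx'
  rw [subquotientComplex_d_mk hAB j (j - 1) (by ring)] at hx'
  have hx2 : δ x.1 ∈ B := (Submodule.Quotient.mk_eq_zero (B.submoduleOf (A ⊓ G (j - 1)))).1 hx'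
  obtain ⟨y, hyA, hyG, hy⟩ := H (j + 1) j rfl x.1 x.2.1 x.2.2 hx2
  refine ⟨Submodule.Quotient.mk (⟨y, hyA, hyG⟩ : ↥(A ⊓ G (j + 1))), ?_⟩
  change (subquotientComplex hAB).d (j + 1) j (Submodule.Quotient.mk _) = _
  rw [subquotientComplex_d_mk hAB (j + 1) j rfl]
  refine ((Submodule.Quotient.eq _).2 ?_).symm
  exact hy

/-- The inclusion `A ⧸ B → M ⧸ B`. -/
def subquotientIncl (hB : IsSubquotientComplex δ G ⊤ B) (hAB : IsSubquotientComplex δ G A B) :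
    subquotientComplex hAB ⟶ subquotientComplex hB where
  f d := ModuleCat.ofHom (Submodule.mapQ _ _
    (Submodule.inclusion (inf_le_inf_right (G d) (le_top : A ≤ ⊤))) (fun _ hx => hx))
  comm' i j hij := by
    have hij' : j + 1 = i := hij
    simp only [subquotientComplex, dif_pos hij', ← ModuleCat.ofHom_comp]
    congr 1
    refine Submodule.linearMap_qext _ (LinearMap.ext fun x => ?_)
    rfl

/-- The sequence `0 → A ⧸ B → M ⧸ B → M ⧸ A → 0` is exact in each degree. Vanishing of the homology
of `A ⧸ B` in degrees `i` and `i - 1` makes the map in homology mono and epi in degree `i`. -/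
lemma quasiIso_subquotientProj (hB : IsSubquotientComplex δ G ⊤ B)
    (hA : IsSubquotientComplex δ G ⊤ A) (hAB : IsSubquotientComplex δ G A B)
    (hac : (subquotientComplex hAB).Acyclic) :
    QuasiIso (subquotientProj hB hA hAB.le) := by
  have hzero : subquotientIncl hB hAB ≫ subquotientProj hB hA hAB.le = 0 := by
    ext d : 1
    refine ModuleCat.hom_ext ?_
    refine Submodule.linearMap_qext _ (LinearMap.ext fun x => ?_)
    exact (Submodule.Quotient.mk_eq_zero _).2 x.2.1
  let S : ShortComplex (ChainComplex (ModuleCat.{u} K) ℤ) := ShortComplex.mk _ _ hzero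
  have hS : S.ShortExact := by
    refine HomologicalComplex.shortExact_of_degreewise_shortExact S fun d => ?_
    have hex : (S.map (HomologicalComplex.eval (ModuleCat.{u} K) (ComplexShape.down ℤ) d)).Exact := by
      rw [ShortComplex.moduleCat_exact_iff]
      intro x hx
      obtain ⟨x, rfl⟩ := Submodule.Quotient.mk_surjective _ x
      have hx2 : x.1 ∈ A := (Submodule.Quotient.mk_eq_zero (A.submoduleOf (⊤ ⊓ G d))).1 hx
      exact ⟨Submodule.Quotient.mk (⟨x.1, hx2, x.2.2⟩ : ↥(A ⊓ G d)), rfl⟩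
    refine { exact := hex, mono_f := ?_, epi_g := ?_ }
    · refine (ModuleCat.mono_iff_injective _).2 ?_
      refine (injective_iff_map_eq_zero (ModuleCat.Hom.hom ((subquotientIncl hB hAB).f d))).2 ?_
      intro x hx
      obtain ⟨x, rfl⟩ := Submodule.Quotient.mk_surjective _ x
      exact (Submodule.Quotient.mk_eq_zero _).2 
        ((Submodule.Quotient.mk_eq_zero (B.submoduleOf (⊤ ⊓ G d))).1 hx : x.1 ∈ B)
    · refine (ModuleCat.epi_iff_surjective _).2 ?_
      intro x
      obtain ⟨x, rfl⟩ := Submodule.Quotient.mk_surjective _ x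
      exact ⟨Submodule.Quotient.mk x, rfl⟩
  have hz : ∀ i, Limits.IsZero (S.X₁.homology i) := fun i =>
    (HomologicalComplex.exactAt_iff_isZero_homology _ _).1 (hac i)
  rw [quasiIso_iff]
  intro i
  rw [quasiIsoAt_iff_isIso_homologyMap]
  have hmono : Mono (HomologicalComplex.homologyMap S.g i) :=
    (hS.homology_exact₂ i).mono_g ((hz i).eq_of_src _ _)
  have hepi : Epi (HomologicalComplex.homologyMap S.g i) :=
    (hS.homology_exact₃ i (i - 1) (by simp)).epi_f ((hz (i - 1)).eq_of_tgt _ _)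
  exact isIso_of_mono_of_epi (HomologicalComplex.homologyMap S.g i)

/-- A homotopy that is triangular with nonzero diagonal entries on generators of `A ⧸ B` makes
`M ⧸ B → M ⧸ A` a quasi-isomorphism. -/
lemma quotientIsQuasiIso_of_homotopy [CharZero K] {ι : Type*} (gen : ι → M) (rk : ι → ℕ)
    (h : M →ₗ[K] M) (hB : IsSubquotientComplex δ G ⊤ B) (hA : IsSubquotientComplex δ G ⊤ A)
    (hBA : B ≤ A) (hhB : ∀ x ∈ B, h x ∈ B)
    (hhA : ∀ x ∈ A, h x ∈ A) (hG : ∀ i j, j + 1 = i → ∀ x ∈ G j, h x ∈ G i)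
    (hspan : A ≤ B ⊔ Submodule.span K (Set.range gen))
    (hgen : ∀ i, gen i ∈ B ∨ ∃ n : ℕ, n ≠ 0 ∧
      δ (h (gen i)) + h (δ (gen i)) - (n : K) • gen i ∈
        B ⊔ Submodule.span K (gen '' {j | rk j < rk i})) :
    QuotientIsQuasiIso δ G B A hBA := by
  have hAB := hB.of_top hA hBA
  have hac := subquotientComplex_acyclic hAB
    (exists_primitive_of_homotopy gen rk h hAB hhB hhA hG hspan hgen)
  exact ⟨hB, hA, hAB, hac, quasiIso_subquotientProj hB hA hAB hac⟩

end Algebra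

/-! ### Isomorphisms of labelled graphs and their invariants. -/

namespace ColGraph

variable {m v e : ℕ}

@[ext]
lemma ext_fields {Γ Γ' : ColGraph m v e} (h₁ : ∀ a, Γ.src a = Γ'.src a)
    (h₂ : ∀ a, Γ.tgt a = Γ'.tgt a) (h₃ : ∀ c a, Γ.ori c a = Γ'.ori c a) : Γ = Γ' := by
  cases Γ
  cases Γ'
  simp only [mk.injEq]
  exact ⟨funext h₁, funext h₂, funext fun c => funext (h₃ c)⟩

lemma tail_eq (Γ : ColGraph m v e) (c : Fin m) (a : Fin e) :
    (Γ.tail c a = Γ.src a ∧ Γ.head c a = Γ.tgt a ∧ Γ.ori c a = true) ∨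
      (Γ.tail c a = Γ.tgt a ∧ Γ.head c a = Γ.src a ∧ Γ.ori c a = false) := by
  unfold tail head
  cases h : Γ.ori c a <;> simp

lemma valence_eq_sum (Γ : ColGraph m v e) (x : Fin v) : Γ.valence x =
    ∑ a, ((if Γ.src a = x then 1 else 0) + (if Γ.tgt a = x then 1 else 0)) := by
  rw [valence, Finset.card_filter, Finset.card_filter, Finset.sum_add_distrib]

/-- The edge `a` in `Γ` is carried to the edge `b` in `Γ'` by the map `f` of vertices, possibly
with the opposite intrinsic orientation. -/
def EdgeMatch {v' e' : ℕ} (Γ : ColGraph m v e) (Γ' : ColGraph m v' e') (f : Fin v → Fin v')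
    (a : Fin e) (b : Fin e') : Prop :=
  (Γ'.src b = f (Γ.src a) ∧ Γ'.tgt b = f (Γ.tgt a) ∧ ∀ c, Γ'.ori c b = Γ.ori c a) ∨
    (Γ'.src b = f (Γ.tgt a) ∧ Γ'.tgt b = f (Γ.src a) ∧ ∀ c, Γ'.ori c b = !(Γ.ori c a))

namespace EdgeMatch

variable {v' e' : ℕ} {Γ : ColGraph m v e} {Γ' : ColGraph m v' e'} {f : Fin v → Fin v'} {a : Fin e}
  {b : Fin e'}

lemma tail (h : EdgeMatch Γ Γ' f a b) (c : Fin m) : Γ'.tail c b = f (Γ.tail c a) := by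
  unfold ColGraph.tail
  rcases h with ⟨h₁, h₂, h₃⟩ | ⟨h₁, h₂, h₃⟩ <;> rw [h₁, h₂, h₃] <;> cases Γ.ori c a <;> rfl

lemma head (h : EdgeMatch Γ Γ' f a b) (c : Fin m) : Γ'.head c b = f (Γ.head c a) := by
  unfold ColGraph.head
  rcases h with ⟨h₁, h₂, h₃⟩ | ⟨h₁, h₂, h₃⟩ <;> rw [h₁, h₂, h₃] <;> cases Γ.ori c a <;> rfl

end EdgeMatch

lemma eqvGen_map {α β : Type*} {r : α → α → Prop} {s : β → β → Prop} (f : α → β)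
    (h : ∀ x y, r x y → Relation.EqvGen s (f x) (f y)) {x y : α} (hxy : Relation.EqvGen r x y) :
    Relation.EqvGen s (f x) (f y) := by
  induction hxy with
  | rel x y h' => exact h x y h'
  | refl x => exact .refl _
  | symm x y _ ih => exact .symm _ _ ih
  | trans x y z _ _ ih₁ ih₂ => exact .trans _ _ _ ih₁ ih₂

/-- The vertices of `Γ` and `Γ'` correspond via `σ` and their edges via `τ`, up to reversal of
intrinsic orientations. -/
def Iso (Γ Γ' : ColGraph m v e) (σ : Equiv.Perm (Fin v)) (τ : Equiv.Perm (Fin e)) : Prop :=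
  ∀ a, EdgeMatch Γ Γ' σ a (τ a)

namespace Iso

variable {Γ Γ' : ColGraph m v e} {σ : Equiv.Perm (Fin v)} {τ : Equiv.Perm (Fin e)}

lemma symm (h : Iso Γ Γ' σ τ) : Iso Γ' Γ σ.symm τ.symm := by
  intro a
  have := h (τ.symm a)
  unfold EdgeMatch at *
  rw [τ.apply_symm_apply] at this
  rcases this with ⟨h₁, h₂, h₃⟩ | ⟨h₁, h₂, h₃⟩
  · left; simp [h₁, h₂, h₃]
  · right; simp [h₁, h₂, h₃]

lemma valence (h : Iso Γ Γ' σ τ) (x : Fin v) : Γ'.valence (σ x) = Γ.valence x := by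
  rw [valence_eq_sum, valence_eq_sum, ← Equiv.sum_comp τ]
  refine Finset.sum_congr rfl fun a _ => ?_
  rcases h a with ⟨h₁, h₂, -⟩ | ⟨h₁, h₂, -⟩ <;> rw [h₁, h₂] <;> simp [add_comm]

lemma passesIn (h : Iso Γ Γ' σ τ) (c : Fin m) (x : Fin v) (hx : Γ.PassesIn c x) :
    Γ'.PassesIn c (σ x) := by
  obtain ⟨⟨a, ha⟩, b, hb⟩ := hx
  exact ⟨⟨τ a, by rw [(h a).head, ha]⟩, τ b, by rw [(h b).tail, hb]⟩

lemma passesIn_iff (h : Iso Γ Γ' σ τ) (c : Fin m) (x : Fin v) :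
    Γ'.PassesIn c (σ x) ↔ Γ.PassesIn c x :=
  ⟨fun hx => by simpa using h.symm.passesIn c _ hx, h.passesIn c x⟩

lemma hasCycle (h : Iso Γ Γ' σ τ) (c : Fin m) (hx : Γ.HasCycle c) : Γ'.HasCycle c := by
  obtain ⟨x, hx⟩ := hx
  refine ⟨σ x, hx.lift σ ?_⟩
  rintro y z ⟨a, rfl, rfl⟩
  exact ⟨τ a, (h a).tail c, (h a).head c⟩

lemma joins_iff (h : Iso Γ Γ' σ τ) (a : Fin e) (x y : Fin v) :
    Γ'.Joins (τ a) (σ x) (σ y) ↔ Γ.Joins a x y := by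
  unfold Joins
  rcases h a with ⟨h₁, h₂, -⟩ | ⟨h₁, h₂, -⟩ <;> rw [h₁, h₂] <;> simp
  tauto

lemma admissible (h : Iso Γ Γ' σ τ) (hΓ : Γ.IsAdmissible) : Γ'.IsAdmissible where
  nonempty := hΓ.nonempty
  loopless a := by
    have := hΓ.loopless (τ.symm a)
    rcases h (τ.symm a) with ⟨h₁, h₂, -⟩ | ⟨h₁, h₂, -⟩ <;>
      rw [τ.apply_symm_apply] at h₁ h₂ <;> rw [h₁, h₂] <;> simp [this, this.symm]
  acyclic c hc := hΓ.acyclic c (h.symm.hasCycle c hc)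
  connected x y := by
    have := eqvGen_map σ (s := fun p q => ∃ a, Γ'.src a = p ∧ Γ'.tgt a = q) ?_
      (hΓ.connected (σ.symm x) (σ.symm y))
    · simpa using this
    · rintro x y ⟨a, rfl, rfl⟩
      rcases h a with ⟨h₁, h₂, -⟩ | ⟨h₁, h₂, -⟩
      · exact .rel _ _ ⟨τ a, h₁, h₂⟩
      · exact .symm _ _ (.rel _ _ ⟨τ a, h₁, h₂⟩)
  two_le_valence x := by
    have := h.valence (σ.symm x)
    rw [σ.apply_symm_apply] at this
    rw [this]
    exact hΓ.two_le_valence _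
  exists_three_le_valence := by
    obtain ⟨x, hx⟩ := hΓ.exists_three_le_valence
    exact ⟨σ x, by rwa [h.valence]⟩

lemma admissible_iff (h : Iso Γ Γ' σ τ) : Γ'.IsAdmissible ↔ Γ.IsAdmissible :=
  ⟨h.symm.admissible, h.admissible⟩

end Iso

lemma iso_permVertices (Γ : ColGraph m v e) (σ : Equiv.Perm (Fin v)) :
    Iso Γ (Γ.permVertices σ) σ 1 := fun _ => Or.inl ⟨rfl, rfl, fun _ => rfl⟩

lemma iso_permEdges (Γ : ColGraph m v e) (τ : Equiv.Perm (Fin e)) :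
    Iso Γ (Γ.permEdges τ) 1 τ := fun _ => Or.inl ⟨by simp [permEdges], by simp [permEdges],
      fun _ => by simp [permEdges]⟩

lemma iso_reverse (Γ : ColGraph m v e) (t : Fin e) : Iso Γ (Γ.reverse t) 1 1 := by
  intro a
  by_cases h : a = t
  · right; simp [reverse, h]
  · left; simp [reverse, h]

end ColGraph

/-! ### The relations of the coinvariants for odd `n`. -/

section Sym

variable (K : Type u) [Field K] {m v e : ℕ}

/-- The span of the relations of the coinvariants. -/
def symSpan (m : ℕ) (n : ℤ) : Submodule K (Chains K m) := Submodule.span K {x | SymRelator K m n x}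

variable {K}

lemma basisVecOrZero_of_adm {Γ : ColGraph m v e} (h : Γ.IsAdmissible) :
    basisVecOrZero K Γ = basisVec K Γ h := dif_pos h

lemma basisVecOrZero_of_not_adm {Γ : ColGraph m v e} (h : ¬ Γ.IsAdmissible) :
    basisVecOrZero K Γ = 0 := dif_neg h

variable {n : ℤ}

/-- Admissibility is invariant under isomorphism, so for `basisVecOrZero` this relation and the next
two hold without an admissibility hypothesis: otherwise both sides are zero. -/
lemma basisVecOrZero_permVertices (hn : ¬ Even n) (Γ : ColGraph m v e) (σ : Equiv.Perm (Fin v)) :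
    basisVecOrZero K (Γ.permVertices σ) ≡ ((Equiv.Perm.sign σ : ℤ) : K) • basisVecOrZero K Γ
      [SMOD symSpan K m n] := by
  rw [SModEq.sub_mem]
  by_cases h : Γ.IsAdmissible
  · have h' := (Γ.iso_permVertices σ).admissible h
    rw [basisVecOrZero_of_adm h, basisVecOrZero_of_adm h']
    refine Submodule.subset_span ?_
    simpa [hn] using SymRelator.vertices (K := K) (n := n) Γ σ h h'
  · have h' := mt (Γ.iso_permVertices σ).admissible_iff.1 h
    simp [basisVecOrZero_of_not_adm h, basisVecOrZero_of_not_adm h']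

lemma basisVecOrZero_permEdges (hn : ¬ Even n) (Γ : ColGraph m v e) (σ : Equiv.Perm (Fin e)) :
    basisVecOrZero K (Γ.permEdges σ) ≡ basisVecOrZero K Γ [SMOD symSpan K m n] := by
  rw [SModEq.sub_mem]
  by_cases h : Γ.IsAdmissible
  · have h' := (Γ.iso_permEdges σ).admissible h
    rw [basisVecOrZero_of_adm h, basisVecOrZero_of_adm h']
    refine Submodule.subset_span ?_
    simpa [hn] using SymRelator.edges (K := K) (n := n) Γ σ h h'
  · have h' := mt (Γ.iso_permEdges σ).admissible_iff.1 h
    simp [basisVecOrZero_of_not_adm h, basisVecOrZero_of_not_adm h']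

lemma basisVecOrZero_reverse (hn : ¬ Even n) (Γ : ColGraph m v e) (t : Fin e) :
    basisVecOrZero K (Γ.reverse t) ≡ - basisVecOrZero K Γ [SMOD symSpan K m n] := by
  rw [SModEq.sub_mem]
  by_cases h : Γ.IsAdmissible
  · have h' := (Γ.iso_reverse t).admissible h
    rw [basisVecOrZero_of_adm h, basisVecOrZero_of_adm h']
    refine Submodule.subset_span ?_
    simpa [hn] using SymRelator.reversal (K := K) (n := n) Γ t h h'
  · have h' := mt (Γ.iso_reverse t).admissible_iff.1 h
    simp [basisVecOrZero_of_not_adm h, basisVecOrZero_of_not_adm h']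

/-- To map the relations of the coinvariants into a submodule it suffices to consider the three
kinds of relations for odd `n`. -/
lemma map_symSpan_le {M : Type*} [AddCommGroup M] [Module K M] (hn : ¬ Even n)
    (f : Chains K m →ₗ[K] M) (S : Submodule K M)
    (h₁ : ∀ {v e : ℕ} (Γ : ColGraph m v e) (σ : Equiv.Perm (Fin v)), Γ.IsAdmissible →
      f (basisVecOrZero K (Γ.permVertices σ)) ≡
        ((Equiv.Perm.sign σ : ℤ) : K) • f (basisVecOrZero K Γ) [SMOD S])
    (h₂ : ∀ {v e : ℕ} (Γ : ColGraph m v e) (σ : Equiv.Perm (Fin e)), Γ.IsAdmissible →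
      f (basisVecOrZero K (Γ.permEdges σ)) ≡ f (basisVecOrZero K Γ) [SMOD S])
    (h₃ : ∀ {v e : ℕ} (Γ : ColGraph m v e) (t : Fin e), Γ.IsAdmissible →
      f (basisVecOrZero K (Γ.reverse t)) ≡ - f (basisVecOrZero K Γ) [SMOD S]) :
    ∀ x ∈ symSpan K m n, f x ∈ S := by
  suffices symSpan K m n ≤ S.comap f from this
  refine Submodule.span_le.2 ?_
  rintro _ (⟨Γ, σ, h, h'⟩ | ⟨Γ, σ, h, h'⟩ | ⟨Γ, t, h, h'⟩)
  · have := SModEq.sub_mem.1 (h₁ Γ σ h)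
    rw [basisVecOrZero_of_adm h, basisVecOrZero_of_adm h'] at this
    simpa [hn] using this
  · have := SModEq.sub_mem.1 (h₂ Γ σ h)
    rw [basisVecOrZero_of_adm h, basisVecOrZero_of_adm h'] at this
    simpa [hn] using this
  · have := SModEq.sub_mem.1 (h₃ Γ t h)
    rw [basisVecOrZero_of_adm h, basisVecOrZero_of_adm h'] at this
    simpa [hn] using this

end Sym

/-! ### Deleting one point from a permutation -/

section RemovePoint

variable {N : ℕ}

/-- The permutation induced by `σ` on the complements of `p` and `σ p`. -/
def removePerm (σ : Equiv.Perm (Fin (N + 1))) (p : Fin (N + 1)) : Equiv.Perm (Fin N) :=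
  ((finSuccAboveEquiv p).trans (σ.subtypeEquiv fun a => by simp)).trans
    (finSuccAboveEquiv (σ p)).symm

lemma succAbove_removePerm (σ : Equiv.Perm (Fin (N + 1))) (p : Fin (N + 1)) (i : Fin N) :
    (σ p).succAbove (removePerm σ p i) = σ (p.succAbove i) := by
  have h := congrArg Subtype.val ((finSuccAboveEquiv (σ p)).apply_symm_apply
    ((σ.subtypeEquiv (p := fun a => a ≠ p) (q := fun a => a ≠ σ p) fun a => by simp)
      (finSuccAboveEquiv p i)))
  exact h

lemma succAbove_removePerm_symm (σ : Equiv.Perm (Fin (N + 1))) (p : Fin (N + 1)) (i : Fin N) :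
    p.succAbove ((removePerm σ p).symm i) = σ.symm ((σ p).succAbove i) := by
  rw [Equiv.eq_symm_apply, ← succAbove_removePerm, Equiv.apply_symm_apply]

/-- The cycles `cycleRange` bring `p` and `σ p` to the place `0` with signs `(-1) ^ p` and `(-1) ^ σ
p`. Between them `σ` becomes a permutation that fixes `0` and is `removePerm σ p` on the rest. -/
lemma sign_removePerm (σ : Equiv.Perm (Fin (N + 1))) (p : Fin (N + 1)) :
    (Equiv.Perm.sign (removePerm σ p) : ℤ) =
      Equiv.Perm.sign σ * (-1) ^ (p : ℕ) * (-1) ^ (σ p : ℕ) := by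
  have h : Equiv.Perm.decomposeFin.symm (0, removePerm σ p) =
      (σ p).cycleRange * σ * (p.cycleRange)⁻¹ := by
    refine Equiv.ext fun i => ?_
    refine Fin.cases ?_ (fun i => ?_) i
    · simp [Equiv.Perm.mul_apply, Equiv.Perm.inv_def]
    · simp only [Equiv.Perm.mul_apply, Equiv.Perm.inv_def, Fin.cycleRange_symm_succ,
        ← succAbove_removePerm σ p, Fin.cycleRange_succAbove]
      simp
  have h2 := congrArg (fun π => (Equiv.Perm.sign π : ℤ)) h
  simp only [Equiv.Perm.decomposeFin.symm_sign, Equiv.Perm.sign_mul, Equiv.Perm.sign_inv,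
    Fin.sign_cycleRange, if_true, one_mul] at h2
  rw [h2]
  push_cast
  ring

end RemovePoint

/-! ### Contraction of edges: relabelling, reversal, double contraction, admissibility. -/

namespace ColGraph

variable {m v e : ℕ}

lemma succAbove_mergeVertex (p x : Fin (v + 1)) (h : x ≠ p) (w : Fin (v + 1)) :
    p.succAbove (mergeVertex p x h w) = if w = p then x else w := by
  unfold mergeVertex
  split_ifs with hw
  · exact congrArg Subtype.val ((finSuccAboveEquiv p).apply_symm_apply ⟨x, h⟩)
  · exact congrArg Subtype.val ((finSuccAboveEquiv p).apply_symm_apply ⟨w, hw⟩)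

lemma mergeVertex_succAbove (p x : Fin (v + 1)) (h : x ≠ p) (w : Fin v) :
    mergeVertex p x h (p.succAbove w) = w :=
  p.succAbove_right_injective (by rw [succAbove_mergeVertex, if_neg (Fin.succAbove_ne p w)])

lemma mergeVertex_surjective (p x : Fin (v + 1)) (h : x ≠ p) :
    Function.Surjective (mergeVertex p x h) := fun w => ⟨_, mergeVertex_succAbove p x h w⟩

lemma mergeVertex_eq_iff (p x : Fin (v + 1)) (h : x ≠ p) (u w : Fin (v + 1)) :
    mergeVertex p x h u = mergeVertex p x h w ↔
      u = w ∨ (u = p ∧ w = x) ∨ (u = x ∧ w = p) := by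
  rw [← p.succAbove_right_injective.eq_iff, succAbove_mergeVertex, succAbove_mergeVertex]
  split_ifs <;> grind

/-- The map on vertices of the contraction of an edge. -/
abbrev contractMap (Γ : ColGraph m (v + 1) (e + 1)) (t : Fin (e + 1)) (h : Γ.src t ≠ Γ.tgt t) :
    Fin (v + 1) → Fin v := mergeVertex (Γ.tgt t) (Γ.src t) h

/-- Equalities of contractions are tested after the injection `succAbove` into the original
vertices, where no labels are shifted. -/
lemma eq_contract {Γ : ColGraph m (v + 1) (e + 1)} {t : Fin (e + 1)} {h : Γ.src t ≠ Γ.tgt t}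
    {Γ' : ColGraph m v e}
    (h₁ : ∀ a, (Γ.tgt t).succAbove (Γ'.src a) =
      if Γ.src (t.succAbove a) = Γ.tgt t then Γ.src t else Γ.src (t.succAbove a))
    (h₂ : ∀ a, (Γ.tgt t).succAbove (Γ'.tgt a) =
      if Γ.tgt (t.succAbove a) = Γ.tgt t then Γ.src t else Γ.tgt (t.succAbove a))
    (h₃ : ∀ c a, Γ'.ori c a = Γ.ori c (t.succAbove a)) : Γ.contract t h = Γ' := by
  ext a
  · exact congrArg _ ((Γ.tgt t).succAbove_right_injective
      ((succAbove_mergeVertex _ _ h _).trans (h₁ a).symm))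
  · exact congrArg _ ((Γ.tgt t).succAbove_right_injective
      ((succAbove_mergeVertex _ _ h _).trans (h₂ a).symm))
  · exact (h₃ _ _).symm

lemma succAbove_contract_src (Γ : ColGraph m (v + 1) (e + 1)) (t : Fin (e + 1))
    (h : Γ.src t ≠ Γ.tgt t) (a : Fin e) : (Γ.tgt t).succAbove ((Γ.contract t h).src a) =
      if Γ.src (t.succAbove a) = Γ.tgt t then Γ.src t else Γ.src (t.succAbove a) :=
  succAbove_mergeVertex _ _ h _

lemma succAbove_contract_tgt (Γ : ColGraph m (v + 1) (e + 1)) (t : Fin (e + 1))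
    (h : Γ.src t ≠ Γ.tgt t) (a : Fin e) : (Γ.tgt t).succAbove ((Γ.contract t h).tgt a) =
      if Γ.tgt (t.succAbove a) = Γ.tgt t then Γ.src t else Γ.tgt (t.succAbove a) :=
  succAbove_mergeVertex _ _ h _

lemma contract_permVertices (Γ : ColGraph m (v + 1) (e + 1)) (σ : Equiv.Perm (Fin (v + 1)))
    (t : Fin (e + 1)) (h : Γ.src t ≠ Γ.tgt t)
    (h' : (Γ.permVertices σ).src t ≠ (Γ.permVertices σ).tgt t) :
    (Γ.permVertices σ).contract t h' =
      (Γ.contract t h).permVertices (removePerm σ (Γ.tgt t)) := by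
  refine eq_contract (fun a => ?_) (fun a => ?_) (fun c a => rfl)
  · refine (succAbove_removePerm σ (Γ.tgt t) _).trans ?_
    rw [succAbove_contract_src]
    simp only [permVertices, EmbeddingLike.apply_eq_iff_eq, apply_ite σ]
  · refine (succAbove_removePerm σ (Γ.tgt t) _).trans ?_
    rw [succAbove_contract_tgt]
    simp only [permVertices, EmbeddingLike.apply_eq_iff_eq, apply_ite σ]

lemma contract_permEdges (Γ : ColGraph m (v + 1) (e + 1)) (τ : Equiv.Perm (Fin (e + 1)))
    (t : Fin (e + 1)) (h : Γ.src t ≠ Γ.tgt t)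
    (h' : (Γ.permEdges τ).src (τ t) ≠ (Γ.permEdges τ).tgt (τ t)) :
    (Γ.permEdges τ).contract (τ t) h' =
      (Γ.contract t h).permEdges (removePerm τ t) := by
  have e₁ : (Γ.permEdges τ).src (τ t) = Γ.src t := congrArg Γ.src (τ.symm_apply_apply t)
  have e₂ : (Γ.permEdges τ).tgt (τ t) = Γ.tgt t := congrArg Γ.tgt (τ.symm_apply_apply t)
  refine eq_contract (fun a => ?_) (fun a => ?_) (fun c a => ?_)
  · rw [e₁, e₂]
    refine (succAbove_contract_src Γ t h _).trans ?_
    rw [succAbove_removePerm_symm]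
    rfl
  · rw [e₁, e₂]
    refine (succAbove_contract_tgt Γ t h _).trans ?_
    rw [succAbove_removePerm_symm]
    rfl
  · change Γ.ori c _ = Γ.ori c _
    rw [succAbove_removePerm_symm]

lemma contract_reverse_of_ne (Γ : ColGraph m (v + 1) (e + 1)) (t : Fin (e + 1)) (s : Fin e)
    (h : Γ.src t ≠ Γ.tgt t)
    (h' : (Γ.reverse (t.succAbove s)).src t ≠ (Γ.reverse (t.succAbove s)).tgt t) :
    (Γ.reverse (t.succAbove s)).contract t h' = (Γ.contract t h).reverse s := by
  have hne : t ≠ t.succAbove s := (Fin.succAbove_ne t s).symm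
  have e₁ : (Γ.reverse (t.succAbove s)).src t = Γ.src t := if_neg hne
  have e₂ : (Γ.reverse (t.succAbove s)).tgt t = Γ.tgt t := if_neg hne
  refine eq_contract (fun a => ?_) (fun a => ?_) (fun c a => ?_)
  · rw [e₁, e₂]
    simp only [reverse, t.succAbove_right_injective.eq_iff]
    split_ifs <;> simp_all [succAbove_contract_src, succAbove_contract_tgt]
  · rw [e₁, e₂]
    simp only [reverse, t.succAbove_right_injective.eq_iff]
    split_ifs <;> simp_all [succAbove_contract_src, succAbove_contract_tgt]
  · simp only [reverse, contract, t.succAbove_right_injective.eq_iff]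

/-- Contraction keeps the label of the source and drops that of the target. Reversing `t` exchanges
these roles, and the transposition of its two ends exchanges them back. -/
lemma contract_swap_reverse (Γ : ColGraph m (v + 1) (e + 1)) (t : Fin (e + 1))
    (h : Γ.src t ≠ Γ.tgt t)
    (h' : ((Γ.reverse t).permVertices (Equiv.swap (Γ.src t) (Γ.tgt t))).src t ≠
      ((Γ.reverse t).permVertices (Equiv.swap (Γ.src t) (Γ.tgt t))).tgt t) :
    ((Γ.reverse t).permVertices (Equiv.swap (Γ.src t) (Γ.tgt t))).contract t h' =
      Γ.contract t h := by
  have e₁ : ((Γ.reverse t).permVertices (Equiv.swap (Γ.src t) (Γ.tgt t))).src t = Γ.src t := by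
    simp [permVertices, reverse]
  have e₂ : ((Γ.reverse t).permVertices (Equiv.swap (Γ.src t) (Γ.tgt t))).tgt t = Γ.tgt t := by
    simp [permVertices, reverse]
  have key : ∀ w, (if Equiv.swap (Γ.src t) (Γ.tgt t) w = Γ.tgt t then Γ.src t else
      Equiv.swap (Γ.src t) (Γ.tgt t) w) = if w = Γ.tgt t then Γ.src t else w := by
    intro w
    rcases eq_or_ne w (Γ.src t) with rfl | h1
    · simp [h]
    rcases eq_or_ne w (Γ.tgt t) with rfl | h2
    · simp [h]
    rw [Equiv.swap_apply_of_ne_of_ne h1 h2]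
  refine eq_contract (fun a => ?_) (fun a => ?_) (fun c a => ?_)
  · rw [e₁, e₂, succAbove_contract_src, ← key]
    simp [permVertices, reverse]
  · rw [e₁, e₂, succAbove_contract_tgt, ← key]
    simp [permVertices, reverse]
  · simp [permVertices, reverse, contract]

/-- Both orders delete `p₁` and `p₂`, and the remaining vertices embed into the original ones in the
same way (`e4`). After this embedding both sides are explicit case distinctions on `w`. -/
lemma mergeVertex_mergeVertex {p₁ x₁ p₂ x₂ : Fin (v + 1 + 1)} (h₁ : x₁ ≠ p₁) (h₂ : x₂ ≠ p₂)
    (hne : p₁ ≠ p₂) (hn : ¬ (x₁ = p₂ ∧ x₂ = p₁)) {q y q' y' : Fin (v + 1)}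
    (hq : q = mergeVertex p₁ x₁ h₁ p₂) (hy : y = mergeVertex p₁ x₁ h₁ x₂)
    (hq' : q' = mergeVertex p₂ x₂ h₂ p₁) (hy' : y' = mergeVertex p₂ x₂ h₂ x₁)
    (hyq : y ≠ q) (hyq' : y' ≠ q') (w : Fin (v + 1 + 1)) :
    mergeVertex q y hyq (mergeVertex p₁ x₁ h₁ w) =
      mergeVertex q' y' hyq' (mergeVertex p₂ x₂ h₂ w) := by
  have e1 : p₁.succAbove q = p₂ := by rw [hq, succAbove_mergeVertex, if_neg hne.symm]
  have e2 : p₂.succAbove q' = p₁ := by rw [hq', succAbove_mergeVertex, if_neg hne]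
  have e3 : q' = q.predAbove p₁ := by
    apply p₂.succAbove_right_injective
    rw [e2, ← e1, Fin.succAbove_succAbove_predAbove]
  have e4 : ∀ k, p₂.succAbove (q'.succAbove k) = p₁.succAbove (q.succAbove k) := by
    intro k
    rw [e3, ← e1, Fin.succAbove_succAbove_succAbove_predAbove]
  have ey : p₁.succAbove y = if x₂ = p₁ then x₁ else x₂ := by rw [hy, succAbove_mergeVertex]
  have ey' : p₂.succAbove y' = if x₁ = p₂ then x₂ else x₁ := by rw [hy', succAbove_mergeVertex]
  have hi : Function.Injective fun k => p₁.succAbove (q.succAbove k) :=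
    p₁.succAbove_right_injective.comp q.succAbove_right_injective
  apply hi
  change p₁.succAbove (q.succAbove _) = p₁.succAbove (q.succAbove _)
  rw [← e4 (mergeVertex q' y' hyq' _), succAbove_mergeVertex, succAbove_mergeVertex,
    apply_ite p₁.succAbove, apply_ite p₂.succAbove, succAbove_mergeVertex, succAbove_mergeVertex,
    ey, ey']
  have c1 : mergeVertex p₁ x₁ h₁ w = q ↔ (if w = p₁ then x₁ else w) = p₂ := by
    rw [← p₁.succAbove_right_injective.eq_iff, succAbove_mergeVertex, e1]
  have c2 : mergeVertex p₂ x₂ h₂ w = q' ↔ (if w = p₂ then x₂ else w) = p₁ := by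
    rw [← p₂.succAbove_right_injective.eq_iff, succAbove_mergeVertex, e2]
  simp only [c1, c2]
  grind

/-- Here `s.predAbove t` is the label of `t` after `t.succAbove s` has been removed. Different
targets guarantee that both orders delete the same two labels. -/
lemma contract_contract (Γ : ColGraph m (v + 1 + 1) (e + 1 + 1)) (t : Fin (e + 2)) (s : Fin (e + 1))
    (ht : Γ.src t ≠ Γ.tgt t) (hu : Γ.src (t.succAbove s) ≠ Γ.tgt (t.succAbove s))
    (hs : (Γ.contract t ht).src s ≠ (Γ.contract t ht).tgt s)
    (hr : (Γ.contract (t.succAbove s) hu).src (s.predAbove t) ≠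
      (Γ.contract (t.succAbove s) hu).tgt (s.predAbove t))
    (hne : Γ.tgt t ≠ Γ.tgt (t.succAbove s)) :
    (Γ.contract t ht).contract s hs =
      (Γ.contract (t.succAbove s) hu).contract (s.predAbove t) hr := by
  have hut : (t.succAbove s).succAbove (s.predAbove t) = t :=
    Fin.succAbove_succAbove_predAbove t s
  have h5 : ∀ k, (t.succAbove s).succAbove ((s.predAbove t).succAbove k) =
      t.succAbove (s.succAbove k) :=
    fun k => Fin.succAbove_succAbove_succAbove_predAbove t s k
  have hs' : ¬ (Γ.src t = Γ.tgt (t.succAbove s) ∧ Γ.src (t.succAbove s) = Γ.tgt t) := by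
    rintro ⟨ha, hb⟩
    apply hs
    apply (Γ.tgt t).succAbove_right_injective
    rw [succAbove_contract_src, succAbove_contract_tgt, hb, if_pos rfl, if_neg hne.symm, ha]
  have key := mergeVertex_mergeVertex ht hu hne hs' (q := (Γ.contract t ht).tgt s)
    (y := (Γ.contract t ht).src s) (q' := (Γ.contract (t.succAbove s) hu).tgt (s.predAbove t))
    (y' := (Γ.contract (t.succAbove s) hu).src (s.predAbove t)) rfl rfl
    (congrArg (fun a => mergeVertex _ _ hu (Γ.tgt a)) hut)
    (congrArg (fun a => mergeVertex _ _ hu (Γ.src a)) hut) hs hr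
  ext a
  · refine congrArg _ ((key _).trans ?_)
    exact congrArg (fun b => mergeVertex _ _ hr (mergeVertex _ _ hu (Γ.src b))) (h5 a).symm
  · refine congrArg _ ((key _).trans ?_)
    exact congrArg (fun b => mergeVertex _ _ hr (mergeVertex _ _ hu (Γ.tgt b))) (h5 a).symm
  · exact congrArg (Γ.ori _) (h5 _).symm

/-! ### Cycles and contractions -/

lemma hasCycle_of_loop (Γ : ColGraph m v e) (a : Fin e) (h : Γ.src a = Γ.tgt a) (c : Fin m) :
    Γ.HasCycle c := by
  refine ⟨Γ.src a, .single ⟨a, ?_⟩⟩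
  rcases Γ.tail_eq c a with ⟨h₁, h₂, -⟩ | ⟨h₁, h₂, -⟩ <;> rw [h₁, h₂] <;> simp [h]

/-- A cycle maps to a cycle if every edge except one loopless edge maps to an edge. -/
lemma hasCycle_of_map {v' e' : ℕ} {Γ : ColGraph m v e} {Γ' : ColGraph m v' e'} (f : Fin v → Fin v')
    (c : Fin m) (t : Fin e) (ht : Γ.tail c t ≠ Γ.head c t) (hft : f (Γ.tail c t) = f (Γ.head c t))
    (hf : ∀ a, a ≠ t → ∃ b, Γ'.tail c b = f (Γ.tail c a) ∧ Γ'.head c b = f (Γ.head c a))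
    (h : Γ.HasCycle c) : Γ'.HasCycle c := by
  obtain ⟨x, hx⟩ := h
  have key : ∀ y, Relation.TransGen (fun y z => ∃ a, Γ.tail c a = y ∧ Γ.head c a = z) x y →
      Relation.TransGen (fun y z => ∃ a, Γ'.tail c a = y ∧ Γ'.head c a = z) (f x) (f y) ∨
        (x = Γ.tail c t ∧ y = Γ.head c t) := by
    intro y hy
    induction hy with
    | single h =>
      obtain ⟨a, rfl, rfl⟩ := h
      rcases eq_or_ne a t with rfl | ha
      · exact Or.inr ⟨rfl, rfl⟩
      · exact Or.inl (.single (hf a ha))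
    | tail _ h ih =>
      obtain ⟨a, rfl, rfl⟩ := h
      rcases eq_or_ne a t with rfl | ha
      · rcases ih with ih | ⟨-, ih⟩
        · exact Or.inl (hft ▸ ih)
        · exact absurd ih ht
      · rcases ih with ih | ⟨rfl, ih⟩
        · exact Or.inl (ih.tail (hf a ha))
        · rw [hft, ← ih]
          exact Or.inl (.single (hf a ha))
  rcases key x hx with h | ⟨h₁, h₂⟩
  · exact ⟨_, h⟩
  · exact absurd (h₁.symm.trans h₂) ht

section Contract

variable {Γ : ColGraph m (v + 1) (e + 1)} {t : Fin (e + 1)} {h : Γ.src t ≠ Γ.tgt t}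

lemma edgeMatch_contract (s : Fin e) :
    EdgeMatch Γ (Γ.contract t h) (Γ.contractMap t h) (t.succAbove s) s :=
  Or.inl ⟨rfl, rfl, fun _ => rfl⟩

lemma contractMap_eq_iff (u w : Fin (v + 1)) : Γ.contractMap t h u = Γ.contractMap t h w ↔
    u = w ∨ (u = Γ.tgt t ∧ w = Γ.src t) ∨ (u = Γ.src t ∧ w = Γ.tgt t) :=
  mergeVertex_eq_iff _ _ _ _ _

lemma contractMap_src : Γ.contractMap t h (Γ.src t) = Γ.contractMap t h (Γ.tgt t) :=
  (contractMap_eq_iff _ _).2 (Or.inr (Or.inr ⟨rfl, rfl⟩))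

/-- A cycle cannot consist of `t` alone, which is not a loop, so dropping `t` leaves a nontrivial
closed path. -/
lemma HasCycle.contract {c : Fin m} (hc : Γ.HasCycle c) : (Γ.contract t h).HasCycle c := by
  refine hasCycle_of_map (Γ.contractMap t h) c t ?_ ?_ (fun a ha => ?_) hc
  · rcases Γ.tail_eq c t with ⟨h₁, h₂, -⟩ | ⟨h₁, h₂, -⟩ <;> rw [h₁, h₂]
    · exact h
    · exact h.symm
  · rcases Γ.tail_eq c t with ⟨h₁, h₂, -⟩ | ⟨h₁, h₂, -⟩ <;> rw [h₁, h₂]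
    · exact contractMap_src
    · exact contractMap_src.symm
  · obtain ⟨s, rfl⟩ := Fin.exists_succAbove_eq ha
    exact ⟨s, (edgeMatch_contract s).tail c, (edgeMatch_contract s).head c⟩

lemma valence_contract_of_ne (x : Fin (v + 1)) (hs : x ≠ Γ.src t) (ht : x ≠ Γ.tgt t) :
    (Γ.contract t h).valence (Γ.contractMap t h x) = Γ.valence x := by
  rw [valence_eq_sum, valence_eq_sum, Fin.sum_univ_succAbove _ t, if_neg hs.symm, if_neg ht.symm,
    zero_add, zero_add]
  refine Finset.sum_congr rfl fun a _ => ?_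
  have : ∀ w, Γ.contractMap t h w = Γ.contractMap t h x ↔ w = x := by
    intro w
    rw [contractMap_eq_iff]
    tauto
  exact congrArg₂ _ (if_congr (this _) rfl rfl) (if_congr (this _) rfl rfl)

lemma valence_contract_src :
    (Γ.contract t h).valence (Γ.contractMap t h (Γ.src t)) + 2 =
      Γ.valence (Γ.src t) + Γ.valence (Γ.tgt t) := by
  rw [valence_eq_sum, valence_eq_sum, valence_eq_sum, Fin.sum_univ_succAbove _ t,
    Fin.sum_univ_succAbove (n := e) _ t, if_pos rfl, if_neg h.symm, if_neg h, if_pos rfl,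
    show ∀ A B : ℕ, 1 + 0 + A + (0 + 1 + B) = (A + B) + 2 by intros; ring, ← Finset.sum_add_distrib]
  congr 1
  refine Finset.sum_congr rfl fun a _ => ?_
  have : ∀ w, (if Γ.contractMap t h w = Γ.contractMap t h (Γ.src t) then 1 else 0) =
      (if w = Γ.src t then 1 else 0) + (if w = Γ.tgt t then 1 else 0) := by
    intro w
    simp only [contractMap_eq_iff]
    split_ifs <;> grind
  refine (congrArg₂ _ (this _) (this _)).trans ?_
  ring

lemma valence_contract_tgt :
    (Γ.contract t h).valence (Γ.contractMap t h (Γ.tgt t)) + 2 =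
      Γ.valence (Γ.src t) + Γ.valence (Γ.tgt t) := by
  rw [← contractMap_src, valence_contract_src]

/-- Oriented cycles are the only obstruction: the valence of the merged vertex is the sum of the two
valences minus 2, so the bounds 2 and 3 both survive. -/
lemma admissible_contract [NeZero m] (hΓ : Γ.IsAdmissible)
    (hac : ∀ c, ¬ (Γ.contract t h).HasCycle c) : (Γ.contract t h).IsAdmissible where
  nonempty := (Γ.contractMap t h (Γ.src t)).pos
  -- A loop is an oriented cycle in every colour. At least one colour is needed for this.
  loopless a ha := hac 0 (hasCycle_of_loop _ a ha 0)
  acyclic := hac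
  connected x y := by
    obtain ⟨x, rfl⟩ := mergeVertex_surjective _ _ h x
    obtain ⟨y, rfl⟩ := mergeVertex_surjective _ _ h y
    refine eqvGen_map (Γ.contractMap t h) ?_ (hΓ.connected x y)
    rintro x y ⟨a, rfl, rfl⟩
    rcases eq_or_ne a t with rfl | ha
    · rw [contractMap_src]
      exact .refl _
    · obtain ⟨s, rfl⟩ := Fin.exists_succAbove_eq ha
      exact .rel _ _ ⟨s, rfl, rfl⟩
  two_le_valence x := by
    obtain ⟨x, rfl⟩ := mergeVertex_surjective _ _ h x
    have hs := hΓ.two_le_valence (Γ.src t)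
    have ht := hΓ.two_le_valence (Γ.tgt t)
    have h1 := valence_contract_src (Γ := Γ) (t := t) (h := h)
    have h2 := valence_contract_tgt (Γ := Γ) (t := t) (h := h)
    by_cases hxs : x = Γ.src t
    · rw [hxs]; simp only [contractMap] at h1; omega
    by_cases hxt : x = Γ.tgt t
    · rw [hxt]; simp only [contractMap] at h2; omega
    exact (hΓ.two_le_valence x).trans_eq (valence_contract_of_ne x hxs hxt).symm
  exists_three_le_valence := by
    obtain ⟨x, hx⟩ := hΓ.exists_three_le_valence
    refine ⟨Γ.contractMap t h x, ?_⟩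
    have hs := hΓ.two_le_valence (Γ.src t)
    have ht := hΓ.two_le_valence (Γ.tgt t)
    have h1 := valence_contract_src (Γ := Γ) (t := t) (h := h)
    have h2 := valence_contract_tgt (Γ := Γ) (t := t) (h := h)
    by_cases hxs : x = Γ.src t
    · subst hxs; omega
    by_cases hxt : x = Γ.tgt t
    · subst hxt; omega
    rwa [valence_contract_of_ne x hxs hxt]

lemma exists_hasCycle_contract [NeZero m] (hΓ : Γ.IsAdmissible)
    (hn : ¬ (Γ.contract t h).IsAdmissible) : ∃ c, (Γ.contract t h).HasCycle c := by
  by_contra! hc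
  exact hn (admissible_contract hΓ hc)

end Contract

end ColGraph

/-! ### Signed contractions, and the differential on coinvariants. -/

section Terms

variable {K : Type u} [Field K] {m v e : ℕ} {n : ℤ}

open ColGraph

lemma contractSign_of_odd (hn : ¬ Even n) (p : Fin (v + 1)) (t : Fin (e + 1)) :
    contractSign K n p t = (-1) ^ (v - p.val) := if_neg hn

/-- The sign `(-1) ^ (v - p)` is that of moving `p` to the last place, so it absorbs the two powers
of `-1` in `sign_removePerm`. For odd `n` the edge plays no role, hence two unrelated edges are
allowed. -/
lemma contractSign_removePerm (hn : ¬ Even n) (σ : Equiv.Perm (Fin (v + 1))) (p : Fin (v + 1))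
    (t t' : Fin (e + 1)) :
    contractSign K n (σ p) t * ((Equiv.Perm.sign (removePerm σ p) : ℤ) : K) =
      ((Equiv.Perm.sign σ : ℤ) : K) * contractSign K n p t' := by
  rw [contractSign_of_odd hn, contractSign_of_odd hn, sign_removePerm]
  have h1 : ∀ q : Fin (v + 1), (-1 : K) ^ (v - q.val) * (-1) ^ q.val = (-1) ^ v := fun q => by
    rw [← pow_add, Nat.sub_add_cancel (Nat.lt_succ_iff.1 q.isLt)]
  have h2 : ∀ q : Fin (v + 1), (-1 : K) ^ (v - q.val) = (-1) ^ v * (-1) ^ q.val := fun q => by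
    rw [← h1 q, mul_assoc, ← mul_pow]
    simp
  push_cast
  rw [h2 p, ← h1 (σ p)]
  ring

/-- The signed value of a function of graphs at the contraction of the edge `t`. -/
def contractWith (K : Type u) [Field K] (n : ℤ) {M : Type*} [AddCommGroup M] [Module K M]
    (F : ColGraph m v e → M) (Γ : ColGraph m (v + 1) (e + 1)) (t : Fin (e + 1)) : M :=
  if h : Γ.src t ≠ Γ.tgt t then contractSign K n (Γ.tgt t) t • F (Γ.contract t h) else 0

variable {M : Type*} [AddCommGroup M] [Module K M]

lemma contractWith_of_ne (F : ColGraph m v e → M) (Γ : ColGraph m (v + 1) (e + 1))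
    (t : Fin (e + 1)) (h : Γ.src t ≠ Γ.tgt t) :
    contractWith K n F Γ t = contractSign K n (Γ.tgt t) t • F (Γ.contract t h) := dif_pos h

lemma contractWith_of_eq (F : ColGraph m v e → M) (Γ : ColGraph m (v + 1) (e + 1))
    (t : Fin (e + 1)) (h : Γ.src t = Γ.tgt t) : contractWith K n F Γ t = 0 := dif_neg (not_not.2 h)

/-- A function of graphs that changes by the sign under permutations of vertices, modulo `S`. -/
def VertexEquivariant (S : Submodule K M) (F : ColGraph m v e → M) : Prop :=
  ∀ (σ : Equiv.Perm (Fin v)) (Γ : ColGraph m v e),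
    F (Γ.permVertices σ) ≡ ((Equiv.Perm.sign σ : ℤ) : K) • F Γ [SMOD S]

variable {S : Submodule K M}

/-- The function `F` is kept general so that this also applies when `F` is itself a contraction, as
in `doubleTerm`. -/
lemma VertexEquivariant.contractWith (hn : ¬ Even n) {F : ColGraph m v e → M}
    (hF : VertexEquivariant S F) (t : Fin (e + 1)) :
    VertexEquivariant S fun Γ => contractWith K n F Γ t := by
  intro σ Γ
  by_cases h : Γ.src t = Γ.tgt t
  · have h' : (Γ.permVertices σ).src t = (Γ.permVertices σ).tgt t := congrArg σ h
    simp only [contractWith_of_eq F _ t h, contractWith_of_eq F _ t h', smul_zero, SModEq.rfl]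
  · have h' : (Γ.permVertices σ).src t ≠ (Γ.permVertices σ).tgt t := σ.injective.ne h
    simp only [contractWith_of_ne F _ t h, contractWith_of_ne F _ t h']
    rw [contract_permVertices Γ σ t h h', smul_smul,
      ← contractSign_removePerm hn σ (Γ.tgt t) t t, ← smul_smul]
    exact (hF _ _).smul _

/-- By `contract_swap_reverse` a reversal of `t` is undone by the transposition of its ends, which
costs `-1`. -/
lemma contractWith_reverse_self (hn : ¬ Even n) {F : ColGraph m v e → M}
    (hF : VertexEquivariant S F) (Γ : ColGraph m (v + 1) (e + 1)) (t : Fin (e + 1)) :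
    contractWith K n F (Γ.reverse t) t ≡ - contractWith K n F Γ t [SMOD S] := by
  by_cases h : Γ.src t = Γ.tgt t
  · have h' : (Γ.reverse t).src t = (Γ.reverse t).tgt t := by simp [reverse, h]
    rw [contractWith_of_eq F _ t h, contractWith_of_eq F _ t h', neg_zero]
  · have h' : ((Γ.reverse t).permVertices (Equiv.swap (Γ.src t) (Γ.tgt t))).src t ≠
        ((Γ.reverse t).permVertices (Equiv.swap (Γ.src t) (Γ.tgt t))).tgt t := by
      simpa [permVertices, reverse] using h
    have h1 := hF.contractWith (n := n) hn t (Equiv.swap (Γ.src t) (Γ.tgt t)) (Γ.reverse t)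
    rw [Equiv.Perm.sign_swap h] at h1
    simp only [contractWith_of_ne F _ t h'] at h1
    rw [contract_swap_reverse Γ t h h'] at h1
    have h2 : ((Γ.reverse t).permVertices (Equiv.swap (Γ.src t) (Γ.tgt t))).tgt t = Γ.tgt t := by
      simp [permVertices, reverse]
    rw [h2, ← contractWith_of_ne F Γ t h] at h1
    have h3 := h1.symm.neg
    simpa using h3

lemma contractWith_reverse_of_ne {F : ColGraph m v e → M} (s : Fin e)
    (hF : ∀ Γ, F (Γ.reverse s) ≡ - F Γ [SMOD S]) (Γ : ColGraph m (v + 1) (e + 1)) (t : Fin (e + 1)) :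
    contractWith K n F (Γ.reverse (t.succAbove s)) t ≡ - contractWith K n F Γ t [SMOD S] := by
  have hne : t ≠ t.succAbove s := (Fin.succAbove_ne t s).symm
  have e₁ : (Γ.reverse (t.succAbove s)).src t = Γ.src t := if_neg hne
  have e₂ : (Γ.reverse (t.succAbove s)).tgt t = Γ.tgt t := if_neg hne
  by_cases h : Γ.src t = Γ.tgt t
  · rw [contractWith_of_eq F _ t h, contractWith_of_eq F _ t (by rw [e₁, e₂, h]), neg_zero]
  · have h' : (Γ.reverse (t.succAbove s)).src t ≠ (Γ.reverse (t.succAbove s)).tgt t := by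
      rwa [e₁, e₂]
    rw [contractWith_of_ne F _ t h, contractWith_of_ne F _ t h',
      contract_reverse_of_ne Γ t s h h', e₂, ← smul_neg]
    exact (hF _).smul _

lemma contractWith_permEdges {F : ColGraph m v e → M} (hn : ¬ Even n)
    (hF : ∀ (τ : Equiv.Perm (Fin e)) Γ, F (Γ.permEdges τ) ≡ F Γ [SMOD S])
    (Γ : ColGraph m (v + 1) (e + 1)) (τ : Equiv.Perm (Fin (e + 1))) (t : Fin (e + 1)) :
    contractWith K n F (Γ.permEdges τ) (τ t) ≡ contractWith K n F Γ t [SMOD S] := by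
  have e₁ : (Γ.permEdges τ).src (τ t) = Γ.src t := congrArg Γ.src (τ.symm_apply_apply t)
  have e₂ : (Γ.permEdges τ).tgt (τ t) = Γ.tgt t := congrArg Γ.tgt (τ.symm_apply_apply t)
  by_cases h : Γ.src t = Γ.tgt t
  · rw [contractWith_of_eq F _ t h, contractWith_of_eq F _ (τ t) (by rw [e₁, e₂, h])]
  · have h' : (Γ.permEdges τ).src (τ t) ≠ (Γ.permEdges τ).tgt (τ t) := by rwa [e₁, e₂]
    rw [contractWith_of_ne F _ t h, contractWith_of_ne F _ _ h', contract_permEdges Γ τ t h h', e₂,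
      contractSign_of_odd hn, contractSign_of_odd hn]
    exact (hF _ _).smul _

/-- The signed contraction of an edge, or zero if the contraction is not admissible. -/
def term (K : Type u) [Field K] (n : ℤ) (Γ : ColGraph m (v + 1) (e + 1)) (t : Fin (e + 1)) :
    Chains K m := contractWith K n (basisVecOrZero K) Γ t

lemma term_of_ne (Γ : ColGraph m (v + 1) (e + 1)) (t : Fin (e + 1)) (h : Γ.src t ≠ Γ.tgt t) :
    term K n Γ t = contractSign K n (Γ.tgt t) t • basisVecOrZero K (Γ.contract t h) := dif_pos h

lemma term_of_eq (Γ : ColGraph m (v + 1) (e + 1)) (t : Fin (e + 1)) (h : Γ.src t = Γ.tgt t) :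
    term K n Γ t = 0 := dif_neg (not_not.2 h)

lemma term_eq_zero_of_hasCycle {Γ : ColGraph m (v + 1) (e + 1)} {c : Fin m} (hc : Γ.HasCycle c)
    (t : Fin (e + 1)) : term K n Γ t = 0 := by
  by_cases h : Γ.src t = Γ.tgt t
  · exact term_of_eq Γ t h
  · rw [term_of_ne Γ t h, basisVecOrZero_of_not_adm fun h' => h'.acyclic c hc.contract, smul_zero]

lemma vertexEquivariant_basisVecOrZero (hn : ¬ Even n) :
    VertexEquivariant (symSpan K m n) (basisVecOrZero K : ColGraph m v e → Chains K m) :=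
  fun σ Γ => basisVecOrZero_permVertices hn Γ σ

lemma vertexEquivariant_term (hn : ¬ Even n) (t : Fin (e + 1)) :
    VertexEquivariant (symSpan K m n)
      (fun Γ => term K n Γ t : ColGraph m (v + 1) (e + 1) → Chains K m) :=
  (vertexEquivariant_basisVecOrZero hn).contractWith hn t

lemma term_reverse (hn : ¬ Even n) (Γ : ColGraph m (v + 1) (e + 1)) (s t : Fin (e + 1)) :
    term K n (Γ.reverse s) t ≡ - term K n Γ t [SMOD symSpan K m n] := by
  rcases eq_or_ne s t with rfl | hs
  · exact contractWith_reverse_self hn (vertexEquivariant_basisVecOrZero hn) Γ s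
  · obtain ⟨s, rfl⟩ := Fin.exists_succAbove_eq hs
    exact contractWith_reverse_of_ne s (fun Γ => basisVecOrZero_reverse hn Γ s) Γ t

lemma term_permEdges (hn : ¬ Even n) (Γ : ColGraph m (v + 1) (e + 1))
    (τ : Equiv.Perm (Fin (e + 1))) (t : Fin (e + 1)) :
    term K n (Γ.permEdges τ) (τ t) ≡ term K n Γ t [SMOD symSpan K m n] :=
  contractWith_permEdges hn (fun τ Γ => basisVecOrZero_permEdges hn Γ τ) Γ τ t

lemma IsAdmissible.exists_succ {Γ : ColGraph m v e} (h : Γ.IsAdmissible) :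
    ∃ v' e', v = v' + 1 ∧ e = e' + 1 := by
  refine ⟨v - 1, e - 1, (Nat.succ_pred_eq_of_pos h.nonempty).symm, ?_⟩
  have h2 := h.two_le_valence ⟨0, h.nonempty⟩
  rcases e with - | e
  · simp [valence] at h2
  · rfl

lemma delta_basisVecOrZero {Γ : ColGraph m (v + 1) (e + 1)} (h : Γ.IsAdmissible) :
    delta K m n (basisVecOrZero K Γ) = ∑ t, term K n Γ t := by
  rw [basisVecOrZero_of_adm h, basisVec, delta, Finsupp.linearCombination_single, one_smul]
  exact Finset.sum_congr rfl fun t _ => (term_of_ne Γ t (h.loopless t)).symm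

lemma delta_symSpan (hn : ¬ Even n) : ∀ x ∈ symSpan K m n, delta K m n x ∈ symSpan K m n := by
  refine map_symSpan_le hn (delta K m n) _ ?_ ?_ ?_
  · intro v e Γ σ h
    obtain ⟨v, e, rfl, rfl⟩ := IsAdmissible.exists_succ h
    rw [delta_basisVecOrZero h, delta_basisVecOrZero ((Γ.iso_permVertices σ).admissible h),
      Finset.smul_sum]
    exact SModEq.sum fun t _ => vertexEquivariant_term hn t σ Γ
  · intro v e Γ σ h
    obtain ⟨v, e, rfl, rfl⟩ := IsAdmissible.exists_succ h
    rw [delta_basisVecOrZero h, delta_basisVecOrZero ((Γ.iso_permEdges σ).admissible h),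
      ← Equiv.sum_comp σ]
    exact SModEq.sum fun t _ => term_permEdges hn Γ σ t
  · intro v e Γ s h
    obtain ⟨v, e, rfl, rfl⟩ := IsAdmissible.exists_succ h
    rw [delta_basisVecOrZero h, delta_basisVecOrZero ((Γ.iso_reverse s).admissible h),
      ← Finset.sum_neg_distrib]
    exact SModEq.sum fun t _ => term_reverse hn Γ s t

/-! ### The square of the differential -/

/-- The signed contraction of two edges. -/
def doubleTerm (K : Type u) [Field K] (n : ℤ) (Γ : ColGraph m (v + 1 + 1) (e + 1 + 1))
    (t : Fin (e + 2)) (s : Fin (e + 1)) : Chains K m :=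
  contractWith K n (fun Γ' => term K n Γ' s) Γ t

/-- Removing the two vertices in the other order differs by the transposition of the last two
places. The cases are which of the two labels is smaller, as only removal of the smaller label
shifts the other. -/
lemma contractSign_mul_contractSign (hn : ¬ Even n) (p : Fin (v + 1 + 1)) (q : Fin (v + 1))
    (t t' : Fin (e + 1 + 1)) (s s' : Fin (e + 1)) :
    contractSign K n p t * contractSign K n q s +
      contractSign K n (p.succAbove q) t' * contractSign K n (q.predAbove p) s' = 0 := by
  simp only [contractSign_of_odd hn, ← pow_add]
  have hp := p.isLt
  have hq := q.isLt
  rcases Fin.lt_or_le q.castSucc p with h | h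
  · rw [Fin.succAbove_of_castSucc_lt _ _ h, Fin.predAbove_of_castSucc_lt _ _ h]
    have h' : q.val < p.val := h
    simp only [Fin.val_castSucc, Fin.val_pred]
    rw [show (v + 1 - q.val) + (v - (p.val - 1)) = ((v + 1 - p.val) + (v - q.val)) + 1 by omega,
      pow_succ]
    ring
  · rw [Fin.succAbove_of_le_castSucc _ _ h, Fin.predAbove_of_le_castSucc _ _ h]
    have h' : p.val ≤ q.val := h
    simp only [Fin.val_succ, Fin.coe_castPred]
    rw [show (v + 1 - p.val) + (v - q.val) = ((v + 1 - (q.val + 1)) + (v - p.val)) + 1 by omega,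
      pow_succ]
    ring

lemma doubleTerm_add_of_ne (hn : ¬ Even n) (Γ : ColGraph m (v + 1 + 1) (e + 1 + 1))
    (hΓ : ∀ a, Γ.src a ≠ Γ.tgt a) (t : Fin (e + 2)) (s : Fin (e + 1))
    (hne : Γ.tgt t ≠ Γ.tgt (t.succAbove s)) :
    doubleTerm K n Γ t s + doubleTerm K n Γ (t.succAbove s) (s.predAbove t) = 0 := by
  have ht := hΓ t
  have hu := hΓ (t.succAbove s)
  have hut : (t.succAbove s).succAbove (s.predAbove t) = t :=
    Fin.succAbove_succAbove_predAbove t s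
  rw [doubleTerm, doubleTerm, contractWith_of_ne _ _ _ ht, contractWith_of_ne _ _ _ hu]
  have e1 : (Γ.contract t ht).src s = (Γ.contract t ht).tgt s ↔
      (Γ.src t = Γ.tgt (t.succAbove s) ∧ Γ.src (t.succAbove s) = Γ.tgt t) := by
    rw [← (Γ.tgt t).succAbove_right_injective.eq_iff, succAbove_contract_src,
      succAbove_contract_tgt]
    grind
  have e2 : (Γ.contract (t.succAbove s) hu).src (s.predAbove t) =
      (Γ.contract (t.succAbove s) hu).tgt (s.predAbove t) ↔
      (Γ.src t = Γ.tgt (t.succAbove s) ∧ Γ.src (t.succAbove s) = Γ.tgt t) := by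
    rw [← (Γ.tgt (t.succAbove s)).succAbove_right_injective.eq_iff, succAbove_contract_src,
      succAbove_contract_tgt, hut]
    grind
  -- For two edges running in opposite directions between the same vertices, either contraction
  -- turns the other edge into a loop.
  by_cases hpar : Γ.src t = Γ.tgt (t.succAbove s) ∧ Γ.src (t.succAbove s) = Γ.tgt t
  · rw [term_of_eq _ _ (e1.2 hpar), term_of_eq _ _ (e2.2 hpar), smul_zero, smul_zero, add_zero]
  · have hs := mt e1.1 hpar
    have hr := mt e2.1 hpar
    rw [term_of_ne _ _ hs, term_of_ne _ _ hr, contract_contract Γ t s ht hu hs hr hne, smul_smul,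
      smul_smul, ← add_smul]
    have hq : (Γ.tgt t).succAbove ((Γ.contract t ht).tgt s) = Γ.tgt (t.succAbove s) := by
      rw [succAbove_contract_tgt, if_neg hne.symm]
    have hq' : (Γ.contract (t.succAbove s) hu).tgt (s.predAbove t) =
        ((Γ.contract t ht).tgt s).predAbove (Γ.tgt t) := by
      apply (Γ.tgt (t.succAbove s)).succAbove_right_injective
      rw [succAbove_contract_tgt, hut, if_neg hne]
      conv_rhs => rw [← hq]
      rw [Fin.succAbove_succAbove_predAbove]
    rw [hq', ← hq, contractSign_mul_contractSign hn, zero_smul]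

/-- If the targets agree, reversing one edge separates them and multiplies both double contractions
by `-1`. -/
lemma doubleTerm_add (hn : ¬ Even n) (Γ : ColGraph m (v + 1 + 1) (e + 1 + 1))
    (hΓ : ∀ a, Γ.src a ≠ Γ.tgt a) (t : Fin (e + 2)) (s : Fin (e + 1)) :
    doubleTerm K n Γ t s + doubleTerm K n Γ (t.succAbove s) (s.predAbove t) ∈ symSpan K m n := by
  by_cases hne : Γ.tgt t = Γ.tgt (t.succAbove s)
  · have h1 := doubleTerm_add_of_ne (K := K) hn (Γ.reverse (t.succAbove s)) (fun a => ?_) t s ?_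
    · have h2 : doubleTerm K n (Γ.reverse (t.succAbove s)) t s ≡ - doubleTerm K n Γ t s
          [SMOD symSpan K m n] :=
        contractWith_reverse_of_ne s (fun Γ => term_reverse hn Γ s s) Γ t
      have h3 : doubleTerm K n (Γ.reverse (t.succAbove s)) (t.succAbove s) (s.predAbove t) ≡
          - doubleTerm K n Γ (t.succAbove s) (s.predAbove t) [SMOD symSpan K m n] :=
        contractWith_reverse_self hn (vertexEquivariant_term hn _) Γ _
      have h4 := h2.add h3
      rw [h1, ← neg_add] at h4
      have h5 := h4.symm
      rw [SModEq.zero] at h5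
      exact neg_mem_iff.1 h5
    · have := hΓ a
      simp only [reverse]
      split_ifs
      · exact this.symm
      · exact this
    · have := hΓ (t.succAbove s)
      simp only [reverse, if_neg (Fin.succAbove_ne t s).symm, if_true, hne]
      exact this.symm
  · rw [doubleTerm_add_of_ne hn Γ hΓ t s hne]
    exact zero_mem _

lemma sum_doubleTerm_mem [CharZero K] (hn : ¬ Even n) (Γ : ColGraph m (v + 1 + 1) (e + 1 + 1))
    (hΓ : ∀ a, Γ.src a ≠ Γ.tgt a) : ∑ t, ∑ s, doubleTerm K n Γ t s ∈ symSpan K m n := by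
  rw [← Fintype.sum_prod_type' (f := fun t s => doubleTerm K n Γ t s)]
  -- Exchanging the order of the two contractions is an involution on the index pairs. Pairing each
  -- term with its image shows that twice the sum vanishes.
  have hinv : Function.Involutive
      (fun p : Fin (e + 2) × Fin (e + 1) => (p.1.succAbove p.2, p.2.predAbove p.1)) := by
    rintro ⟨t, s⟩
    have h1 : (t.succAbove s).succAbove (s.predAbove t) = t := Fin.succAbove_succAbove_predAbove t s
    refine Prod.ext h1 ?_
    apply t.succAbove_right_injective
    have h2 := Fin.succAbove_succAbove_predAbove (t.succAbove s) (s.predAbove t)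
    rw [h1] at h2
    exact h2
  have h2 : (2 : K) • ∑ p : Fin (e + 2) × Fin (e + 1), doubleTerm K n Γ p.1 p.2 ∈
      symSpan K m n := by
    rw [two_smul]
    nth_rw 2 [← Equiv.sum_comp hinv.toPerm]
    rw [← Finset.sum_add_distrib]
    exact Submodule.sum_mem _ fun p _ => doubleTerm_add hn Γ hΓ p.1 p.2
  exact (Submodule.smul_mem_iff _ two_ne_zero).1 h2

/-- A first contraction that is not admissible counts as zero on the left. On the right it contains
an oriented cycle, which survives the second contraction, so those terms vanish too. -/
lemma delta_term [NeZero m] {Γ : ColGraph m (v + 1 + 1) (e + 1 + 1)} (hΓ : Γ.IsAdmissible)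
    (t : Fin (e + 2)) : delta K m n (term K n Γ t) = ∑ s, doubleTerm K n Γ t s := by
  have ht := hΓ.loopless t
  simp only [doubleTerm, term_of_ne Γ t ht, contractWith_of_ne _ Γ t ht, map_smul,
    ← Finset.smul_sum]
  by_cases h : (Γ.contract t ht).IsAdmissible
  · rw [delta_basisVecOrZero h]
  · obtain ⟨c, hc⟩ := exists_hasCycle_contract hΓ h
    simp only [basisVecOrZero_of_not_adm h, map_zero, term_eq_zero_of_hasCycle hc,
      Finset.sum_const_zero]

lemma delta_delta_mem [NeZero m] [CharZero K] (hn : ¬ Even n) (x : Chains K m) :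
    delta K m n (delta K m n x) ∈ symSpan K m n := by
  induction x using Finsupp.induction_linear with
  | zero => simp
  | add x y hx hy => simpa using add_mem hx hy
  | single Γ a =>
    have h1 : (Finsupp.single Γ a : Chains K m) = a • basisVecOrZero K Γ.graph := by
      rw [basisVecOrZero_of_adm Γ.adm, basisVec, Finsupp.smul_single, smul_eq_mul, mul_one]
    rw [h1, map_smul, map_smul]
    refine Submodule.smul_mem _ _ ?_
    obtain ⟨Γ, h⟩ := Γ
    obtain ⟨v, e, rfl, rfl⟩ := IsAdmissible.exists_succ h
    rw [delta_basisVecOrZero h, map_sum]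
    -- A nonzero term supplies an admissible contraction, and with it the second vertex and second
    -- edge that `doubleTerm` needs.
    by_cases hall : ∀ t, term K n Γ t = 0
    · simp [hall]
    · push Not at hall
      obtain ⟨t, ht⟩ := hall
      have hadm : (Γ.contract t (h.loopless t)).IsAdmissible := by
        by_contra hna
        exact ht (by rw [term_of_ne Γ t (h.loopless t), basisVecOrZero_of_not_adm hna, smul_zero])
      obtain ⟨v, e, rfl, rfl⟩ := IsAdmissible.exists_succ hadm
      simp only [delta_term h]
      exact sum_doubleTerm_mem hn Γ h.loopless

lemma delta_degreePart (i j : ℤ) (hij : j + 1 = i) (x : Chains K m) (hx : x ∈ degreePart K m n i) :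
    delta K m n x ∈ degreePart K m n j := by
  suffices degreePart K m n i ≤ (degreePart K m n j).comap (delta K m n) from this hx
  rw [degreePart, Finsupp.supported_eq_span_single]
  refine Submodule.span_le.2 ?_
  rintro _ ⟨⟨Γ, h⟩, hΓ, rfl⟩
  obtain ⟨v, e, rfl, rfl⟩ := IsAdmissible.exists_succ h
  have h2 := delta_basisVecOrZero (K := K) (n := n) h
  rw [basisVecOrZero_of_adm h, basisVec] at h2
  change delta K m n _ ∈ degreePart K m n j
  rw [h2]
  refine Submodule.sum_mem _ fun t _ => ?_
  rw [term_of_ne Γ t (h.loopless t)]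
  refine Submodule.smul_mem _ _ ?_
  by_cases hadm : (Γ.contract t (h.loopless t)).IsAdmissible
  · rw [basisVecOrZero_of_adm hadm]
    refine Finsupp.single_mem_supported K _ ?_
    simp only [Set.mem_ofPred_eq, AdmGraph.degree] at hΓ ⊢
    push_cast at hΓ
    linarith
  · rw [basisVecOrZero_of_not_adm hadm]
    exact zero_mem _

end Terms

namespace ColGraph

variable {m k v e : ℕ}

/-! ### Edges at a vertex -/

/-- The vertex `x` is an end of the edge `a`. -/
def Meets (Γ : ColGraph m v e) (a : Fin e) (x : Fin v) : Prop := Γ.src a = x ∨ Γ.tgt a = x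

lemma meets_iff_tail_or_head (Γ : ColGraph m v e) (c : Fin m) (a : Fin e) (x : Fin v) :
    Γ.Meets a x ↔ Γ.tail c a = x ∨ Γ.head c a = x := by
  unfold Meets
  rcases Γ.tail_eq c a with ⟨h₁, h₂, -⟩ | ⟨h₁, h₂, -⟩ <;> rw [h₁, h₂]
  exact or_comm

lemma tail_ne_head {Γ : ColGraph m v e} {a : Fin e} (h : Γ.src a ≠ Γ.tgt a) (c : Fin m) :
    Γ.tail c a ≠ Γ.head c a := by
  rcases Γ.tail_eq c a with ⟨h₁, h₂, -⟩ | ⟨h₁, h₂, -⟩ <;> rw [h₁, h₂]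
  · exact h
  · exact h.symm

lemma Joins.meets_left {Γ : ColGraph m v e} {a : Fin e} {x y : Fin v} (h : Γ.Joins a x y) :
    Γ.Meets a x := by
  unfold Joins at h; unfold Meets; tauto

lemma Joins.symm {Γ : ColGraph m v e} {a : Fin e} {x y : Fin v} (h : Γ.Joins a x y) :
    Γ.Joins a y x := by
  unfold Joins at *; tauto

lemma Joins.meets_right {Γ : ColGraph m v e} {a : Fin e} {x y : Fin v} (h : Γ.Joins a x y) :
    Γ.Meets a y := h.symm.meets_left

lemma Meets.exists_joins {Γ : ColGraph m v e} {a : Fin e} {x : Fin v} (h : Γ.Meets a x) :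
    ∃ y, Γ.Joins a x y := by
  rcases h with h | h
  · exact ⟨_, Or.inl ⟨h, rfl⟩⟩
  · exact ⟨_, Or.inr ⟨rfl, h⟩⟩

/-- Two edges joining the same vertices have the same tail and head in every colour without
oriented cycles. -/
lemma joins_tail_head {Γ : ColGraph m v e} {c : Fin m} (hc : ¬ Γ.HasCycle c) {a b : Fin e}
    {x y : Fin v} (ha : Γ.Joins a x y) (hb : Γ.Joins b x y) :
    Γ.tail c a = Γ.tail c b ∧ Γ.head c a = Γ.head c b := by
  by_contra hne
  have key : Γ.tail c a = Γ.head c b ∧ Γ.head c a = Γ.tail c b := by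
    unfold Joins at ha hb
    rcases Γ.tail_eq c a with ⟨h₁, h₂, -⟩ | ⟨h₁, h₂, -⟩ <;>
      rcases Γ.tail_eq c b with ⟨h₃, h₄, -⟩ | ⟨h₃, h₄, -⟩ <;> grind
  exact hc ⟨_, .tail (.single ⟨a, rfl, rfl⟩) ⟨b, key.2.symm, key.1.symm⟩⟩

lemma valence_eq_card {Γ : ColGraph m v e} (hΓ : ∀ a, Γ.src a ≠ Γ.tgt a) (x : Fin v) :
    Γ.valence x = (Finset.univ.filter fun a => Γ.src a = x ∨ Γ.tgt a = x).card := by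
  rw [valence, Finset.filter_or, Finset.card_union_of_disjoint]
  refine Finset.disjoint_filter.2 fun a _ h₁ h₂ => hΓ a (h₁.trans h₂.symm)

lemma exists_two_edges {Γ : ColGraph m v e} (hΓ : ∀ a, Γ.src a ≠ Γ.tgt a) {x : Fin v}
    (hx : Γ.valence x = 2) : ∃ s t, s ≠ t ∧ ∀ a, Γ.Meets a x ↔ a = s ∨ a = t := by
  rw [valence_eq_card hΓ, Finset.card_eq_two] at hx
  obtain ⟨s, t, hst, h⟩ := hx
  refine ⟨s, t, hst, fun a => ?_⟩
  have := Finset.ext_iff.1 h a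
  simpa [Meets] using this

lemma eq_or_eq_of_meets {Γ : ColGraph m v e} (hΓ : ∀ a, Γ.src a ≠ Γ.tgt a) {x : Fin v}
    (hx : Γ.valence x = 2) {s t : Fin e} (hst : s ≠ t) (hs : Γ.Meets s x) (ht : Γ.Meets t x)
    {a : Fin e} (ha : Γ.Meets a x) : a = s ∨ a = t := by
  obtain ⟨s', t', -, h⟩ := exists_two_edges hΓ hx
  rw [h] at hs ht ha
  grind

lemma three_le_valence {Γ : ColGraph m v e} (hΓ : ∀ a, Γ.src a ≠ Γ.tgt a) {x : Fin v}
    {a b c : Fin e} (hab : a ≠ b) (hac : a ≠ c) (hbc : b ≠ c) (ha : Γ.Meets a x)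
    (hb : Γ.Meets b x) (hc : Γ.Meets c x) : 3 ≤ Γ.valence x := by
  rw [valence_eq_card hΓ]
  refine Finset.two_lt_card.2 ⟨a, ?_, b, ?_, c, ?_, hab, hac, hbc⟩ <;>
    rw [Finset.mem_filter] <;> exact ⟨Finset.mem_univ _, by assumption⟩

lemma passesIn_iff_of_two_edges {Γ : ColGraph m v e} {z : Fin v} {s t : Fin e}
    (hat : ∀ a, Γ.Meets a z ↔ a = s ∨ a = t) (hs : Γ.src s ≠ Γ.tgt s) (ht : Γ.src t ≠ Γ.tgt t)
    (c : Fin m) : Γ.PassesIn c z ↔ (Γ.head c s = z ↔ Γ.head c t ≠ z) := by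
  have h₁ := (Γ.meets_iff_tail_or_head c s z).1 ((hat s).2 (Or.inl rfl))
  have h₂ := (Γ.meets_iff_tail_or_head c t z).1 ((hat t).2 (Or.inr rfl))
  have h₃ := tail_ne_head hs c
  have h₄ := tail_ne_head ht c
  constructor
  · rintro ⟨⟨a, ha⟩, b, hb⟩
    have ha' := (hat a).1 ((Γ.meets_iff_tail_or_head c a z).2 (Or.inr ha))
    have hb' := (hat b).1 ((Γ.meets_iff_tail_or_head c b z).2 (Or.inl hb))
    grind
  · intro h
    by_cases hsz : Γ.head c s = z
    · exact ⟨⟨s, hsz⟩, t, by grind⟩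
    · exact ⟨⟨t, by grind⟩, s, by grind⟩

/-- A set of vertices that is closed under adjacency is everything in a connected graph. -/
lemma IsAdmissible.forall_of_closed {Γ : ColGraph m v e} (hΓ : Γ.IsAdmissible) {P : Fin v → Prop}
    (hP : ∀ a, P (Γ.src a) ↔ P (Γ.tgt a)) {x : Fin v} (hx : P x) (y : Fin v) : P y := by
  suffices P x ↔ P y from this.1 hx
  clear hx
  have := hΓ.connected x y
  induction this with
  | rel x y h => obtain ⟨a, rfl, rfl⟩ := h; exact hP a
  | refl x => rfl
  | symm x y _ ih => exact ih.symm
  | trans x y z _ _ ih₁ ih₂ => exact ih₁.trans ih₂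

end ColGraph

namespace ColGraph

variable {m k v e : ℕ}

/-! ### Inner vertices of skeleton edges -/

/-- A 2-valent vertex that is passing in every colour except possibly the last one. -/
def IsInner (Γ : ColGraph (k + 1) v e) (x : Fin v) : Prop :=
  Γ.valence x = 2 ∧ ∀ c : Fin k, Γ.PassesIn c.castSucc x

lemma isWeaklyPassing_iff (Γ : ColGraph (k + 1) v e) (x : Fin v) :
    Γ.IsWeaklyPassing x ↔ Γ.IsInner x ∧ ¬ Γ.PassesIn (Fin.last k) x := by
  unfold IsWeaklyPassing IsInner
  tauto

lemma isPassing_iff (Γ : ColGraph (k + 1) v e) (x : Fin v) :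
    Γ.IsPassing x ↔ Γ.IsInner x ∧ Γ.PassesIn (Fin.last k) x := by
  unfold IsPassing IsInner
  rw [Fin.forall_fin_succ']
  tauto

lemma IsInner.isWeaklyPassing_or {Γ : ColGraph (k + 1) v e} {x : Fin v} (h : Γ.IsInner x) :
    Γ.IsWeaklyPassing x ∨ Γ.IsPassing x := by
  rw [isWeaklyPassing_iff, isPassing_iff]
  tauto

lemma IsWeaklyPassing.isInner {Γ : ColGraph (k + 1) v e} {x : Fin v} (h : Γ.IsWeaklyPassing x) :
    Γ.IsInner x := ((Γ.isWeaklyPassing_iff x).1 h).1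

lemma Iso.isInner_iff {Γ Γ' : ColGraph (k + 1) v e} {σ : Equiv.Perm (Fin v)}
    {τ : Equiv.Perm (Fin e)} (h : Iso Γ Γ' σ τ) (x : Fin v) :
    Γ'.IsInner (σ x) ↔ Γ.IsInner x := by
  unfold IsInner
  rw [h.valence]
  simp only [h.passesIn_iff]

lemma Iso.meets_iff {Γ Γ' : ColGraph m v e} {σ : Equiv.Perm (Fin v)}
    {τ : Equiv.Perm (Fin e)} (h : Iso Γ Γ' σ τ) (a : Fin e) (x : Fin v) :
    Γ'.Meets (τ a) (σ x) ↔ Γ.Meets a x := by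
  unfold Meets
  rcases h a with ⟨h₁, h₂, -⟩ | ⟨h₁, h₂, -⟩ <;> rw [h₁, h₂] <;> simp [or_comm]

section Contract

variable {Γ : ColGraph m (v + 1) (e + 1)} {t : Fin (e + 1)} {h : Γ.src t ≠ Γ.tgt t}
  {z : Fin (v + 1)}

lemma contractMap_eq_iff_of_not_meets (hz : ¬ Γ.Meets t z) (u : Fin (v + 1)) :
    Γ.contractMap t h u = Γ.contractMap t h z ↔ u = z := by
  unfold Meets at hz
  rw [contractMap_eq_iff]
  grind

lemma meets_contract_iff (hz : ¬ Γ.Meets t z) (s : Fin e) :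
    (Γ.contract t h).Meets s (Γ.contractMap t h z) ↔ Γ.Meets (t.succAbove s) z :=
  or_congr (contractMap_eq_iff_of_not_meets hz _) (contractMap_eq_iff_of_not_meets hz _)

lemma valence_contract_of_not_meets (hz : ¬ Γ.Meets t z) :
    (Γ.contract t h).valence (Γ.contractMap t h z) = Γ.valence z := by
  unfold Meets at hz
  push Not at hz
  exact valence_contract_of_ne z hz.1.symm hz.2.symm

lemma passesIn_contract_iff (hz : ¬ Γ.Meets t z) (c : Fin m) :
    (Γ.contract t h).PassesIn c (Γ.contractMap t h z) ↔ Γ.PassesIn c z := by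
  have key : ∀ F : Fin (e + 1) → Fin (v + 1), (∀ a, F a = z → Γ.Meets a z) →
      ((∃ s, Γ.contractMap t h (F (t.succAbove s)) = Γ.contractMap t h z) ↔ ∃ a, F a = z) := by
    intro F hF
    simp only [contractMap_eq_iff_of_not_meets hz]
    refine ⟨fun ⟨s, hs⟩ => ⟨_, hs⟩, fun ⟨a, ha⟩ => ?_⟩
    have hat : a ≠ t := fun hat => hz (hat ▸ hF a ha)
    obtain ⟨s, rfl⟩ := Fin.exists_succAbove_eq hat
    exact ⟨s, ha⟩
  unfold PassesIn
  simp only [(edgeMatch_contract _).head, (edgeMatch_contract _).tail]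
  exact and_congr
    (key (Γ.head c) fun a ha => (Γ.meets_iff_tail_or_head c a z).2 (Or.inr ha))
    (key (Γ.tail c) fun a ha => (Γ.meets_iff_tail_or_head c a z).2 (Or.inl ha))

lemma isPassing_contract_iff (hz : ¬ Γ.Meets t z) :
    (Γ.contract t h).IsPassing (Γ.contractMap t h z) ↔ Γ.IsPassing z := by
  simp only [IsPassing, valence_contract_of_not_meets hz, passesIn_contract_iff hz]

lemma joins_contract {x y : Fin (v + 1)} {s : Fin e} (hs : Γ.Joins (t.succAbove s) x y) :
    (Γ.contract t h).Joins s (Γ.contractMap t h x) (Γ.contractMap t h y) := by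
  rcases hs with ⟨h₁, h₂⟩ | ⟨h₁, h₂⟩
  · exact Or.inl ⟨congrArg (Γ.contractMap t h) h₁, congrArg (Γ.contractMap t h) h₂⟩
  · exact Or.inr ⟨congrArg (Γ.contractMap t h) h₁, congrArg (Γ.contractMap t h) h₂⟩

lemma Joins.contractMap_eq {x y : Fin (v + 1)} (hxy : Γ.Joins t x y) :
    Γ.contractMap t h x = Γ.contractMap t h y := by
  rw [contractMap_eq_iff]
  unfold Joins at hxy
  grind

/-- Contracting one of two edges between the same vertices creates a loop. -/
lemma not_admissible_contract_of_joins {x y : Fin (v + 1)} {s : Fin e} (ht : Γ.Joins t x y)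
    (hs : Γ.Joins (t.succAbove s) x y) : ¬ (Γ.contract t h).IsAdmissible := by
  intro hadm
  have h1 := joins_contract (h := h) hs
  rw [ht.contractMap_eq (h := h)] at h1
  refine hadm.loopless s ?_
  rcases h1 with ⟨h₁, h₂⟩ | ⟨h₁, h₂⟩ <;> rw [h₁, h₂]

end Contract

section ContractInner

variable {Γ : ColGraph (k + 1) (v + 1) (e + 1)} {t : Fin (e + 1)} {h : Γ.src t ≠ Γ.tgt t}
  {z : Fin (v + 1)}

lemma isInner_contract_iff (hz : ¬ Γ.Meets t z) :
    (Γ.contract t h).IsInner (Γ.contractMap t h z) ↔ Γ.IsInner z := by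
  simp only [IsInner, valence_contract_of_not_meets hz, passesIn_contract_iff hz]

lemma isWeaklyPassing_contract_iff (hz : ¬ Γ.Meets t z) :
    (Γ.contract t h).IsWeaklyPassing (Γ.contractMap t h z) ↔ Γ.IsWeaklyPassing z := by
  simp only [IsWeaklyPassing, valence_contract_of_not_meets hz, passesIn_contract_iff hz]

end ContractInner

/-! ### Cycles avoiding a vertex -/

/-- A cycle does not meet a vertex that is not passing, so it is enough to map the edges away from
that vertex. -/
lemma hasCycle_of_map_of_not_passesIn {v' e' : ℕ} {Γ : ColGraph m v e} {Γ' : ColGraph m v' e'}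
    (f : Fin v → Fin v') (c : Fin m) (z : Fin v) (hz : ¬ Γ.PassesIn c z)
    (hf : ∀ a, ¬ Γ.Meets a z → ∃ b, Γ'.tail c b = f (Γ.tail c a) ∧ Γ'.head c b = f (Γ.head c a))
    (h : Γ.HasCycle c) : Γ'.HasCycle c := by
  obtain ⟨x, hx⟩ := h
  have hhead : ∀ y, Relation.TransGen (fun y z => ∃ a, Γ.tail c a = y ∧ Γ.head c a = z) x y →
      ∃ a, Γ.head c a = y := by
    intro y hy
    induction hy with
    | single h => obtain ⟨a, -, ha⟩ := h; exact ⟨a, ha⟩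
    | tail _ h _ => obtain ⟨a, -, ha⟩ := h; exact ⟨a, ha⟩
  have hxz : x ≠ z := by
    rintro rfl
    refine hz ⟨hhead _ hx, ?_⟩
    obtain ⟨y, ⟨a, ha, -⟩, -⟩ := Relation.TransGen.head'_iff.1 hx
    exact ⟨a, ha⟩
  have key : ∀ y, Relation.TransGen (fun y z => ∃ a, Γ.tail c a = y ∧ Γ.head c a = z) x y →
      y ≠ z →
      Relation.TransGen (fun y z => ∃ a, Γ'.tail c a = y ∧ Γ'.head c a = z) (f x) (f y) := by
    intro y hy
    induction hy with
    | single h =>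
      obtain ⟨a, rfl, rfl⟩ := h
      intro hne
      exact .single (hf a (by rw [meets_iff_tail_or_head _ c]; tauto))
    | tail h' h ih =>
      obtain ⟨a, rfl, rfl⟩ := h
      intro hne
      have hne' : Γ.tail c a ≠ z := fun hta => hz ⟨hta ▸ hhead _ h', a, hta⟩
      exact (ih hne').tail (hf a (by rw [meets_iff_tail_or_head _ c]; tauto))
  exact ⟨_, key x hx hxz⟩

/-! ### Toggling -/

section Toggle

variable (Γ : ColGraph (k + 1) v e) (z : Fin v)

lemma toggle_toggle : (Γ.toggle z).toggle z = Γ := by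
  ext a
  · rfl
  · rfl
  · simp only [toggle]
    split_ifs <;> simp

lemma toggle_tail_castSucc (c : Fin k) (a : Fin e) :
    (Γ.toggle z).tail c.castSucc a = Γ.tail c.castSucc a := by
  simp [tail, toggle, (Fin.castSucc_lt_last c).ne]

lemma toggle_head_castSucc (c : Fin k) (a : Fin e) :
    (Γ.toggle z).head c.castSucc a = Γ.head c.castSucc a := by
  simp [head, toggle, (Fin.castSucc_lt_last c).ne]

variable {Γ z}

lemma toggle_tail_of_meets {a : Fin e} (ha : Γ.Meets a z) :
    (Γ.toggle z).tail (Fin.last k) a = Γ.head (Fin.last k) a := by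
  have ha' : Γ.src a = z ∨ Γ.tgt a = z := ha
  simp only [tail, head, toggle, ha']
  cases Γ.ori (Fin.last k) a <;> simp

lemma toggle_head_of_meets {a : Fin e} (ha : Γ.Meets a z) :
    (Γ.toggle z).head (Fin.last k) a = Γ.tail (Fin.last k) a := by
  have ha' : Γ.src a = z ∨ Γ.tgt a = z := ha
  simp only [tail, head, toggle, ha']
  cases Γ.ori (Fin.last k) a <;> simp

lemma toggle_ori_of_not_meets {a : Fin e} (ha : ¬ Γ.Meets a z) (c : Fin (k + 1)) :
    (Γ.toggle z).ori c a = Γ.ori c a := by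
  have ha' : ¬ (Γ.src a = z ∨ Γ.tgt a = z) := ha
  simp [toggle, ha']

lemma toggle_tail_of_not_meets {a : Fin e} (ha : ¬ Γ.Meets a z) (c : Fin (k + 1)) :
    (Γ.toggle z).tail c a = Γ.tail c a := by
  rw [tail, tail, toggle_ori_of_not_meets ha]; rfl

lemma toggle_head_of_not_meets {a : Fin e} (ha : ¬ Γ.Meets a z) (c : Fin (k + 1)) :
    (Γ.toggle z).head c a = Γ.head c a := by
  rw [head, head, toggle_ori_of_not_meets ha]; rfl

lemma toggle_isInner (x : Fin v) : (Γ.toggle z).IsInner x ↔ Γ.IsInner x := by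
  unfold IsInner PassesIn
  simp only [toggle_tail_castSucc, toggle_head_castSucc]
  rfl

lemma toggle_passesIn_last (hz : ¬ Γ.PassesIn (Fin.last k) z) :
    ¬ (Γ.toggle z).PassesIn (Fin.last k) z := by
  rintro ⟨⟨a, ha⟩, b, hb⟩
  have ha' : Γ.Meets a z := (meets_iff_tail_or_head (Γ.toggle z) _ a z).2 (Or.inr ha)
  have hb' : Γ.Meets b z := (meets_iff_tail_or_head (Γ.toggle z) _ b z).2 (Or.inl hb)
  rw [toggle_head_of_meets ha'] at ha
  rw [toggle_tail_of_meets hb'] at hb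
  exact hz ⟨⟨b, hb⟩, a, ha⟩

lemma IsWeaklyPassing.toggle (hz : Γ.IsWeaklyPassing z) : (Γ.toggle z).IsWeaklyPassing z := by
  rw [isWeaklyPassing_iff] at *
  exact ⟨(toggle_isInner z).2 hz.1, toggle_passesIn_last hz.2⟩

/-- Only the last colour changes, and in it `z` remains a sink or a source. A cycle in that colour
therefore avoids the toggled edges. -/
lemma admissible_toggle (hz : Γ.IsWeaklyPassing z) (hΓ : Γ.IsAdmissible) :
    (Γ.toggle z).IsAdmissible where
  nonempty := hΓ.nonempty
  loopless := hΓ.loopless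
  acyclic c hc := by
    refine Fin.lastCases (motive := fun c => (Γ.toggle z).HasCycle c → False) ?_ (fun c hc => ?_) c hc
    · intro hc
      refine hΓ.acyclic _ (hasCycle_of_map_of_not_passesIn id _ z
        ((isWeaklyPassing_iff _ _).1 hz.toggle).2 (fun a ha => ⟨a, ?_, ?_⟩) hc)
      · exact (toggle_tail_of_not_meets (Γ := Γ) ha _).symm
      · exact (toggle_head_of_not_meets (Γ := Γ) ha _).symm
    · obtain ⟨x, hx⟩ := hc
      simp only [toggle_tail_castSucc, toggle_head_castSucc] at hx
      exact hΓ.acyclic _ ⟨x, hx⟩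
  connected := hΓ.connected
  two_le_valence := hΓ.two_le_valence
  exists_three_le_valence := hΓ.exists_three_le_valence

lemma admissible_toggle_iff (hz : Γ.IsWeaklyPassing z) :
    (Γ.toggle z).IsAdmissible ↔ Γ.IsAdmissible :=
  ⟨fun h => by simpa only [toggle_toggle] using admissible_toggle hz.toggle h, admissible_toggle hz⟩

end Toggle

/-- In a long skeleton edge, toggling a weakly passing vertex makes its weakly passing neighbour
passing. -/
lemma isPassing_toggle {Γ : ColGraph (k + 1) v e} (hΓ : Γ.IsAdmissible) {a : Fin e} {y z : Fin v}
    (ha : Γ.Joins a y z) (hy : Γ.IsWeaklyPassing y) (hz : Γ.IsWeaklyPassing z) :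
    (Γ.toggle y).IsPassing z := by
  have hyz : y ≠ z := by
    rintro rfl
    unfold Joins at ha
    exact hΓ.loopless a (by grind)
  obtain ⟨s, t, hst, hat⟩ := exists_two_edges hΓ.loopless hz.1
  wlog has : a = s generalizing s t
  · refine this t s hst.symm (fun a => by rw [hat, or_comm]) ?_
    exact ((hat a).1 ha.meets_right).resolve_left has
  subst has
  -- If both edges at `z` went to `y`, then `y` and `z` would be a whole component with only
  -- 2-valent vertices. So toggling `y` changes exactly one of the edges at `z`.
  have hty : ¬ Γ.Meets t y := by
    intro hty
    have hay := ha.meets_left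
    have htj : Γ.Joins t y z := by
      have := (hat t).2 (Or.inr rfl)
      unfold Meets at *; unfold Joins; grind
    have hclosed : ∀ x, x = y ∨ x = z := by
      refine hΓ.forall_of_closed (P := fun x => x = y ∨ x = z) (x := y) (fun b => ?_) (Or.inl rfl)
      have key : ∀ x, (x = y ∨ x = z) → Γ.Meets b x → Γ.Joins b y z := by
        rintro x (rfl | rfl) hb
        · rcases eq_or_eq_of_meets hΓ.loopless hy.1 hst hay hty hb with rfl | rfl
          · exact ha
          · exact htj
        · rcases (hat b).1 hb with rfl | rfl
          · exact ha
          · exact htj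
      constructor
      · intro hb
        have := key _ hb (Or.inl rfl)
        unfold Joins at this; grind
      · intro hb
        have := key _ hb (Or.inr rfl)
        unfold Joins at this; grind
    obtain ⟨x, hx⟩ := hΓ.exists_three_le_valence
    have := hy.1
    have := hz.1
    rcases hclosed x with rfl | rfl <;> omega
  rw [isPassing_iff]
  refine ⟨(toggle_isInner z).2 hz.isInner, ?_⟩
  have h1 := ((isWeaklyPassing_iff _ _).1 hz).2
  rw [passesIn_iff_of_two_edges hat (hΓ.loopless _) (hΓ.loopless _)] at h1
  rw [passesIn_iff_of_two_edges (Γ := Γ.toggle y) hat (hΓ.loopless _) (hΓ.loopless _),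
    toggle_head_of_meets ha.meets_left, toggle_head_of_not_meets hty]
  have h2 := tail_ne_head (hΓ.loopless a) (Fin.last k)
  have h3 := (meets_iff_tail_or_head Γ (Fin.last k) a z).1 ha.meets_right
  grind

end ColGraph

/-! ### Cancellation of the two contractions at a 2-valent vertex. -/

section Pair

variable {K : Type u} [Field K] {m v e : ℕ} {n : ℤ}

open ColGraph

/-- Exchanging the labels `s` and `t` in `Γ₂` is free. The contraction of `s` is then that of `s` in
`Γ₁` with the remaining edge at `z` reversed, which costs `-1`. The condition `hhead` says that the
colours of this edge match after the reversal; it holds for `Γ₂ = Γ₁` at a passing vertex and for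
the toggled graph at a weakly passing one. -/
lemma term_add_term_of_tgt (hn : ¬ Even n) {Γ₁ Γ₂ : ColGraph m (v + 1) (e + 1)} {z : Fin (v + 1)}
    {s t : Fin (e + 1)} (hst : s ≠ t) (hsrc : ∀ a, Γ₂.src a = Γ₁.src a)
    (htgt : ∀ a, Γ₂.tgt a = Γ₁.tgt a) (hs : Γ₁.src s ≠ Γ₁.tgt s) (ht : Γ₁.src t ≠ Γ₁.tgt t)
    (hat : ∀ a, Γ₁.Meets a z → a = s ∨ a = t)
    (hori : ∀ c a, a ≠ s → a ≠ t → Γ₂.ori c a = Γ₁.ori c a)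
    (hhead : ∀ c, Γ₂.head c s = z ↔ Γ₁.head c t ≠ z) (hsz : Γ₁.tgt s = z) (htz : Γ₁.tgt t = z) :
    term K n Γ₁ s + term K n Γ₂ t ∈ symSpan K m n := by
  have hts := hst.symm
  have h1 := term_permEdges (K := K) hn Γ₂ (Equiv.swap s t) t
  rw [Equiv.swap_apply_right] at h1
  set Γ₃ := Γ₂.permEdges (Equiv.swap s t) with hΓ₃
  have hsw : ∀ a, a ≠ s → a ≠ t → Equiv.swap s t a = a := fun a => Equiv.swap_apply_of_ne_of_ne
  have e1 : Γ₃.src s = Γ₁.src t := by simp [hΓ₃, permEdges, hsrc]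
  have e2 : Γ₃.tgt s = z := by simp [hΓ₃, permEdges, htgt, htz]
  have e3 : Γ₃.src t = Γ₁.src s := by simp [hΓ₃, permEdges, hsrc]
  have e4 : Γ₃.tgt t = z := by simp [hΓ₃, permEdges, htgt, hsz]
  have hne₃ : Γ₃.src s ≠ Γ₃.tgt s := by rw [e1, e2, ← htz]; exact ht
  obtain ⟨r, hr⟩ := Fin.exists_succAbove_eq hts
  have key : Γ₃.contract s hne₃ = (Γ₁.contract s hs).reverse r := by
    have hcase : ∀ a, a ≠ r → s.succAbove a ≠ s ∧ s.succAbove a ≠ t := fun a ha =>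
      ⟨Fin.succAbove_ne s a, fun h => ha (s.succAbove_right_injective (h.trans hr.symm))⟩
    have hoff : ∀ a, a ≠ r → ¬ Γ₁.Meets (s.succAbove a) z := fun a ha hm => by
      have := hcase a ha
      rcases hat _ hm with h | h <;> tauto
    refine eq_contract (fun a => ?_) (fun a => ?_) (fun c a => ?_)
    · rw [e1, e2, ← hsz]
      rcases eq_or_ne a r with rfl | ha
      · simp only [reverse, if_true]
        rw [succAbove_contract_tgt, hr, if_pos (htz.trans hsz.symm), e3, if_neg hs]
      · simp only [reverse, if_neg ha, succAbove_contract_src]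
        have h2 : Γ₃.src (s.succAbove a) = Γ₁.src (s.succAbove a) := by
          simp [hΓ₃, permEdges, hsrc, hsw _ (hcase a ha).1 (hcase a ha).2]
        have h3 : Γ₁.src (s.succAbove a) ≠ Γ₁.tgt s := fun h => hoff a ha (Or.inl (h.trans hsz))
        rw [h2, if_neg h3, if_neg h3]
    · rw [e1, e2, ← hsz]
      rcases eq_or_ne a r with rfl | ha
      · simp only [reverse, if_true]
        rw [succAbove_contract_src, hr, e4, if_neg (by rw [hsz, ← htz]; exact ht), if_pos hsz.symm]
      · simp only [reverse, if_neg ha, succAbove_contract_tgt]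
        have h2 : Γ₃.tgt (s.succAbove a) = Γ₁.tgt (s.succAbove a) := by
          simp [hΓ₃, permEdges, htgt, hsw _ (hcase a ha).1 (hcase a ha).2]
        have h3 : Γ₁.tgt (s.succAbove a) ≠ Γ₁.tgt s := fun h => hoff a ha (Or.inr (h.trans hsz))
        rw [h2, if_neg h3, if_neg h3]
    · rcases eq_or_ne a r with rfl | ha
      · simp only [reverse, if_true, contract, hr, hΓ₃, permEdges, Equiv.symm_swap,
          Equiv.swap_apply_right]
        have h2 := hhead c
        simp only [ColGraph.head, hsrc, htgt, hsz, htz] at h2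
        rw [hsz] at hs
        rw [htz] at ht
        cases h3 : Γ₂.ori c s <;> cases h4 : Γ₁.ori c t <;> simp_all
      · simp only [reverse, if_neg ha, contract, hΓ₃, permEdges, Equiv.symm_swap]
        rw [hsw _ (hcase a ha).1 (hcase a ha).2, hori _ _ (hcase a ha).1 (hcase a ha).2]
  have h2 : term K n Γ₃ s ≡ - term K n Γ₁ s [SMOD symSpan K m n] := by
    rw [term_of_ne _ _ hne₃, term_of_ne _ _ hs, key, e2, hsz, ← smul_neg]
    exact (basisVecOrZero_reverse hn _ _).smul _
  have h3 := h1.symm.trans h2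
  rw [SModEq.sub_mem, sub_neg_eq_add, add_comm] at h3
  exact h3

/-- The contractions of the two edges at a 2-valent vertex cancel, if the colours correspond. -/
lemma term_add_term (hn : ¬ Even n) {Γ₁ Γ₂ : ColGraph m (v + 1) (e + 1)} {z : Fin (v + 1)}
    {s t : Fin (e + 1)} (hst : s ≠ t) (hsrc : ∀ a, Γ₂.src a = Γ₁.src a)
    (htgt : ∀ a, Γ₂.tgt a = Γ₁.tgt a) (hs : Γ₁.src s ≠ Γ₁.tgt s) (ht : Γ₁.src t ≠ Γ₁.tgt t)
    (hat : ∀ a, Γ₁.Meets a z ↔ a = s ∨ a = t)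
    (hori : ∀ c a, a ≠ s → a ≠ t → Γ₂.ori c a = Γ₁.ori c a)
    (hhead : ∀ c, Γ₂.head c s = z ↔ Γ₁.head c t ≠ z) :
    term K n Γ₁ s + term K n Γ₂ t ∈ symSpan K m n := by
  -- Reversing an edge in both graphs multiplies both terms by `-1`, so both edges may be assumed to
  -- point to `z`.
  have step : ∀ r, (r = s ∨ r = t) →
      (term K n (Γ₁.reverse r) s + term K n (Γ₂.reverse r) t ∈ symSpan K m n) →
      term K n Γ₁ s + term K n Γ₂ t ∈ symSpan K m n := by
    intro r _ h
    have h1 := (term_reverse (K := K) hn Γ₁ r s).add (term_reverse (K := K) hn Γ₂ r t)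
    rw [← neg_add, SModEq.sub_mem, sub_neg_eq_add] at h1
    have h2 := sub_mem h1 h
    rwa [add_sub_cancel_left] at h2
  have hrev : ∀ (Γ : ColGraph m (v + 1) (e + 1)) r c a, (Γ.reverse r).head c a = Γ.head c a :=
    fun Γ r c a => (Γ.iso_reverse r a).head c
  have hmeets : ∀ (Γ : ColGraph m (v + 1) (e + 1)) r a, (Γ.reverse r).Meets a z ↔ Γ.Meets a z :=
    fun Γ r a => (Γ.iso_reverse r).meets_iff a z
  have hne : ∀ (Γ : ColGraph m (v + 1) (e + 1)) r a, Γ.src a ≠ Γ.tgt a →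
      (Γ.reverse r).src a ≠ (Γ.reverse r).tgt a := by
    intro Γ r a h
    simp only [reverse]
    split_ifs
    · exact h.symm
    · exact h
  have step2 : ∀ Γ₁ Γ₂ : ColGraph m (v + 1) (e + 1), (∀ a, Γ₂.src a = Γ₁.src a) →
      (∀ a, Γ₂.tgt a = Γ₁.tgt a) → Γ₁.src s ≠ Γ₁.tgt s → Γ₁.src t ≠ Γ₁.tgt t →
      (∀ a, Γ₁.Meets a z ↔ a = s ∨ a = t) →
      (∀ c a, a ≠ s → a ≠ t → Γ₂.ori c a = Γ₁.ori c a) →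
      (∀ c, Γ₂.head c s = z ↔ Γ₁.head c t ≠ z) → Γ₁.tgt s = z →
      term K n Γ₁ s + term K n Γ₂ t ∈ symSpan K m n := by
    intro Γ₁ Γ₂ hsrc htgt hs ht hat hori hhead hsz
    by_cases htz : Γ₁.tgt t = z
    · exact term_add_term_of_tgt hn hst hsrc htgt hs ht (fun a => (hat a).1) hori hhead hsz htz
    · have h1 := (term_reverse (K := K) hn Γ₁ t s).add (term_reverse (K := K) hn Γ₂ t t)
      rw [← neg_add, SModEq.sub_mem, sub_neg_eq_add] at h1
      have h2 := sub_mem h1 (term_add_term_of_tgt (K := K) (z := z) (Γ₁ := Γ₁.reverse t)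
        (Γ₂ := Γ₂.reverse t) hn hst ?_ ?_ (hne _ _ _ hs) (hne _ _ _ ht) ?_ ?_ ?_ ?_ ?_)
      · rwa [add_sub_cancel_left] at h2
      · intro a; simp only [reverse, hsrc, htgt]
      · intro a; simp only [reverse, hsrc, htgt]
      · intro a; rw [hmeets, hat]; exact id
      · intro c a h1 h2; simp only [reverse, if_neg h2]; exact hori c a h1 h2
      · intro c; rw [hrev, hrev]; exact hhead c
      · simp only [reverse, if_neg hst, hsz]
      · simp only [reverse, if_true]
        exact ((hat t).2 (Or.inr rfl)).resolve_right htz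
  by_cases hsz : Γ₁.tgt s = z
  · exact step2 Γ₁ Γ₂ hsrc htgt hs ht hat hori hhead hsz
  · refine step s (Or.inl rfl) (step2 (Γ₁.reverse s) (Γ₂.reverse s) ?_ ?_ (hne _ _ _ hs)
      (hne _ _ _ ht) ?_ ?_ ?_ ?_)
    · intro a; simp only [reverse, hsrc, htgt]
    · intro a; simp only [reverse, hsrc, htgt]
    · intro a; rw [hmeets, hat]
    · intro c a h1 h2; simp only [reverse, if_neg h1]; exact hori c a h1 h2
    · intro c; rw [hrev, hrev]; exact hhead c
    · simp only [reverse, if_true]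
      exact ((hat s).2 (Or.inl rfl)).resolve_right hsz

end Pair

/-! ### The relations of the quotient complexes and their stability under the differential. -/

section Relations

open ColGraph

variable {K : Type u} [Field K] {k v e : ℕ} {n : ℤ}

lemma symSpan_le_sgcRel : symSpan K (k + 1) n ≤ sgcRel K k n :=
  le_sup_left.trans le_sup_left

lemma basisVecOrZero_mem_of_isPassing (Γ : ColGraph (k + 1) v e) {z : Fin v}
    (hz : Γ.IsPassing z) : basisVecOrZero K Γ ∈ sgcRel K k n := by
  by_cases h : Γ.IsAdmissible
  · rw [basisVecOrZero_of_adm h]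
    exact Submodule.mem_sup_left (Submodule.mem_sup_right
      (Submodule.subset_span ⟨v, e, Γ, h, ⟨z, hz⟩, rfl⟩))
  · rw [basisVecOrZero_of_not_adm h]
    exact zero_mem _

lemma basisVecOrZero_add_toggle_mem [CharZero K] (Γ : ColGraph (k + 1) v e) {z : Fin v}
    (hz : Γ.IsWeaklyPassing z) :
    basisVecOrZero K Γ + basisVecOrZero K (Γ.toggle z) ∈ sgcRel K k n := by
  by_cases h : Γ.IsAdmissible
  · have h' := admissible_toggle hz h
    rw [basisVecOrZero_of_adm h, basisVecOrZero_of_adm h']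
    have h2 : (2⁻¹ : K) • (basisVec K Γ h + basisVec K (Γ.toggle z) h') ∈ sgcRel K k n :=
      Submodule.mem_sup_right (Submodule.mem_sup_right
        (Submodule.subset_span ⟨v, e, Γ, z, h, h', hz, rfl⟩))
    exact (Submodule.smul_mem_iff _ (inv_ne_zero two_ne_zero)).1 h2
  · have h' := mt (admissible_toggle_iff hz).1 h
    rw [basisVecOrZero_of_not_adm h, basisVecOrZero_of_not_adm h', add_zero]
    exact zero_mem _

/-- An edge between two inner vertices makes a graph vanish. -/
lemma basisVecOrZero_mem_of_joins_inner (Γ : ColGraph (k + 1) v e) {a : Fin e} {y z : Fin v}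
    (ha : Γ.Joins a y z) (hy : Γ.IsInner y) (hz : Γ.IsInner z) :
    basisVecOrZero K Γ ∈ sgcRel K k n := by
  rcases hy.isWeaklyPassing_or with hy | hy
  · rcases hz.isWeaklyPassing_or with hz | hz
    · by_cases h : Γ.IsAdmissible
      · rw [basisVecOrZero_of_adm h]
        refine Submodule.mem_sup_right (Submodule.mem_sup_left
          (Submodule.subset_span ⟨v, e, Γ, h, ⟨a, ?_⟩, rfl⟩))
        rcases ha with ⟨h₁, h₂⟩ | ⟨h₁, h₂⟩ <;> rw [h₁, h₂]
        · exact ⟨hy, hz⟩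
        · exact ⟨hz, hy⟩
      · rw [basisVecOrZero_of_not_adm h]
        exact zero_mem _
    · exact basisVecOrZero_mem_of_isPassing Γ hz
  · exact basisVecOrZero_mem_of_isPassing Γ hy

/-- The relation for skeleton edges of length at least 3 follows from the other ones. -/
lemma map_sgcRel_le {M : Type*} [AddCommGroup M] [Module K M]
    (f : Chains K (k + 1) →ₗ[K] M) (S : Submodule K M)
    (h₁ : ∀ x ∈ symSpan K (k + 1) n, f x ∈ S)
    (h₂ : ∀ {v e : ℕ} (Γ : ColGraph (k + 1) v e) (z : Fin v), Γ.IsAdmissible → Γ.IsPassing z →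
      f (basisVecOrZero K Γ) ∈ S)
    (h₃ : ∀ {v e : ℕ} (Γ : ColGraph (k + 1) v e) (z : Fin v), Γ.IsAdmissible →
      Γ.IsWeaklyPassing z → f (basisVecOrZero K Γ) + f (basisVecOrZero K (Γ.toggle z)) ∈ S) :
    ∀ x ∈ sgcRel K k n, f x ∈ S := by
  suffices sgcRel K k n ≤ S.comap f from this
  refine sup_le (sup_le h₁ (Submodule.span_le.2 ?_)) (sup_le (Submodule.span_le.2 ?_)
    (Submodule.span_le.2 ?_))
  · rintro _ ⟨v, e, Γ, h, ⟨z, hz⟩, rfl⟩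
    rw [← basisVecOrZero_of_adm h]
    exact h₂ Γ z h hz
  · rintro _ ⟨v, e, Γ, h, ⟨a, hy, hz⟩, rfl⟩
    rw [← basisVecOrZero_of_adm h]
    -- By `isPassing_toggle` the toggled graph has a passing vertex, so the toggle relation reduces
    -- to the graph with the long skeleton edge alone.
    have h4 := h₃ Γ _ h hy
    have h5 := h₂ _ _ (admissible_toggle hy h) (isPassing_toggle h (Or.inl ⟨rfl, rfl⟩) hy hz)
    have h6 := sub_mem h4 h5
    rwa [add_sub_cancel_right] at h6
  · rintro _ ⟨v, e, Γ, z, h, h', hz, rfl⟩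
    rw [← basisVecOrZero_of_adm h, ← basisVecOrZero_of_adm h']
    change f _ ∈ S
    rw [map_smul, map_add]
    exact S.smul_mem _ (h₃ Γ z h hz)

lemma sum_mem_of_pair {ι M : Type*} [Fintype ι] [AddCommGroup M] [Module K M]
    {S : Submodule K M} (F : ι → M) {s t : ι} (hst : s ≠ t) (h : F s + F t ∈ S)
    (hF : ∀ a, a ≠ s → a ≠ t → F a ∈ S) : ∑ a, F a ∈ S := by
  classical
  rw [← Finset.sum_erase_add _ _ (Finset.mem_univ s),
    ← Finset.sum_erase_add _ _ (Finset.mem_erase.2 ⟨hst.symm, Finset.mem_univ t⟩), add_assoc,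
    add_comm (F t)]
  refine add_mem (sum_mem fun a ha => ?_) h
  simp only [Finset.mem_erase] at ha
  exact hF a ha.2.1 ha.1

lemma term_mem {m : ℕ} {S : Submodule K (Chains K m)} (Γ : ColGraph m (v + 1) (e + 1))
    (t : Fin (e + 1))
    (h : ∀ h, (Γ.contract t h).IsAdmissible → basisVecOrZero K (Γ.contract t h) ∈ S) :
    term K n Γ t ∈ S := by
  by_cases hne : Γ.src t = Γ.tgt t
  · rw [term_of_eq Γ t hne]
    exact zero_mem _
  · rw [term_of_ne Γ t hne]
    refine S.smul_mem _ ?_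
    by_cases hadm : (Γ.contract t hne).IsAdmissible
    · exact h hne hadm
    · rw [basisVecOrZero_of_not_adm hadm]
      exact zero_mem _

lemma contract_toggle {Γ : ColGraph (k + 1) (v + 1) (e + 1)} {t : Fin (e + 1)} {z : Fin (v + 1)}
    (hz : ¬ Γ.Meets t z) (h : Γ.src t ≠ Γ.tgt t) :
    (Γ.toggle z).contract t h = (Γ.contract t h).toggle (Γ.contractMap t h z) := by
  refine eq_contract (fun a => ?_) (fun a => ?_) (fun c a => ?_)
  · exact succAbove_contract_src Γ t h a
  · exact succAbove_contract_tgt Γ t h a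
  · refine if_congr (and_congr Iff.rfl ?_) rfl rfl
    exact meets_contract_iff hz a

/-- Contractions away from the distinguished vertex preserve the relation there. The two
contractions at a passing vertex cancel each other. For a half-sum, each contraction in the graph
cancels the contraction of the other edge in the toggled graph. -/
lemma delta_sgcRel [CharZero K] (hn : ¬ Even n) :
    ∀ x ∈ sgcRel K k n, delta K (k + 1) n x ∈ sgcRel K k n := by
  refine map_sgcRel_le _ _ (fun x hx => symSpan_le_sgcRel (delta_symSpan hn x hx)) ?_ ?_
  · intro v e Γ z h hz
    obtain ⟨v, e, rfl, rfl⟩ := IsAdmissible.exists_succ h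
    rw [delta_basisVecOrZero h]
    obtain ⟨s, t, hst, hat⟩ := exists_two_edges h.loopless hz.1
    refine sum_mem_of_pair _ hst ?_ (fun a has hta => term_mem Γ a fun hne _ => ?_)
    · refine symSpan_le_sgcRel (term_add_term hn hst (fun _ => rfl) (fun _ => rfl) (h.loopless s)
        (h.loopless t) hat (fun _ _ _ _ => rfl) fun c => ?_)
      exact (passesIn_iff_of_two_edges hat (h.loopless s) (h.loopless t) c).1 (hz.2 c)
    · refine basisVecOrZero_mem_of_isPassing _ (z := Γ.contractMap a hne z) ?_
      rw [isPassing_contract_iff (by rw [hat]; tauto)]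
      exact hz
  · intro v e Γ z h hz
    obtain ⟨v, e, rfl, rfl⟩ := IsAdmissible.exists_succ h
    rw [delta_basisVecOrZero h, delta_basisVecOrZero (admissible_toggle hz h),
      ← Finset.sum_add_distrib]
    obtain ⟨s, t, hst, hat⟩ := exists_two_edges h.loopless hz.1
    have hpair : ∀ s t, s ≠ t → (∀ a, Γ.Meets a z ↔ a = s ∨ a = t) →
        term K n Γ s + term K n (Γ.toggle z) t ∈ sgcRel K k n := by
      intro s t hst hat
      refine symSpan_le_sgcRel (term_add_term hn hst (fun _ => rfl) (fun _ => rfl) (h.loopless s)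
        (h.loopless t) hat (fun c a has hta => ?_) fun c => ?_)
      · exact toggle_ori_of_not_meets (by rw [hat]; tauto) c
      · have hp := passesIn_iff_of_two_edges hat (h.loopless s) (h.loopless t)
        refine Fin.lastCases (motive := fun c => (Γ.toggle z).head c s = z ↔ Γ.head c t ≠ z) ?_
          (fun c => ?_) c
        · have h1 := ((isWeaklyPassing_iff _ _).1 hz).2
          have hsz := (hat s).2 (Or.inl rfl)
          rw [hp] at h1
          rw [toggle_head_of_meets hsz]
          have h2 := tail_ne_head (h.loopless s) (Fin.last k)
          have h3 := (meets_iff_tail_or_head Γ (Fin.last k) s z).1 hsz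
          grind
        · rw [toggle_head_castSucc]
          exact (hp _).1 (hz.2.1 c)
    refine sum_mem_of_pair _ hst ?_ (fun a has hta => ?_)
    · have h1 := add_mem (hpair s t hst hat)
        (hpair t s hst.symm fun a => by rw [hat, or_comm])
      convert h1 using 1
      abel
    · have hm : ¬ Γ.Meets a z := by rw [hat]; tauto
      have hne := h.loopless a
      rw [term_of_ne Γ a hne, term_of_ne (Γ.toggle z) a hne, contract_toggle hm hne]
      change contractSign K n (Γ.tgt a) a • _ + contractSign K n (Γ.tgt a) a • _ ∈ _
      rw [← smul_add]
      refine Submodule.smul_mem _ _ (basisVecOrZero_add_toggle_mem _ ?_)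
      exact (isWeaklyPassing_contract_iff hm).2 hz

lemma basisVecOrZero_mem_of_hasTadpole (Γ : ColGraph (k + 1) v e) (h : Γ.HasTadpole) :
    basisVecOrZero K Γ ∈ notadpRel K k n := by
  by_cases hadm : Γ.IsAdmissible
  · rw [basisVecOrZero_of_adm hadm]
    exact Submodule.mem_sup_right (Submodule.subset_span ⟨v, e, Γ, hadm, h, rfl⟩)
  · rw [basisVecOrZero_of_not_adm hadm]
    exact zero_mem _

lemma map_notadpRel_le {M : Type*} [AddCommGroup M] [Module K M]
    (f : Chains K (k + 1) →ₗ[K] M) (S : Submodule K M) (h₁ : ∀ x ∈ sgcRel K k n, f x ∈ S)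
    (h₂ : ∀ {v e : ℕ} (Γ : ColGraph (k + 1) v e), Γ.IsAdmissible → Γ.HasTadpole →
      f (basisVecOrZero K Γ) ∈ S) :
    ∀ x ∈ notadpRel K k n, f x ∈ S := by
  suffices notadpRel K k n ≤ S.comap f from this
  refine sup_le h₁ (Submodule.span_le.2 ?_)
  rintro _ ⟨v, e, Γ, h, ht, rfl⟩
  rw [← basisVecOrZero_of_adm h]
  exact h₂ Γ h ht

/-- Contracting one edge of a tadpole makes the other one a loop, and every other contraction keeps
the tadpole. -/
lemma delta_notadpRel [CharZero K] (hn : ¬ Even n) :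
    ∀ x ∈ notadpRel K k n, delta K (k + 1) n x ∈ notadpRel K k n := by
  refine map_notadpRel_le _ _ (fun x hx => sgcRel_le_notadpRel K k n (delta_sgcRel hn x hx)) ?_
  rintro v e Γ h ⟨z, x, hz, hzx⟩
  obtain ⟨v, e, rfl, rfl⟩ := IsAdmissible.exists_succ h
  rw [delta_basisVecOrZero h]
  refine sum_mem fun a _ => term_mem Γ a fun hne hadm => ?_
  by_cases ha : Γ.Meets a z
  · obtain ⟨s, t, hst, hat⟩ := exists_two_edges h.loopless hz.1
    obtain ⟨b, hba, hb⟩ : ∃ b, b ≠ a ∧ Γ.Meets b z := by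
      rcases (hat a).1 ha with rfl | rfl
      · exact ⟨t, hst.symm, (hat t).2 (Or.inr rfl)⟩
      · exact ⟨s, hst, (hat s).2 (Or.inl rfl)⟩
    obtain ⟨b, rfl⟩ := Fin.exists_succAbove_eq hba
    exact absurd hadm (not_admissible_contract_of_joins (hzx a ha) (hzx _ hb))
  · refine basisVecOrZero_mem_of_hasTadpole _ ⟨Γ.contractMap a hne z, Γ.contractMap a hne x,
      (isWeaklyPassing_contract_iff ha).2 hz, fun b hb => joins_contract (hzx _ ?_)⟩
    exact (meets_contract_iff ha b).1 hb

lemma isSubquotientComplex_of_stable [CharZero K] (hn : ¬ Even n)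
    (B : Submodule K (Chains K (k + 1))) (hB : sgcRel K k n ≤ B)
    (hstable : ∀ x ∈ B, delta K (k + 1) n x ∈ B) :
    IsSubquotientComplex (delta K (k + 1) n) (degreePart K (k + 1) n) ⊤ B where
  le := le_top
  degree := delta_degreePart
  stable_num _ _ := trivial
  stable_den := hstable
  sq_zero x _ := hB (symSpan_le_sgcRel (delta_delta_mem hn x))

end Relations

/-! ### Expanding a vertex -/

section ExtendPerm

variable {N : ℕ}

/-- The extension of a permutation by a fixed point at the last place. -/
def extendLast (σ : Equiv.Perm (Fin N)) : Equiv.Perm (Fin (N + 1)) :=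
  finSuccEquivLast.symm.permCongr (Equiv.optionCongr σ)

@[simp]
lemma extendLast_castSucc (σ : Equiv.Perm (Fin N)) (i : Fin N) :
    extendLast σ i.castSucc = (σ i).castSucc := by
  simp [extendLast, Equiv.permCongr_apply]

@[simp]
lemma extendLast_last (σ : Equiv.Perm (Fin N)) : extendLast σ (Fin.last N) = Fin.last N := by
  simp [extendLast, Equiv.permCongr_apply]

@[simp]
lemma extendLast_symm_castSucc (σ : Equiv.Perm (Fin N)) (i : Fin N) :
    (extendLast σ).symm i.castSucc = (σ.symm i).castSucc := by
  rw [Equiv.symm_apply_eq, extendLast_castSucc, Equiv.apply_symm_apply]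

@[simp]
lemma extendLast_symm_last (σ : Equiv.Perm (Fin N)) :
    (extendLast σ).symm (Fin.last N) = Fin.last N := by
  rw [Equiv.symm_apply_eq, extendLast_last]

lemma sign_extendLast (σ : Equiv.Perm (Fin N)) :
    Equiv.Perm.sign (extendLast σ) = Equiv.Perm.sign σ := by
  rw [extendLast, Equiv.Perm.sign_permCongr, Equiv.optionCongr_sign]

end ExtendPerm

namespace ColGraph

variable {m k v e : ℕ}

open Classical in
/-- A new last vertex and a new last edge from the vertex `x` to it, with orientations `o`, are
added. The sources of the edges in `p` and the targets of the edges in `q`, which should be equal to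
`x`, are moved to the new vertex. -/
def expand (Γ : ColGraph m v e) (p q : Fin e → Prop) (x : Fin v) (o : Fin m → Bool) :
    ColGraph m (v + 1) (e + 1) where
  src := Fin.lastCases (motive := fun _ => Fin (v + 1)) x.castSucc
    fun a => if p a then Fin.last v else (Γ.src a).castSucc
  tgt := Fin.lastCases (motive := fun _ => Fin (v + 1)) (Fin.last v)
    fun a => if q a then Fin.last v else (Γ.tgt a).castSucc
  ori c := Fin.lastCases (motive := fun _ => Bool) (o c) (Γ.ori c)

section Expand

variable (Γ : ColGraph m v e) (p q : Fin e → Prop) (x : Fin v) (o : Fin m → Bool)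

@[simp]
lemma expand_src_last : (Γ.expand p q x o).src (Fin.last e) = x.castSucc := by simp [expand]

@[simp]
lemma expand_tgt_last : (Γ.expand p q x o).tgt (Fin.last e) = Fin.last v := by simp [expand]

@[simp]
lemma expand_ori_last (c : Fin m) : (Γ.expand p q x o).ori c (Fin.last e) = o c := by
  simp [expand]

open Classical in
lemma expand_src_castSucc (a : Fin e) : (Γ.expand p q x o).src a.castSucc =
    if p a then Fin.last v else (Γ.src a).castSucc := by simp [expand]

open Classical in
lemma expand_tgt_castSucc (a : Fin e) : (Γ.expand p q x o).tgt a.castSucc =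
    if q a then Fin.last v else (Γ.tgt a).castSucc := by simp [expand]

@[simp]
lemma expand_ori_castSucc (c : Fin m) (a : Fin e) :
    (Γ.expand p q x o).ori c a.castSucc = Γ.ori c a := by simp [expand]

lemma expand_src_ne_tgt_last :
    (Γ.expand p q x o).src (Fin.last e) ≠ (Γ.expand p q x o).tgt (Fin.last e) := by
  rw [expand_src_last, expand_tgt_last]
  exact (Fin.castSucc_lt_last x).ne

lemma expand_permVertices (σ : Equiv.Perm (Fin v)) :
    (Γ.permVertices σ).expand p q (σ x) o =
      (Γ.expand p q x o).permVertices (extendLast σ) := by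
  refine ext_fields (fun a => ?_) (fun a => ?_) (fun c a => ?_)
  · refine Fin.lastCases ?_ (fun a => ?_) a
    · simp [permVertices]
    · simp only [permVertices, expand_src_castSucc]
      split_ifs <;> simp
  · refine Fin.lastCases ?_ (fun a => ?_) a
    · simp [permVertices]
    · simp only [permVertices, expand_tgt_castSucc]
      split_ifs <;> simp
  · rfl

lemma expand_permEdges (τ : Equiv.Perm (Fin e)) :
    (Γ.permEdges τ).expand (fun a => p (τ.symm a)) (fun a => q (τ.symm a)) x o =
      (Γ.expand p q x o).permEdges (extendLast τ) := by
  refine ext_fields (fun a => ?_) (fun a => ?_) (fun c a => ?_)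
  · refine Fin.lastCases ?_ (fun a => ?_) a
    · simp [permEdges]
    · simp [permEdges, expand_src_castSucc]
  · refine Fin.lastCases ?_ (fun a => ?_) a
    · simp [permEdges]
    · simp [permEdges, expand_tgt_castSucc]
  · refine Fin.lastCases ?_ (fun a => ?_) a
    · simp [permEdges]
    · simp [permEdges]

open Classical in
lemma expand_reverse (t : Fin e) {p' q' : Fin e → Prop} (hp : ∀ a, a ≠ t → (p' a ↔ p a))
    (hq : ∀ a, a ≠ t → (q' a ↔ q a)) (hpq : p' t ↔ q t) (hqp : q' t ↔ p t) :
    (Γ.reverse t).expand p' q' x o = (Γ.expand p q x o).reverse t.castSucc := by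
  have hl := (Fin.castSucc_lt_last t).ne'
  refine ext_fields (fun a => ?_) (fun a => ?_) (fun c a => ?_)
  · refine Fin.lastCases ?_ (fun a => ?_) a
    · simp [reverse, hl]
    · rcases eq_or_ne a t with rfl | h
      · simp only [reverse, expand_src_castSucc, expand_tgt_castSucc, if_true]
        exact if_congr hpq rfl rfl
      · simp only [reverse, expand_src_castSucc, Fin.castSucc_inj, if_neg h]
        exact if_congr (hp a h) rfl rfl
  · refine Fin.lastCases ?_ (fun a => ?_) a
    · simp [reverse, hl]
    · rcases eq_or_ne a t with rfl | h
      · simp only [reverse, expand_src_castSucc, expand_tgt_castSucc, if_true]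
        exact if_congr hqp rfl rfl
      · simp only [reverse, expand_tgt_castSucc, Fin.castSucc_inj, if_neg h]
        exact if_congr (hq a h) rfl rfl
  · refine Fin.lastCases ?_ (fun a => ?_) a
    · simp [reverse, hl]
    · by_cases h : a = t <;> simp [reverse, h]

variable {Γ p q x o}

lemma contractMap_expand_castSucc (y : Fin v) :
    (Γ.expand p q x o).contractMap (Fin.last e) (expand_src_ne_tgt_last Γ p q x o) y.castSucc =
      y := by
  have h := mergeVertex_succAbove _ _ (expand_src_ne_tgt_last Γ p q x o) y
  have h2 : ((Γ.expand p q x o).tgt (Fin.last e)).succAbove y = y.castSucc := by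
    rw [expand_tgt_last, Fin.succAbove_last]
  rwa [h2] at h

/-- Contraction of the new edge reverses the expansion. -/
lemma contract_expand_last (hp : ∀ a, p a → Γ.src a = x) (hq : ∀ a, q a → Γ.tgt a = x)
    (h : (Γ.expand p q x o).src (Fin.last e) ≠ (Γ.expand p q x o).tgt (Fin.last e)) :
    (Γ.expand p q x o).contract (Fin.last e) h = Γ := by
  refine eq_contract (fun a => ?_) (fun a => ?_) (fun c a => ?_)
  · rw [expand_tgt_last, expand_src_last, Fin.succAbove_last_apply, Fin.succAbove_last_apply,
      expand_src_castSucc]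
    split_ifs with h1 h2 h3
    · rw [hp a h1]
    · exact absurd rfl h2
    · exact absurd h3 (Fin.castSucc_lt_last _).ne
    · rfl
  · rw [expand_tgt_last, expand_src_last, Fin.succAbove_last_apply, Fin.succAbove_last_apply,
      expand_tgt_castSucc]
    split_ifs with h1 h2 h3
    · rw [hq a h1]
    · exact absurd rfl h2
    · exact absurd h3 (Fin.castSucc_lt_last _).ne
    · rfl
  · rw [Fin.succAbove_last_apply, expand_ori_castSucc]

end Expand

/-- Contraction of an old edge commutes with the expansion. -/
lemma contract_expand_castSucc (Γ : ColGraph m (v + 1) (e + 1)) (p q : Fin (e + 1) → Prop)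
    (x : Fin (v + 1)) (o : Fin m → Bool) (t : Fin (e + 1)) (hp : ¬ p t) (hq : ¬ q t)
    (h : Γ.src t ≠ Γ.tgt t)
    (h' : (Γ.expand p q x o).src t.castSucc ≠ (Γ.expand p q x o).tgt t.castSucc) :
    (Γ.expand p q x o).contract t.castSucc h' =
      (Γ.contract t h).expand (fun a => p (t.succAbove a)) (fun a => q (t.succAbove a))
        (Γ.contractMap t h x) o := by
  have hs : (Γ.expand p q x o).src t.castSucc = (Γ.src t).castSucc := by
    rw [expand_src_castSucc, if_neg hp]
  have ht : (Γ.expand p q x o).tgt t.castSucc = (Γ.tgt t).castSucc := by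
    rw [expand_tgt_castSucc, if_neg hq]
  have hl : t.castSucc.succAbove (Fin.last e) = Fin.last (e + 1) :=
    Fin.succAbove_ne_last_last (Fin.castSucc_lt_last t).ne
  have hl' : (Γ.tgt t).castSucc.succAbove (Fin.last v) = Fin.last (v + 1) :=
    Fin.succAbove_ne_last_last (Fin.castSucc_lt_last _).ne
  refine eq_contract (fun a => ?_) (fun a => ?_) (fun c a => ?_)
  · rw [hs, ht]
    refine Fin.lastCases ?_ (fun a => ?_) a
    · rw [hl, expand_src_last, expand_src_last, Fin.castSucc_succAbove_castSucc,
        succAbove_mergeVertex]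
      simp only [Fin.castSucc_inj]
      split_ifs <;> rfl
    · rw [Fin.castSucc_succAbove_castSucc, expand_src_castSucc, expand_src_castSucc]
      split_ifs with h1 h2 h3
      · exact absurd h2 (Fin.castSucc_lt_last _).ne'
      · exact hl'
      · rw [Fin.castSucc_succAbove_castSucc, succAbove_contract_src,
          if_pos (Fin.castSucc_injective _ h3)]
      · rw [Fin.castSucc_succAbove_castSucc, succAbove_contract_src,
          if_neg fun h4 => h3 (congrArg _ h4)]
  · rw [hs, ht]
    refine Fin.lastCases ?_ (fun a => ?_) a
    · rw [hl, expand_tgt_last, expand_tgt_last, hl', if_neg (Fin.castSucc_lt_last _).ne']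
    · rw [Fin.castSucc_succAbove_castSucc, expand_tgt_castSucc, expand_tgt_castSucc]
      split_ifs with h1 h2 h3
      · exact absurd h2 (Fin.castSucc_lt_last _).ne'
      · exact hl'
      · rw [Fin.castSucc_succAbove_castSucc, succAbove_contract_tgt,
          if_pos (Fin.castSucc_injective _ h3)]
      · rw [Fin.castSucc_succAbove_castSucc, succAbove_contract_tgt,
          if_neg fun h4 => h3 (congrArg _ h4)]
  · refine Fin.lastCases ?_ (fun a => ?_) a
    · rw [hl, expand_ori_last, expand_ori_last]
    · rw [Fin.castSucc_succAbove_castSucc, expand_ori_castSucc, expand_ori_castSucc]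
      rfl

section ExpandProperties

variable {Γ : ColGraph m v e} {p q : Fin e → Prop} {x : Fin v} {o : Fin m → Bool}

lemma not_meets_expand_last {y : Fin v} (hy : y ≠ x) :
    ¬ (Γ.expand p q x o).Meets (Fin.last e) y.castSucc := by
  rintro (h | h)
  · rw [expand_src_last] at h
    exact hy (Fin.castSucc_injective _ h).symm
  · rw [expand_tgt_last] at h
    exact (Fin.castSucc_lt_last y).ne' h

lemma meets_expand_last_iff (y : Fin (v + 1)) : (Γ.expand p q x o).Meets (Fin.last e) y ↔
    y = x.castSucc ∨ y = Fin.last v := by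
  unfold Meets
  rw [expand_src_last, expand_tgt_last, eq_comm, eq_comm (a := Fin.last v)]

lemma meets_expand_castSucc_last_iff (a : Fin e) :
    (Γ.expand p q x o).Meets a.castSucc (Fin.last v) ↔ p a ∨ q a := by
  unfold Meets
  rw [expand_src_castSucc, expand_tgt_castSucc]
  have := fun y : Fin v => (Fin.castSucc_lt_last y).ne
  split_ifs <;> simp_all

/-- Contracting the new edge recovers `Γ`, so the structure at a vertex other than `x` is read off
from the lemmas on contractions instead of being computed again. -/
lemma meets_expand_castSucc_iff (hp : ∀ a, p a → Γ.src a = x) (hq : ∀ a, q a → Γ.tgt a = x)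
    {y : Fin v} (hy : y ≠ x) (a : Fin e) :
    (Γ.expand p q x o).Meets a.castSucc y.castSucc ↔ Γ.Meets a y := by
  have h := meets_contract_iff (h := expand_src_ne_tgt_last Γ p q x o)
    (not_meets_expand_last hy) a
  rw [contractMap_expand_castSucc, Fin.succAbove_last_apply, contract_expand_last hp hq] at h
  exact h.symm

lemma valence_expand_castSucc (hp : ∀ a, p a → Γ.src a = x) (hq : ∀ a, q a → Γ.tgt a = x)
    {y : Fin v} (hy : y ≠ x) : (Γ.expand p q x o).valence y.castSucc = Γ.valence y := by
  have h := valence_contract_of_not_meets (h := expand_src_ne_tgt_last Γ p q x o)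
    (not_meets_expand_last hy)
  rw [contractMap_expand_castSucc, contract_expand_last hp hq] at h
  exact h.symm

open Classical in
lemma valence_expand_last :
    (Γ.expand p q x o).valence (Fin.last v) = 
      (∑ a, ((if p a then 1 else 0) + (if q a then 1 else 0))) + 1 := by
  have hne := fun y : Fin v => (Fin.castSucc_lt_last y).ne
  rw [valence_eq_sum, Fin.sum_univ_castSucc, expand_src_last, expand_tgt_last, if_pos rfl,
    if_neg (hne x), zero_add]
  congr 1
  refine Finset.sum_congr rfl fun a _ => ?_
  rw [expand_src_castSucc, expand_tgt_castSucc]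
  congr 1 <;> split_ifs <;> simp_all

lemma valence_expand_castSucc_self (hp : ∀ a, p a → Γ.src a = x)
    (hq : ∀ a, q a → Γ.tgt a = x) :
    (Γ.expand p q x o).valence x.castSucc + (Γ.expand p q x o).valence (Fin.last v) =
      Γ.valence x + 2 := by
  have h := valence_contract_src (h := expand_src_ne_tgt_last Γ p q x o)
  rw [contract_expand_last hp hq, expand_src_last, expand_tgt_last,
    contractMap_expand_castSucc] at h
  exact h.symm

/-- An oriented cycle in the expansion gives one in the graph. -/
lemma HasCycle.of_expand (hp : ∀ a, p a → Γ.src a = x) (hq : ∀ a, q a → Γ.tgt a = x) {c : Fin m}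
    (h : (Γ.expand p q x o).HasCycle c) : Γ.HasCycle c := by
  have h := h.contract (h := expand_src_ne_tgt_last Γ p q x o)
  rwa [contract_expand_last hp hq] at h

/-- A cycle in the expansion would survive contraction of the new edge and give one in `Γ`, whatever
the orientations `o`. Only the valences at the two ends of the new edge need a hypothesis. -/
lemma admissible_expand (hp : ∀ a, p a → Γ.src a = x) (hq : ∀ a, q a → Γ.tgt a = x)
    (hΓ : Γ.IsAdmissible) (h₁ : 2 ≤ (Γ.expand p q x o).valence x.castSucc)
    (h₂ : 2 ≤ (Γ.expand p q x o).valence (Fin.last v)) : (Γ.expand p q x o).IsAdmissible where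
  nonempty := Nat.succ_pos v
  loopless a := by
    refine Fin.lastCases (expand_src_ne_tgt_last Γ p q x o) (fun a => ?_) a
    rw [expand_src_castSucc, expand_tgt_castSucc]
    have := hΓ.loopless a
    split_ifs with hpa hqa hqa
    · exact absurd ((hp a hpa).trans (hq a hqa).symm) this
    · exact (Fin.castSucc_lt_last _).ne'
    · exact (Fin.castSucc_lt_last _).ne
    · exact (Fin.castSucc_injective _).ne this
  acyclic c hc := hΓ.acyclic c (hc.of_expand hp hq)
  connected := by
    have hx : Relation.EqvGen (fun y z => ∃ a, (Γ.expand p q x o).src a = y ∧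
        (Γ.expand p q x o).tgt a = z) x.castSucc (Fin.last v) :=
      .rel _ _ ⟨Fin.last e, expand_src_last _ _ _ _ _, expand_tgt_last _ _ _ _ _⟩
    have hs : ∀ y : Fin v, Relation.EqvGen (fun y z => ∃ a, (Γ.expand p q x o).src a = y ∧
        (Γ.expand p q x o).tgt a = z) y.castSucc x.castSucc := by
      intro y
      refine eqvGen_map Fin.castSucc ?_ (hΓ.connected y x)
      rintro _ _ ⟨a, rfl, rfl⟩
      have h3 : Relation.EqvGen (fun y z => ∃ a, (Γ.expand p q x o).src a = y ∧
        (Γ.expand p q x o).tgt a = z) ((Γ.expand p q x o).src a.castSucc)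
          ((Γ.expand p q x o).tgt a.castSucc) := .rel _ _ ⟨_, rfl, rfl⟩
      rw [expand_src_castSucc, expand_tgt_castSucc] at h3
      split_ifs at h3 with hpa hqa hqa
      · rw [hp a hpa, hq a hqa]
        exact .refl _
      · rw [hp a hpa]
        exact .trans _ _ _ hx h3
      · rw [hq a hqa]
        exact .trans _ _ _ h3 (.symm _ _ hx)
      · exact h3
    have hall : ∀ y, Relation.EqvGen (fun y z => ∃ a, (Γ.expand p q x o).src a = y ∧
        (Γ.expand p q x o).tgt a = z) y x.castSucc :=
      fun y => Fin.lastCases (.symm _ _ hx) hs y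
    exact fun y z => .trans _ _ _ (hall y) (.symm _ _ (hall z))
  two_le_valence y := by
    refine Fin.lastCases h₂ (fun y => ?_) y
    by_cases hy : y = x
    · rw [hy]; exact h₁
    · rw [valence_expand_castSucc hp hq hy]
      exact hΓ.two_le_valence y
  exists_three_le_valence := by
    obtain ⟨y, hy⟩ := hΓ.exists_three_le_valence
    by_cases hyx : y = x
    · subst hyx
      have h3 := valence_expand_castSucc_self (o := o) hp hq
      by_cases h4 : 3 ≤ (Γ.expand p q y o).valence y.castSucc
      · exact ⟨_, h4⟩
      · exact ⟨Fin.last v, by omega⟩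
    · exact ⟨y.castSucc, by rwa [valence_expand_castSucc hp hq hyx]⟩

end ExpandProperties

end ColGraph

/-! ### The differential of an expanded graph, and maps defined on graphs. -/

section ExpandTerms

open ColGraph

variable {K : Type u} [Field K] {m v e : ℕ} {n : ℤ}

/-- The sign is `+1` because the deleted vertex is already last. This produces the diagonal part of
both homotopies. -/
lemma term_expand_last (hn : ¬ Even n) {Γ : ColGraph m v e} {p q : Fin e → Prop} {x : Fin v}
    {o : Fin m → Bool} (hp : ∀ a, p a → Γ.src a = x) (hq : ∀ a, q a → Γ.tgt a = x) :
    term K n (Γ.expand p q x o) (Fin.last e) = basisVecOrZero K Γ := by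
  rw [term_of_ne _ _ (expand_src_ne_tgt_last Γ p q x o), contract_expand_last hp hq,
    expand_tgt_last, contractSign_of_odd hn, Fin.val_last, Nat.sub_self, pow_zero, one_smul]

/-- The extra sign comes from moving the deleted vertex past the new last one. It makes `δ h` cancel
against `h δ` wherever expansion and contraction commute. -/
lemma term_expand_castSucc (hn : ¬ Even n) (Γ : ColGraph m (v + 1) (e + 1))
    (p q : Fin (e + 1) → Prop) (x : Fin (v + 1)) (o : Fin m → Bool) (t : Fin (e + 1)) (hp : ¬ p t)
    (hq : ¬ q t) (h : Γ.src t ≠ Γ.tgt t) :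
    term K n (Γ.expand p q x o) t.castSucc = - contractSign K n (Γ.tgt t) t •
      basisVecOrZero K ((Γ.contract t h).expand (fun a => p (t.succAbove a))
        (fun a => q (t.succAbove a)) (Γ.contractMap t h x) o) := by
  have ht : (Γ.expand p q x o).tgt t.castSucc = (Γ.tgt t).castSucc := by
    rw [expand_tgt_castSucc, if_neg hq]
  have h' : (Γ.expand p q x o).src t.castSucc ≠ (Γ.expand p q x o).tgt t.castSucc := by
    rw [ht, expand_src_castSucc, if_neg hp]
    exact (Fin.castSucc_injective _).ne h
  rw [term_of_ne _ _ h', contract_expand_castSucc _ _ _ _ _ _ hp hq h, ht,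
    contractSign_of_odd hn, contractSign_of_odd hn, Fin.val_castSucc,
    Nat.sub_add_comm (Nat.lt_succ_iff.1 (Γ.tgt t).isLt), pow_succ, mul_neg_one]

lemma delta_basisVecOrZero_expand (hn : ¬ Even n) {Γ : ColGraph m v e} {p q : Fin e → Prop}
    {x : Fin v} {o : Fin m → Bool} (hp : ∀ a, p a → Γ.src a = x) (hq : ∀ a, q a → Γ.tgt a = x)
    (h : (Γ.expand p q x o).IsAdmissible) :
    delta K m n (basisVecOrZero K (Γ.expand p q x o)) =
      basisVecOrZero K Γ + ∑ t : Fin e, term K n (Γ.expand p q x o) t.castSucc := by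
  rw [delta_basisVecOrZero h, Fin.sum_univ_castSucc, term_expand_last hn hp hq, add_comm]

/-- The linear map given by a function of graphs. -/
def graphMap {M : Type*} [AddCommGroup M] [Module K M]
    (H : ∀ {v e : ℕ}, ColGraph m v e → M) : Chains K m →ₗ[K] M :=
  Finsupp.linearCombination K fun Γ : AdmGraph m => H Γ.graph

lemma graphMap_basisVecOrZero {M : Type*} [AddCommGroup M] [Module K M]
    (H : ∀ {v e : ℕ}, ColGraph m v e → M) {Γ : ColGraph m v e} (h : Γ.IsAdmissible) :
    graphMap (K := K) H (basisVecOrZero K Γ) = H Γ := by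
  rw [basisVecOrZero_of_adm h, graphMap, basisVec, Finsupp.linearCombination_single, one_smul]

end ExpandTerms

section GraphMap

open ColGraph

variable {K : Type u} [Field K] {m : ℕ} {n : ℤ}

lemma basisVecOrZero_mem_degreePart {v e : ℕ} (Γ : ColGraph m v e) {d : ℤ}
    (hd : ((v : ℤ) - 1) * n + (1 - n) * (e : ℤ) = d) :
    basisVecOrZero K Γ ∈ degreePart K m n d := by
  by_cases hadm : Γ.IsAdmissible
  · rw [basisVecOrZero_of_adm hadm]
    exact Finsupp.single_mem_supported K _ hd
  · rw [basisVecOrZero_of_not_adm hadm]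
    exact zero_mem _

/-- A map of graphs that adds one vertex and one edge raises degrees by one. -/
lemma graphMap_mem_degreePart (H : ∀ {v e : ℕ}, ColGraph m v e → Chains K m)
    (hH : ∀ {v e : ℕ} (Γ : ColGraph m v e) (d : ℤ),
      (((v + 1 : ℕ) : ℤ) - 1) * n + (1 - n) * ((e + 1 : ℕ) : ℤ) = d → H Γ ∈ degreePart K m n d)
    (i j : ℤ) (hij : j + 1 = i) (x : Chains K m) (hx : x ∈ degreePart K m n j) :
    graphMap H x ∈ degreePart K m n i := by
  suffices degreePart K m n j ≤ (degreePart K m n i).comap (graphMap H) from this hx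
  rw [degreePart, Finsupp.supported_eq_span_single]
  refine Submodule.span_le.2 ?_
  rintro _ ⟨⟨Γ, h⟩, hΓ, rfl⟩
  have h2 := graphMap_basisVecOrZero (K := K) H h
  rw [basisVecOrZero_of_adm h, basisVec] at h2
  change graphMap H _ ∈ degreePart K m n i
  rw [h2]
  refine hH Γ i ?_
  simp only [Set.mem_ofPred_eq, AdmGraph.degree] at hΓ
  push_cast
  linarith

end GraphMap

namespace ColGraph

variable {m k v e : ℕ}

/-! ### Tadpoles -/

/-- `z` is a 2-valent vertex, both edges of which go to the vertex `x`. -/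
def TadpoleAt (Γ : ColGraph m v e) (z x : Fin v) : Prop :=
  z ≠ x ∧ Γ.valence z = 2 ∧ ∀ a, Γ.Meets a z → Γ.Joins a z x

lemma TadpoleAt.iso {Γ Γ' : ColGraph m v e} {σ : Equiv.Perm (Fin v)} {τ : Equiv.Perm (Fin e)}
    (h : Iso Γ Γ' σ τ) {z x : Fin v} (hz : Γ.TadpoleAt z x) : Γ'.TadpoleAt (σ z) (σ x) := by
  refine ⟨σ.injective.ne hz.1, by rw [h.valence]; exact hz.2.1, fun a ha => ?_⟩
  obtain ⟨a, rfl⟩ := τ.surjective a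
  rw [h.joins_iff]
  exact hz.2.2 a ((h.meets_iff a z).1 ha)

lemma Iso.tadpoleAt_iff {Γ Γ' : ColGraph m v e} {σ : Equiv.Perm (Fin v)} {τ : Equiv.Perm (Fin e)}
    (h : Iso Γ Γ' σ τ) {z x : Fin v} : Γ'.TadpoleAt (σ z) (σ x) ↔ Γ.TadpoleAt z x :=
  ⟨fun hz => by simpa using hz.iso h.symm, fun hz => hz.iso h⟩

lemma exists_meets {Γ : ColGraph m v e} {z : Fin v} (hz : Γ.valence z ≠ 0) : ∃ a, Γ.Meets a z := by
  by_contra! h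
  unfold Meets at h
  push Not at h
  refine hz ?_
  rw [valence_eq_sum]
  refine Finset.sum_eq_zero fun a _ => ?_
  rw [if_neg (h a).1, if_neg (h a).2, add_zero]

lemma TadpoleAt.unique {Γ : ColGraph m v e} {z x y : Fin v} (hx : Γ.TadpoleAt z x)
    (hy : Γ.TadpoleAt z y) : x = y := by
  obtain ⟨a, ha⟩ := exists_meets (Γ := Γ) (z := z) (by rw [hx.2.1]; exact two_ne_zero)
  have h1 := hx.2.2 a ha
  have h2 := hy.2.2 a ha
  have h3 := hx.1
  unfold Joins at h1 h2
  grind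

lemma TadpoleAt.exists_ne {Γ : ColGraph m v e} (hΓ : ∀ a, Γ.src a ≠ Γ.tgt a) {z x : Fin v}
    (hz : Γ.TadpoleAt z x) {a : Fin e} (ha : Γ.Meets a z) : ∃ b, b ≠ a ∧ Γ.Meets b z := by
  obtain ⟨s, t, hst, hat⟩ := exists_two_edges hΓ hz.2.1
  rcases (hat a).1 ha with rfl | rfl
  · exact ⟨t, hst.symm, (hat t).2 (Or.inr rfl)⟩
  · exact ⟨s, hst, (hat s).2 (Or.inl rfl)⟩

/-- If `x` were 2-valent, `z` and `x` would form a whole component without a vertex of valence at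
least 3. -/
lemma TadpoleAt.three_le_valence {Γ : ColGraph m v e} (hΓ : Γ.IsAdmissible) {z x : Fin v}
    (hz : Γ.TadpoleAt z x) : 3 ≤ Γ.valence x := by
  by_contra h3
  have hx2 : Γ.valence x = 2 := by have := hΓ.two_le_valence x; omega
  obtain ⟨a, ha⟩ := exists_meets (Γ := Γ) (z := z) (by rw [hz.2.1]; exact two_ne_zero)
  obtain ⟨b, hba, hb⟩ := hz.exists_ne hΓ.loopless ha
  have hja := hz.2.2 a ha
  have hjb := hz.2.2 b hb
  have hclosed : ∀ y, y = z ∨ y = x := by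
    refine hΓ.forall_of_closed (P := fun y => y = z ∨ y = x) (x := z) (fun c => ?_) (Or.inl rfl)
    have key : ∀ y, (y = z ∨ y = x) → Γ.Meets c y → Γ.Joins c z x := by
      rintro y (rfl | rfl) hc
      · exact hz.2.2 c hc
      · rcases eq_or_eq_of_meets hΓ.loopless hx2 hba hjb.meets_right hja.meets_right hc with
          rfl | rfl
        · exact hjb
        · exact hja
    constructor
    · intro hc
      have := key _ hc (Or.inl rfl)
      unfold Joins at this; grind
    · intro hc
      have := key _ hc (Or.inr rfl)
      unfold Joins at this; grind
  obtain ⟨y, hy⟩ := hΓ.exists_three_le_valence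
  have := hz.2.1
  rcases hclosed y with rfl | rfl <;> omega

section Contract

variable {Γ : ColGraph m (v + 1) (e + 1)} {t : Fin (e + 1)} {h : Γ.src t ≠ Γ.tgt t}

lemma TadpoleAt.contract {z x : Fin (v + 1)} (hz : Γ.TadpoleAt z x) (ht : ¬ Γ.Meets t z) :
    (Γ.contract t h).TadpoleAt (Γ.contractMap t h z) (Γ.contractMap t h x) := by
  refine ⟨fun hzx => hz.1 ((contractMap_eq_iff_of_not_meets ht x).1 hzx.symm).symm, ?_,
    fun a ha => joins_contract (hz.2.2 _ ((meets_contract_iff ht a).1 ha))⟩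
  rw [valence_contract_of_not_meets ht, hz.2.1]

lemma TadpoleAt.not_admissible_contract (hΓ : ∀ a, Γ.src a ≠ Γ.tgt a) {z x : Fin (v + 1)}
    (hz : Γ.TadpoleAt z x) (ht : Γ.Meets t z) : ¬ (Γ.contract t h).IsAdmissible := by
  obtain ⟨b, hbt, hb⟩ := hz.exists_ne hΓ ht
  obtain ⟨b, rfl⟩ := Fin.exists_succAbove_eq hbt
  exact not_admissible_contract_of_joins (hz.2.2 t ht) (hz.2.2 _ hb)

end Contract

/-- A tadpole with one colour is the same as a 2-valent vertex of this kind. -/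
lemma TadpoleAt.isWeaklyPassing {Γ : ColGraph (0 + 1) v e} (hΓ : Γ.IsAdmissible) {z x : Fin v}
    (hz : Γ.TadpoleAt z x) : Γ.IsWeaklyPassing z := by
  refine ⟨hz.2.1, fun c => c.elim0, ?_⟩
  rintro ⟨⟨a, ha⟩, b, hb⟩
  have ha' := hz.2.2 a ((meets_iff_tail_or_head Γ _ a z).2 (Or.inr ha))
  have hb' := hz.2.2 b ((meets_iff_tail_or_head Γ _ b z).2 (Or.inl hb))
  have h1 := joins_tail_head (hΓ.acyclic (Fin.last 0)) ha' hb'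
  exact tail_ne_head (hΓ.loopless a) _ (h1.1.trans (hb.trans ha.symm))

lemma hasTadpole_iff {Γ : ColGraph (0 + 1) v e} (hΓ : Γ.IsAdmissible) :
    Γ.HasTadpole ↔ ∃ z x, Γ.TadpoleAt z x := by
  constructor
  · rintro ⟨z, x, hz, hzx⟩
    refine ⟨z, x, ?_, hz.1, hzx⟩
    rintro rfl
    obtain ⟨a, ha⟩ := exists_meets (Γ := Γ) (z := z) (by rw [hz.1]; exact two_ne_zero)
    have h1 := hzx a ha
    have h2 := hΓ.loopless a
    unfold Joins at h1
    grind
  · rintro ⟨z, x, hz⟩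
    exact ⟨z, x, hz.isWeaklyPassing hΓ, hz.2.2⟩

/-! ### Pulling out a tadpole -/

/-- The tadpole with middle vertex `z` at `x` is moved to a new vertex, which is the end of a new
edge from `x`. -/
def pull (Γ : ColGraph m v e) (z x : Fin v) : ColGraph m (v + 1) (e + 1) :=
  Γ.expand (fun a => Γ.tgt a = z) (fun a => Γ.src a = z) x fun _ => false

section Pull

variable {Γ : ColGraph m v e} {z x : Fin v}

lemma TadpoleAt.src_eq (hz : Γ.TadpoleAt z x) (a : Fin e) (ha : Γ.tgt a = z) : Γ.src a = x := by
  have h1 := hz.2.2 a (Or.inr ha)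
  have h2 := hz.1
  unfold Joins at h1
  grind

lemma TadpoleAt.tgt_eq (hz : Γ.TadpoleAt z x) (a : Fin e) (ha : Γ.src a = z) : Γ.tgt a = x := by
  have h1 := hz.2.2 a (Or.inl ha)
  have h2 := hz.1
  unfold Joins at h1
  grind

lemma pull_permVertices (σ : Equiv.Perm (Fin v)) (Γ : ColGraph m v e) (z x : Fin v) :
    (Γ.permVertices σ).pull (σ z) (σ x) = (Γ.pull z x).permVertices (extendLast σ) := by
  rw [pull, pull, ← expand_permVertices]
  simp only [permVertices, EmbeddingLike.apply_eq_iff_eq]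

lemma pull_permEdges (τ : Equiv.Perm (Fin e)) (Γ : ColGraph m v e) (z x : Fin v) :
    (Γ.permEdges τ).pull z x = (Γ.pull z x).permEdges (extendLast τ) := by
  rw [pull, pull, ← expand_permEdges]
  rfl

lemma pull_reverse (t : Fin e) (Γ : ColGraph m v e) (z x : Fin v) :
    (Γ.reverse t).pull z x = (Γ.pull z x).reverse t.castSucc := by
  refine expand_reverse Γ _ _ x _ t (fun a h => ?_) (fun a h => ?_) ?_ ?_ <;>
    simp [reverse, *]

lemma TadpoleAt.pull (hz : Γ.TadpoleAt z x) :
    (Γ.pull z x).TadpoleAt z.castSucc (Fin.last v) := by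
  refine ⟨(Fin.castSucc_lt_last z).ne, ?_, fun a ha => ?_⟩
  · exact (valence_expand_castSucc hz.src_eq hz.tgt_eq hz.1).trans hz.2.1
  · revert ha
    refine Fin.lastCases (fun ha => ?_) (fun a ha => ?_) a
    · exact absurd ha (not_meets_expand_last hz.1)
    · have ha' := (meets_expand_castSucc_iff hz.src_eq hz.tgt_eq hz.1 a).1 ha
      unfold ColGraph.pull Joins
      rw [expand_src_castSucc, expand_tgt_castSucc]
      have h2 := hz.1
      rcases hz.2.2 a ha' with ⟨h3, h4⟩ | ⟨h3, h4⟩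
      · rw [if_neg (by rw [h4]; exact h2.symm), if_pos h3, h3]
        exact Or.inl ⟨rfl, rfl⟩
      · rw [if_pos h4, if_neg (by rw [h3]; exact h2.symm), h4]
        exact Or.inr ⟨rfl, rfl⟩

lemma TadpoleAt.pull_of_ne {w y : Fin v} (hz : Γ.TadpoleAt z x) (hy : Γ.TadpoleAt y w)
    (hyz : y ≠ z) (hyx : y ≠ x) : (Γ.pull z x).TadpoleAt y.castSucc w.castSucc := by
  refine ⟨(Fin.castSucc_injective _).ne hy.1, ?_, fun a ha => ?_⟩
  · exact (valence_expand_castSucc hz.src_eq hz.tgt_eq hyx).trans hy.2.1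
  · revert ha
    refine Fin.lastCases (fun ha => ?_) (fun a ha => ?_) a
    · exact absurd ha (not_meets_expand_last hyx)
    · have ha' := (meets_expand_castSucc_iff hz.src_eq hz.tgt_eq hyx a).1 ha
      have h1 : ¬ Γ.Meets a z := by
        intro h
        have h1 := hz.2.2 a h
        unfold Joins at h1
        unfold Meets at ha'
        grind
      unfold Meets at h1
      push Not at h1
      unfold ColGraph.pull Joins
      rw [expand_src_castSucc, expand_tgt_castSucc, if_neg h1.1, if_neg h1.2]
      simp only [Fin.castSucc_inj]
      exact hy.2.2 a ha'

lemma TadpoleAt.valence_pull_last (hz : Γ.TadpoleAt z x) :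
    (Γ.pull z x).valence (Fin.last v) = 3 := by
  have h1 := hz.2.1
  rw [valence_eq_sum] at h1
  rw [ColGraph.pull, valence_expand_last, Nat.succ_inj, ← h1]
  refine Finset.sum_congr rfl fun a _ => ?_
  rw [add_comm]
  congr

lemma TadpoleAt.admissible_pull (hΓ : Γ.IsAdmissible) (hz : Γ.TadpoleAt z x) :
    (Γ.pull z x).IsAdmissible := by
  have h1 := hz.valence_pull_last
  have h2 := valence_expand_castSucc_self (o := fun _ => false) hz.src_eq hz.tgt_eq
  have h3 := hz.three_le_valence hΓ
  unfold ColGraph.pull at h1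
  -- The end of the stem has valence 3, so `x` loses one half-edge on balance and keeps at least 2.
  exact admissible_expand hz.src_eq hz.tgt_eq hΓ (by omega) (by omega)

/-- If `z` is passing, the two tadpole edges already form a cycle, which moves along with the
tadpole. Otherwise the cycle avoids `z` and is untouched. -/
lemma TadpoleAt.hasCycle_pull (hz : Γ.TadpoleAt z x) {c : Fin m} (hc : Γ.HasCycle c) :
    (Γ.pull z x).HasCycle c := by
  have htail : ∀ a, Γ.Meets a z → Γ.head c a = z → (Γ.pull z x).head c a.castSucc = z.castSucc ∧
      (Γ.pull z x).tail c a.castSucc = Fin.last v := by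
    intro a ha ha2
    have h1 := hz.1
    have h2 := hz.1.symm
    unfold ColGraph.pull ColGraph.head ColGraph.tail
    rw [expand_src_castSucc, expand_tgt_castSucc, expand_ori_castSucc]
    unfold ColGraph.head at ha2
    rcases hz.2.2 a ha with ⟨h3, h4⟩ | ⟨h3, h4⟩ <;> cases hc : Γ.ori c a <;> simp_all
  have hhead : ∀ a, Γ.Meets a z → Γ.tail c a = z → (Γ.pull z x).tail c a.castSucc = z.castSucc ∧
      (Γ.pull z x).head c a.castSucc = Fin.last v := by
    intro a ha ha2
    have h1 := hz.1
    have h2 := hz.1.symm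
    unfold ColGraph.pull ColGraph.head ColGraph.tail
    rw [expand_src_castSucc, expand_tgt_castSucc, expand_ori_castSucc]
    unfold ColGraph.tail at ha2
    rcases hz.2.2 a ha with ⟨h3, h4⟩ | ⟨h3, h4⟩ <;> cases hc : Γ.ori c a <;> simp_all
  by_cases hp : Γ.PassesIn c z
  · obtain ⟨⟨a, ha⟩, b, hb⟩ := hp
    have ha' := htail a ((meets_iff_tail_or_head Γ _ a z).2 (Or.inr ha)) ha
    have hb' := hhead b ((meets_iff_tail_or_head Γ _ b z).2 (Or.inl hb)) hb
    exact ⟨z.castSucc, .trans (.single ⟨_, hb'⟩) (.single ⟨_, ha'.2, ha'.1⟩)⟩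
  · refine hasCycle_of_map_of_not_passesIn Fin.castSucc c z hp (fun a ha => ⟨a.castSucc, ?_⟩) hc
    unfold Meets at ha
    push Not at ha
    unfold ColGraph.pull ColGraph.head ColGraph.tail
    rw [expand_src_castSucc, expand_tgt_castSucc, expand_ori_castSucc, if_neg ha.1, if_neg ha.2]
    split_ifs <;> exact ⟨rfl, rfl⟩

lemma pull_toggle {Γ : ColGraph (k + 1) v e} {z x w : Fin v} (hz : Γ.TadpoleAt z x) (hw : w ≠ x) :
    (Γ.toggle w).pull z x = (Γ.pull z x).toggle w.castSucc := by
  refine ext_fields (fun a => rfl) (fun a => rfl) fun c a => ?_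
  refine Fin.lastCases ?_ (fun a => ?_) a
  · have h1 := not_meets_expand_last (Γ := Γ) (p := fun a => Γ.tgt a = z)
      (q := fun a => Γ.src a = z) (o := fun _ => false) hw
    refine Eq.trans ?_ (toggle_ori_of_not_meets h1 c).symm
    rw [pull, expand_ori_last, expand_ori_last]
  · have h1 := meets_expand_castSucc_iff (o := fun _ => false) hz.src_eq hz.tgt_eq hw a
    rw [pull, expand_ori_castSucc]
    refine if_congr (and_congr Iff.rfl h1.symm) ?_ ?_ <;> rw [pull, expand_ori_castSucc]

end Pull

lemma contract_pull (Γ : ColGraph m (v + 1) (e + 1)) (z x : Fin (v + 1)) (t : Fin (e + 1))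
    (ht : ¬ Γ.Meets t z) (h : Γ.src t ≠ Γ.tgt t) :
    (Γ.contract t h).expand (fun a => Γ.tgt (t.succAbove a) = z)
      (fun a => Γ.src (t.succAbove a) = z) (Γ.contractMap t h x) (fun _ => false) =
      (Γ.contract t h).pull (Γ.contractMap t h z) (Γ.contractMap t h x) := by
  unfold pull
  congr 1
  · funext a
    exact propext (contractMap_eq_iff_of_not_meets ht _).symm
  · funext a
    exact propext (contractMap_eq_iff_of_not_meets ht _).symm

end ColGraph

/-! ### The homotopy that pulls out tadpoles. -/

section PullHomotopy

open ColGraph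

variable {K : Type u} [Field K] {m v e : ℕ} {n : ℤ}

open Classical in
/-- The tadpoles of a graph: the middle vertex and the vertex to which it is attached. -/
def tadpoles (Γ : ColGraph m v e) : Finset (Fin v × Fin v) :=
  Finset.univ.filter fun p => Γ.TadpoleAt p.1 p.2

lemma mem_tadpoles {Γ : ColGraph m v e} {p : Fin v × Fin v} :
    p ∈ tadpoles Γ ↔ Γ.TadpoleAt p.1 p.2 := by simp [tadpoles]

/-- The middle vertices of the tadpoles. -/
def tadpoleVertices (Γ : ColGraph m v e) : Finset (Fin v) := (tadpoles Γ).image Prod.fst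

lemma mem_tadpoleVertices {Γ : ColGraph m v e} {z : Fin v} :
    z ∈ tadpoleVertices Γ ↔ ∃ x, Γ.TadpoleAt z x := by
  simp [tadpoleVertices, mem_tadpoles]

/-- The sum over the tadpoles of the graphs in which a tadpole is pulled out. -/
def pullSum (K : Type u) [Field K] {m v e : ℕ} (Γ : ColGraph m v e) : Chains K m :=
  ∑ p ∈ tadpoles Γ, basisVecOrZero K (Γ.pull p.1 p.2)

lemma pullSum_permVertices (hn : ¬ Even n) (Γ : ColGraph m v e) (σ : Equiv.Perm (Fin v)) :
    pullSum K (Γ.permVertices σ) ≡ ((Equiv.Perm.sign σ : ℤ) : K) • pullSum K Γ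
      [SMOD symSpan K m n] := by
  have h1 : pullSum K (Γ.permVertices σ) =
      ∑ p ∈ tadpoles Γ, basisVecOrZero K ((Γ.permVertices σ).pull (σ p.1) (σ p.2)) := by
    symm
    refine Finset.sum_equiv (σ.prodCongr σ) (fun p => ?_) fun p _ => rfl
    rw [mem_tadpoles, mem_tadpoles]
    exact (iso_permVertices Γ σ).tadpoleAt_iff.symm
  rw [h1, pullSum, Finset.smul_sum]
  refine SModEq.sum fun p _ => ?_
  rw [pull_permVertices, ← sign_extendLast]
  exact basisVecOrZero_permVertices hn _ _

lemma pullSum_permEdges (hn : ¬ Even n) (Γ : ColGraph m v e) (τ : Equiv.Perm (Fin e)) :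
    pullSum K (Γ.permEdges τ) ≡ pullSum K Γ [SMOD symSpan K m n] := by
  have h1 : tadpoles (Γ.permEdges τ) = tadpoles Γ := by
    ext p
    rw [mem_tadpoles, mem_tadpoles]
    exact (iso_permEdges Γ τ).tadpoleAt_iff
  rw [pullSum, h1]
  refine SModEq.sum fun p _ => ?_
  rw [pull_permEdges]
  exact basisVecOrZero_permEdges hn _ _

lemma pullSum_reverse (hn : ¬ Even n) (Γ : ColGraph m v e) (t : Fin e) :
    pullSum K (Γ.reverse t) ≡ - pullSum K Γ [SMOD symSpan K m n] := by
  have h1 : tadpoles (Γ.reverse t) = tadpoles Γ := by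
    ext p
    rw [mem_tadpoles, mem_tadpoles]
    exact (iso_reverse Γ t).tadpoleAt_iff
  rw [pullSum, h1, pullSum, ← Finset.sum_neg_distrib]
  refine SModEq.sum fun p _ => ?_
  rw [pull_reverse]
  exact basisVecOrZero_reverse hn _ _

/-- A passing or weakly passing vertex is 2-valent, whereas the vertex carrying a tadpole is at
least 3-valent. So pulling happens elsewhere, keeps the type of the vertex and commutes with
toggling it. -/
lemma graphMap_pullSum_sgcRel [CharZero K] (hn : ¬ Even n) :
    ∀ x ∈ sgcRel K 0 n, graphMap (pullSum K) x ∈ sgcRel K 0 n := by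
  refine map_sgcRel_le _ _ (fun x hx => ?_) ?_ ?_
  · refine symSpan_le_sgcRel (map_symSpan_le hn (graphMap (pullSum K)) _ ?_ ?_ ?_ x hx)
    · intro v e Γ σ h
      rw [graphMap_basisVecOrZero _ h,
        graphMap_basisVecOrZero _ ((iso_permVertices Γ σ).admissible h)]
      exact pullSum_permVertices hn Γ σ
    · intro v e Γ τ h
      rw [graphMap_basisVecOrZero _ h,
        graphMap_basisVecOrZero _ ((iso_permEdges Γ τ).admissible h)]
      exact pullSum_permEdges hn Γ τ
    · intro v e Γ t h
      rw [graphMap_basisVecOrZero _ h,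
        graphMap_basisVecOrZero _ ((iso_reverse Γ t).admissible h)]
      exact pullSum_reverse hn Γ t
  · intro v e Γ w h hw
    rw [graphMap_basisVecOrZero _ h]
    refine sum_mem fun p hp => ?_
    rw [mem_tadpoles] at hp
    have hwx : w ≠ p.2 := by
      rintro rfl
      have := hp.three_le_valence h
      have := hw.1
      omega
    refine basisVecOrZero_mem_of_isPassing _ (z := w.castSucc) ?_
    have h1 := isPassing_contract_iff (h := expand_src_ne_tgt_last _ _ _ _ _)
      (not_meets_expand_last (Γ := Γ) (p := fun a => Γ.tgt a = p.1)
      (q := fun a => Γ.src a = p.1) (o := fun _ => false) hwx)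
    rw [contractMap_expand_castSucc, contract_expand_last hp.src_eq hp.tgt_eq] at h1
    exact h1.1 hw
  · intro v e Γ w h hw
    rw [graphMap_basisVecOrZero _ h, graphMap_basisVecOrZero _ (admissible_toggle hw h)]
    have h0 : tadpoles (Γ.toggle w) = tadpoles Γ := rfl
    rw [pullSum, pullSum, h0, ← Finset.sum_add_distrib]
    refine sum_mem fun p hp => ?_
    rw [mem_tadpoles] at hp
    have hwx : w ≠ p.2 := by
      rintro rfl
      have := hp.three_le_valence h
      have := hw.1
      omega
    rw [pull_toggle hp hwx]
    refine basisVecOrZero_add_toggle_mem _ ?_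
    have h1 := isWeaklyPassing_contract_iff (h := expand_src_ne_tgt_last _ _ _ _ _)
      (not_meets_expand_last (Γ := Γ) (p := fun a => Γ.tgt a = p.1)
      (q := fun a => Γ.src a = p.1) (o := fun _ => false) hwx)
    rw [contractMap_expand_castSucc, contract_expand_last hp.src_eq hp.tgt_eq] at h1
    exact h1.1 hw

lemma graphMap_pullSum_notadpRel [CharZero K] (hn : ¬ Even n) :
    ∀ x ∈ notadpRel K 0 n, graphMap (pullSum K) x ∈ notadpRel K 0 n := by
  refine map_notadpRel_le _ _
    (fun x hx => sgcRel_le_notadpRel K 0 n (graphMap_pullSum_sgcRel hn x hx)) ?_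
  intro v e Γ h _
  rw [graphMap_basisVecOrZero _ h]
  refine sum_mem fun p hp => ?_
  rw [mem_tadpoles] at hp
  exact basisVecOrZero_mem_of_hasTadpole _ ((hasTadpole_iff (hp.admissible_pull h)).2
    ⟨_, _, hp.pull⟩)

/-- The basis vectors of the graphs with tadpoles. -/
abbrev tadpoleGen (K : Type u) [Field K] (Γ : {Γ : AdmGraph (0 + 1) // Γ.graph.HasTadpole}) :
    Chains K (0 + 1) := basisVec K Γ.1.graph Γ.1.adm

/-- The number of vertices that are not the middle vertex of a tadpole. -/
def tadpoleRank {m : ℕ} (Γ : AdmGraph m) : ℕ := Γ.numV - (tadpoleVertices Γ.graph).card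

/-- Pulling out a tadpole of a contraction that does not come from the original graph
increases the number of tadpoles. -/
lemma card_tadpoleVertices_lt {Γ : ColGraph m (v + 1) (e + 1)} (hΓ : Γ.IsAdmissible)
    {t : Fin (e + 1)} {h : Γ.src t ≠ Γ.tgt t} (hadm : (Γ.contract t h).IsAdmissible)
    {z x : Fin v} (hz : (Γ.contract t h).TadpoleAt z x)
    (hnew : ∀ p ∈ tadpoles Γ, Γ.contractMap t h p.1 ≠ z) :
    (tadpoleVertices Γ).card < (tadpoleVertices ((Γ.contract t h).pull z x)).card := by
  have hmt : ∀ y ∈ tadpoleVertices Γ, ¬ Γ.Meets t y := by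
    intro y hy ht
    rw [mem_tadpoleVertices] at hy
    obtain ⟨w, hw⟩ := hy
    exact hw.not_admissible_contract hΓ.loopless ht hadm
  have hinj : Set.InjOn (fun y => (Γ.contractMap t h y).castSucc) (tadpoleVertices Γ) := by
    intro y _ y' hy' hyy
    exact (contractMap_eq_iff_of_not_meets (hmt y' hy') y).1 (Fin.castSucc_injective _ hyy)
  rw [← Finset.card_image_of_injOn hinj]
  refine Finset.card_lt_card ((Finset.ssubset_iff_of_subset ?_).2 ⟨z.castSucc, ?_, ?_⟩)
  · intro y hy
    rw [Finset.mem_image] at hy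
    obtain ⟨y, hy, rfl⟩ := hy
    have ht := hmt y hy
    rw [mem_tadpoleVertices] at hy ⊢
    obtain ⟨w, hw⟩ := hy
    refine ⟨_, hz.pull_of_ne (hw.contract ht) (hnew (y, w) (mem_tadpoles.2 hw)) ?_⟩
    intro hyx
    have h1 := hz.three_le_valence hadm
    rw [← hyx, (hw.contract ht).2.1] at h1
    omega
  · exact mem_tadpoleVertices.2 ⟨_, hz.pull⟩
  · rw [Finset.mem_image]
    rintro ⟨y, hy, hyz⟩
    rw [mem_tadpoleVertices] at hy
    obtain ⟨w, hw⟩ := hy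
    exact hnew (y, w) (mem_tadpoles.2 hw) (Fin.castSucc_injective _ hyz)

-- The stem contributes the graph itself, the tadpole edges contribute loops, and the other
-- contractions commute with pulling up to the sign of `term_expand_castSucc`.
open Classical in
lemma delta_pull (hn : ¬ Even n) {Γ : ColGraph m (v + 1) (e + 1)} (hΓ : Γ.IsAdmissible)
    {z x : Fin (v + 1)} (hz : Γ.TadpoleAt z x) :
    delta K m n (basisVecOrZero K (Γ.pull z x)) = basisVecOrZero K Γ -
      ∑ t, contractSign K n (Γ.tgt t) t • if Γ.Meets t z then 0 else basisVecOrZero K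
        ((Γ.contract t (hΓ.loopless t)).pull (Γ.contractMap t (hΓ.loopless t) z)
          (Γ.contractMap t (hΓ.loopless t) x)) := by
  have hadm := hz.admissible_pull hΓ
  refine (delta_basisVecOrZero_expand hn hz.src_eq hz.tgt_eq hadm).trans ?_
  rw [sub_eq_add_neg, ← Finset.sum_neg_distrib]
  congr 1
  refine Finset.sum_congr rfl fun t _ => ?_
  split_ifs with ht
  · have hl := hadm.loopless t.castSucc
    refine (term_of_ne _ _ hl).trans ?_
    have ht' := (meets_expand_castSucc_iff (o := fun _ => false) hz.src_eq hz.tgt_eq hz.1 t).2 ht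
    have h1 := hz.pull.not_admissible_contract (h := hl) hadm.loopless ht'
    rw [basisVecOrZero_of_not_adm h1, smul_zero, smul_zero, neg_zero]
  · have ht' := ht
    unfold Meets at ht'
    push Not at ht'
    refine (term_expand_castSucc hn Γ _ _ x _ t ht'.2 ht'.1 (hΓ.loopless t)).trans ?_
    rw [contract_pull Γ z x t ht, neg_smul]

-- The tadpoles of a contraction are those inherited from `Γ`, whose terms cancel, and new ones.
-- Pulling a new one yields a graph with more tadpoles than `Γ`.
open Classical in
lemma pullSum_contract_sub_mem {Γ : ColGraph (0 + 1) (v + 1) (e + 1)}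
    (hΓ : Γ.IsAdmissible) (t : Fin (e + 1)) :
    graphMap (pullSum K) (basisVecOrZero K (Γ.contract t (hΓ.loopless t))) -
      (∑ p ∈ tadpoles Γ, if Γ.Meets t p.1 then 0 else basisVecOrZero K
        ((Γ.contract t (hΓ.loopless t)).pull (Γ.contractMap t (hΓ.loopless t) p.1)
          (Γ.contractMap t (hΓ.loopless t) p.2))) ∈
      Submodule.span K (tadpoleGen K '' {j | tadpoleRank j.1 < tadpoleRank ⟨Γ, hΓ⟩}) := by
  by_cases hadm : (Γ.contract t (hΓ.loopless t)).IsAdmissible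
  · have hmt : ∀ p ∈ tadpoles Γ, ¬ Γ.Meets t p.1 := fun p hp ht =>
      (mem_tadpoles.1 hp).not_admissible_contract hΓ.loopless ht hadm
    rw [graphMap_basisVecOrZero _ hadm, Finset.sum_congr rfl fun p hp => if_neg (hmt p hp)]
    set f : Fin (v + 1) × Fin (v + 1) → Fin v × Fin v := fun p =>
      (Γ.contractMap t (hΓ.loopless t) p.1, Γ.contractMap t (hΓ.loopless t) p.2) with hf
    have hinj : Set.InjOn f (tadpoles Γ) := by
      intro p hp p' hp' hpp
      have h1 := (contractMap_eq_iff_of_not_meets (hmt p' hp') p.1).1 (congrArg Prod.fst hpp)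
      have h2 := mem_tadpoles.1 hp
      rw [h1] at h2
      exact Prod.ext h1 (h2.unique (mem_tadpoles.1 hp'))
    have hsub : (tadpoles Γ).image f ⊆ tadpoles (Γ.contract t (hΓ.loopless t)) := by
      intro p hp
      rw [Finset.mem_image] at hp
      obtain ⟨p, hp, rfl⟩ := hp
      exact mem_tadpoles.2 ((mem_tadpoles.1 hp).contract (hmt p hp))
    have h1 : ∑ p ∈ tadpoles Γ, basisVecOrZero K ((Γ.contract t (hΓ.loopless t)).pull
        (Γ.contractMap t (hΓ.loopless t) p.1) (Γ.contractMap t (hΓ.loopless t) p.2)) =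
        ∑ p ∈ (tadpoles Γ).image f,
          basisVecOrZero K ((Γ.contract t (hΓ.loopless t)).pull p.1 p.2) :=
      (Finset.sum_image
        (f := fun p => basisVecOrZero K ((Γ.contract t (hΓ.loopless t)).pull p.1 p.2)) hinj).symm
    rw [h1, pullSum, ← Finset.sum_sdiff hsub, add_sub_cancel_right]
    refine sum_mem fun p hp => ?_
    rw [Finset.mem_sdiff] at hp
    have hp1 := mem_tadpoles.1 hp.1
    have hadm' := hp1.admissible_pull hadm
    rw [basisVecOrZero_of_adm hadm']
    refine Submodule.subset_span ⟨⟨⟨_, hadm'⟩, (hasTadpole_iff hadm').2 ⟨_, _, hp1.pull⟩⟩, ?_, rfl⟩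
    have h2 := card_tadpoleVertices_lt hΓ hadm hp1 fun p' hp' hpp => by
      refine hp.2 (Finset.mem_image.2 ⟨p', hp', Prod.ext hpp ?_⟩)
      have h3 := (mem_tadpoles.1 hp').contract (h := hΓ.loopless t) (hmt p' hp')
      rw [hpp] at h3
      exact h3.unique hp1
    have h3 := Finset.card_le_univ
      (tadpoleVertices ((Γ.contract t (hΓ.loopless t)).pull p.1 p.2))
    rw [Fintype.card_fin] at h3
    -- Contracting and then pulling restores the number of vertices, so more tadpoles mean a smaller
    -- rank.
    exact Nat.sub_lt_sub_left (h2.trans_le h3) h2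
  · rw [basisVecOrZero_of_not_adm hadm, map_zero, Finset.sum_eq_zero, sub_zero]
    · exact zero_mem _
    · intro p hp
      split_ifs with ht
      · rfl
      -- The cycle of a contraction that is not admissible persists after pulling, so the
      -- corresponding terms of `δ h` vanish as well.
      · obtain ⟨c, hc⟩ := exists_hasCycle_contract hΓ hadm
        have h1 := ((mem_tadpoles.1 hp).contract (h := hΓ.loopless t) ht).hasCycle_pull hc
        exact basisVecOrZero_of_not_adm fun h2 => h2.acyclic c h1

/-- The graphs with tadpoles form an acyclic subcomplex. -/
theorem quotientIsQuasiIso_tadpoles [CharZero K] (hn : ¬ Even n) :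
    QuotientIsQuasiIso (delta K (0 + 1) n) (degreePart K (0 + 1) n) (sgcRel K 0 n)
      (notadpRel K 0 n) (sgcRel_le_notadpRel K 0 n) := by
  refine quotientIsQuasiIso_of_homotopy (tadpoleGen K) (fun Γ => tadpoleRank Γ.1)
    (graphMap (pullSum K)) (isSubquotientComplex_of_stable hn _ le_rfl (delta_sgcRel hn))
    (isSubquotientComplex_of_stable hn _ (sgcRel_le_notadpRel K 0 n) (delta_notadpRel hn))
    (sgcRel_le_notadpRel K 0 n) (graphMap_pullSum_sgcRel hn) (graphMap_pullSum_notadpRel hn)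
    (graphMap_mem_degreePart _ fun Γ d hd =>
      sum_mem fun p _ => basisVecOrZero_mem_degreePart _ hd) ?_ ?_
  · refine sup_le_sup_left (Submodule.span_mono ?_) _
    rintro _ ⟨v, e, Γ, h, ht, rfl⟩
    exact ⟨⟨⟨Γ, h⟩, ht⟩, rfl⟩
  · rintro ⟨⟨Γ, hΓ⟩, ht⟩
    right
    obtain ⟨v, e, rfl, rfl⟩ := IsAdmissible.exists_succ hΓ
    -- Each tadpole returns `Γ` once, through the contraction of its stem.
    refine ⟨(tadpoles Γ).card, ?_, ?_⟩
    · obtain ⟨z, x, hz⟩ := (hasTadpole_iff hΓ).1 ht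
      exact Finset.card_ne_zero_of_mem (mem_tadpoles (p := (z, x)).2 hz)
    · refine Submodule.mem_sup_right ?_
      simp only [tadpoleGen]
      rw [← basisVecOrZero_of_adm hΓ, graphMap_basisVecOrZero _ hΓ, delta_basisVecOrZero hΓ,
        pullSum, map_sum, Finset.sum_congr rfl fun p hp => delta_pull hn hΓ (mem_tadpoles.1 hp),
        Finset.sum_sub_distrib, Finset.sum_const, Finset.sum_comm, map_sum, Nat.cast_smul_eq_nsmul,
        sub_add_comm, add_sub_cancel_right]
      rw [← Finset.sum_sub_distrib]
      refine sum_mem fun t _ => ?_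
      rw [term_of_ne Γ t (hΓ.loopless t), map_smul, ← Finset.smul_sum, ← smul_sub]
      exact Submodule.smul_mem _ _ (pullSum_contract_sub_mem hΓ t)

end PullHomotopy

namespace ColGraph

variable {m k v e : ℕ}

/-! ### Subdividing an edge -/

/-- The edge `a` is subdivided by a new last vertex, which is a sink in the last colour and passing
in the other ones. The new last edge goes from the head of `a` in the last colour to the new
vertex. -/
def subdivide (Γ : ColGraph (k + 1) v e) (a : Fin e) : ColGraph (k + 1) (v + 1) (e + 1) :=
  Γ.expand (fun b => b = a ∧ Γ.ori (Fin.last k) a = false)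
    (fun b => b = a ∧ Γ.ori (Fin.last k) a = true) (Γ.head (Fin.last k) a)
    -- The new edge points against the direction of `a` in the last colour. To be passing in another
    -- colour `c`, the string must follow `a` in `c`, so the new edge has its intrinsic direction in
    -- `c` exactly when `c` and the last colour disagree on `a`.
    fun c => decide (c = Fin.last k) || (Γ.ori c a ^^ Γ.ori (Fin.last k) a)

section Subdivide

variable (Γ : ColGraph (k + 1) v e) (a : Fin e)

lemma subdivide_src_eq (b : Fin e) (hb : b = a ∧ Γ.ori (Fin.last k) a = false) :
    Γ.src b = Γ.head (Fin.last k) a := by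
  simp [head, hb.1, hb.2]

lemma subdivide_tgt_eq (b : Fin e) (hb : b = a ∧ Γ.ori (Fin.last k) a = true) :
    Γ.tgt b = Γ.head (Fin.last k) a := by
  simp [head, hb.1, hb.2]

variable {Γ a}

lemma subdivide_src_of_ne {b : Fin e} (hb : b ≠ a) :
    (Γ.subdivide a).src b.castSucc = (Γ.src b).castSucc := by
  rw [subdivide, expand_src_castSucc, if_neg fun h => hb h.1]

lemma subdivide_tgt_of_ne {b : Fin e} (hb : b ≠ a) :
    (Γ.subdivide a).tgt b.castSucc = (Γ.tgt b).castSucc := by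
  rw [subdivide, expand_tgt_castSucc, if_neg fun h => hb h.1]

lemma subdivide_tail_of_ne {b : Fin e} (hb : b ≠ a) (c : Fin (k + 1)) :
    (Γ.subdivide a).tail c b.castSucc = (Γ.tail c b).castSucc := by
  rw [tail, tail, subdivide_src_of_ne hb, subdivide_tgt_of_ne hb, subdivide, expand_ori_castSucc]
  split_ifs <;> rfl

lemma subdivide_head_of_ne {b : Fin e} (hb : b ≠ a) (c : Fin (k + 1)) :
    (Γ.subdivide a).head c b.castSucc = (Γ.head c b).castSucc := by
  rw [head, head, subdivide_src_of_ne hb, subdivide_tgt_of_ne hb, subdivide, expand_ori_castSucc]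
  split_ifs <;> rfl

lemma subdivide_joins_of_ne {b : Fin e} (hb : b ≠ a) {x y : Fin v} :
    (Γ.subdivide a).Joins b.castSucc x.castSucc y.castSucc ↔ Γ.Joins b x y := by
  unfold Joins
  rw [subdivide_src_of_ne hb, subdivide_tgt_of_ne hb]
  simp only [Fin.castSucc_inj]

variable (Γ a)

lemma subdivide_last :
    (Γ.subdivide a).tail (Fin.last k) a.castSucc = (Γ.tail (Fin.last k) a).castSucc ∧
      (Γ.subdivide a).head (Fin.last k) a.castSucc = Fin.last v ∧
      (Γ.subdivide a).tail (Fin.last k) (Fin.last e) = (Γ.head (Fin.last k) a).castSucc ∧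
      (Γ.subdivide a).head (Fin.last k) (Fin.last e) = Fin.last v := by
  unfold tail head subdivide
  rw [expand_src_last, expand_tgt_last, expand_ori_last, expand_ori_castSucc, expand_src_castSucc,
    expand_tgt_castSucc]
  cases h : Γ.ori (Fin.last k) a <;> simp [head, h]

lemma subdivide_castSucc (c : Fin k) :
    ((Γ.subdivide a).tail c.castSucc a.castSucc = (Γ.tail c.castSucc a).castSucc ∧
      (Γ.subdivide a).head c.castSucc a.castSucc = Fin.last v ∧
      (Γ.subdivide a).tail c.castSucc (Fin.last e) = Fin.last v ∧
      (Γ.subdivide a).head c.castSucc (Fin.last e) = (Γ.head c.castSucc a).castSucc) ∨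
    ((Γ.subdivide a).tail c.castSucc a.castSucc = Fin.last v ∧
      (Γ.subdivide a).head c.castSucc a.castSucc = (Γ.head c.castSucc a).castSucc ∧
      (Γ.subdivide a).tail c.castSucc (Fin.last e) = (Γ.tail c.castSucc a).castSucc ∧
      (Γ.subdivide a).head c.castSucc (Fin.last e) = Fin.last v) := by
  have hc := (Fin.castSucc_lt_last c).ne
  unfold tail head subdivide
  rw [expand_src_last, expand_tgt_last, expand_ori_last, expand_ori_castSucc, expand_src_castSucc,
    expand_tgt_castSucc]
  cases h : Γ.ori (Fin.last k) a <;> cases Γ.ori c.castSucc a <;> simp [head, h, hc]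

lemma subdivide_joins_last :
    ((Γ.subdivide a).Joins a.castSucc (Fin.last v) (Γ.tail (Fin.last k) a).castSucc) ∧
      (Γ.subdivide a).Joins (Fin.last e) (Fin.last v) (Γ.head (Fin.last k) a).castSucc := by
  obtain ⟨h1, h2, h3, h4⟩ := Γ.subdivide_last a
  unfold Joins
  rcases (Γ.subdivide a).tail_eq (Fin.last k) a.castSucc with ⟨h5, h6, -⟩ | ⟨h5, h6, -⟩ <;>
    rcases (Γ.subdivide a).tail_eq (Fin.last k) (Fin.last e) with ⟨h7, h8, -⟩ | ⟨h7, h8, -⟩ <;>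
    grind

lemma meets_subdivide_last_iff (b : Fin (e + 1)) :
    (Γ.subdivide a).Meets b (Fin.last v) ↔ b = a.castSucc ∨ b = Fin.last e := by
  refine Fin.lastCases ?_ (fun b => ?_) b
  · simp [subdivide, meets_expand_last_iff]
  · have h := (Fin.castSucc_lt_last b).ne
    simp only [subdivide, meets_expand_castSucc_last_iff, Fin.castSucc_inj, h, or_false,
      ← and_or_left]
    cases Γ.ori (Fin.last k) a <;> simp

lemma valence_subdivide_last : (Γ.subdivide a).valence (Fin.last v) = 2 := by
  rw [subdivide, valence_expand_last]
  have h : ∀ b, ((if b = a ∧ Γ.ori (Fin.last k) a = false then 1 else 0) +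
      (if b = a ∧ Γ.ori (Fin.last k) a = true then 1 else 0)) = if b = a then 1 else 0 := by
    intro b
    cases Γ.ori (Fin.last k) a <;> simp
  rw [Finset.sum_congr rfl fun b _ => ?_, Finset.sum_ite_eq' Finset.univ a fun _ => 1]
  · simp
  · rw [← h b]
    congr

lemma valence_subdivide_castSucc (y : Fin v) :
    (Γ.subdivide a).valence y.castSucc = Γ.valence y := by
  by_cases hy : y = Γ.head (Fin.last k) a
  · have h := valence_expand_castSucc_self (Γ := Γ) (o := fun c => decide (c = Fin.last k) ||
      (Γ.ori c a ^^ Γ.ori (Fin.last k) a)) (Γ.subdivide_src_eq a) (Γ.subdivide_tgt_eq a)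
    have h2 := Γ.valence_subdivide_last a
    rw [hy]
    unfold subdivide at *
    omega
  · exact valence_expand_castSucc (Γ.subdivide_src_eq a) (Γ.subdivide_tgt_eq a) hy

/-- In a colour other than the last, the two halves run through the new vertex in the direction of
`a`: one has the tail of `a`, the other its head. -/
lemma passesIn_subdivide_castSucc (c : Fin k) (y : Fin v) :
    (Γ.subdivide a).PassesIn c.castSucc y.castSucc ↔ Γ.PassesIn c.castSucc y := by
  have hy := (Fin.castSucc_lt_last y).ne'
  have key : ∀ (F : Fin (e + 1) → Fin (v + 1)) (G : Fin e → Fin v),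
      (∀ b, b ≠ a → F b.castSucc = (G b).castSucc) →
      (F a.castSucc = (G a).castSucc ∧ F (Fin.last e) = Fin.last v ∨
        F a.castSucc = Fin.last v ∧ F (Fin.last e) = (G a).castSucc) →
      ((∃ b, F b = y.castSucc) ↔ ∃ b, G b = y) := by
    intro F G h1 h2
    constructor
    · rintro ⟨b, hb⟩
      revert hb
      refine Fin.lastCases (fun hb => ?_) (fun b hb => ?_) b
      · rcases h2 with h2 | h2
        · exact absurd (h2.2.symm.trans hb) hy
        · exact ⟨a, Fin.castSucc_injective _ (h2.2.symm.trans hb)⟩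
      · by_cases hba : b = a
        · subst hba
          rcases h2 with h2 | h2
          · exact ⟨b, Fin.castSucc_injective _ (h2.1.symm.trans hb)⟩
          · exact absurd (h2.1.symm.trans hb) hy
        · exact ⟨b, Fin.castSucc_injective _ ((h1 b hba).symm.trans hb)⟩
    · rintro ⟨b, rfl⟩
      by_cases hba : b = a
      · subst hba
        rcases h2 with h2 | h2
        · exact ⟨_, h2.1⟩
        · exact ⟨_, h2.2⟩
      · exact ⟨_, h1 b hba⟩
  have h3 := Γ.subdivide_castSucc a c
  refine and_congr (key _ _ (fun b hb => subdivide_head_of_ne hb _) ?_)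
    (key _ _ (fun b hb => subdivide_tail_of_ne hb _) ?_) <;> tauto

lemma isInner_subdivide_castSucc (y : Fin v) :
    (Γ.subdivide a).IsInner y.castSucc ↔ Γ.IsInner y := by
  unfold IsInner
  rw [valence_subdivide_castSucc]
  simp only [passesIn_subdivide_castSucc]

lemma isWeaklyPassing_subdivide_last : (Γ.subdivide a).IsWeaklyPassing (Fin.last v) := by
  refine ⟨Γ.valence_subdivide_last a, fun c => ?_, ?_⟩
  · rcases Γ.subdivide_castSucc a c with h | h
    · exact ⟨⟨_, h.2.1⟩, _, h.2.2.1⟩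
    · exact ⟨⟨_, h.2.2.2⟩, _, h.1⟩
  · rintro ⟨-, b, hb⟩
    have h1 := Γ.subdivide_last a
    rcases (Γ.meets_subdivide_last_iff a b).1 ((meets_iff_tail_or_head _ _ _ _).2 (Or.inl hb)) with
      rfl | rfl
    · exact (Fin.castSucc_lt_last _).ne (h1.1.symm.trans hb)
    · exact (Fin.castSucc_lt_last _).ne (h1.2.2.1.symm.trans hb)

variable {Γ a}

lemma admissible_subdivide (hΓ : Γ.IsAdmissible) : (Γ.subdivide a).IsAdmissible :=
  admissible_expand (Γ.subdivide_src_eq a) (Γ.subdivide_tgt_eq a) hΓ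
    ((hΓ.two_le_valence _).trans_eq (Γ.valence_subdivide_castSucc a _).symm)
    (Γ.valence_subdivide_last a).ge

/-- Oriented cycles persist if there is an edge parallel to the subdivided one. -/
lemma hasCycle_subdivide {b : Fin e} (hba : b ≠ a) {c : Fin (k + 1)}
    (ht : Γ.tail c b = Γ.tail c a) (hh : Γ.head c b = Γ.head c a) (hc : Γ.HasCycle c) :
    (Γ.subdivide a).HasCycle c := by
  obtain ⟨x, hx⟩ := hc
  refine ⟨x.castSucc, hx.lift Fin.castSucc ?_⟩
  rintro y z ⟨d, rfl, rfl⟩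
  by_cases hd : d = a
  · subst hd
    exact ⟨b.castSucc, by rw [subdivide_tail_of_ne hba, ht], by rw [subdivide_head_of_ne hba, hh]⟩
  · exact ⟨d.castSucc, subdivide_tail_of_ne hd c, subdivide_head_of_ne hd c⟩

variable (Γ a)

lemma subdivide_permVertices (σ : Equiv.Perm (Fin v)) :
    (Γ.permVertices σ).subdivide a = (Γ.subdivide a).permVertices (extendLast σ) := by
  have h : (Γ.permVertices σ).head (Fin.last k) a = σ (Γ.head (Fin.last k) a) :=
    (iso_permVertices Γ σ a).head _
  rw [subdivide, subdivide, ← expand_permVertices, h]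
  rfl

lemma subdivide_permEdges (τ : Equiv.Perm (Fin e)) :
    (Γ.permEdges τ).subdivide (τ a) = (Γ.subdivide a).permEdges (extendLast τ) := by
  have h : ∀ c, (Γ.permEdges τ).ori c (τ a) = Γ.ori c a := fun c => by simp [permEdges]
  have h' : (Γ.permEdges τ).head (Fin.last k) (τ a) = Γ.head (Fin.last k) a :=
    (iso_permEdges Γ τ a).head _
  rw [subdivide, subdivide, ← expand_permEdges, h']
  simp only [h, Equiv.symm_apply_eq]

lemma subdivide_reverse (t : Fin e) :
    (Γ.reverse t).subdivide a = (Γ.subdivide a).reverse t.castSucc := by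
  have h : (Γ.reverse t).head (Fin.last k) a = Γ.head (Fin.last k) a :=
    (iso_reverse Γ t a).head _
  have ho : (fun c => decide (c = Fin.last k) ||
      ((Γ.reverse t).ori c a ^^ (Γ.reverse t).ori (Fin.last k) a)) =
      fun c => decide (c = Fin.last k) || (Γ.ori c a ^^ Γ.ori (Fin.last k) a) := by
    funext c
    simp only [reverse]
    split_ifs <;> simp
  unfold subdivide
  rw [ho, h]
  have hne : ∀ b, b ≠ t → b = a → (Γ.reverse t).ori (Fin.last k) a = Γ.ori (Fin.last k) a := by
    rintro b hb rfl
    simp [reverse, hb]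
  have heq : t = a → (Γ.reverse t).ori (Fin.last k) a = !Γ.ori (Fin.last k) a := by
    rintro rfl
    simp [reverse]
  refine expand_reverse Γ _ _ _ _ t (fun b hb => ?_) (fun b hb => ?_) ?_ ?_
  · exact and_congr_right fun hba => by rw [hne b hb hba]
  · exact and_congr_right fun hba => by rw [hne b hb hba]
  · exact and_congr_right fun hta => by rw [heq hta]; simp
  · exact and_congr_right fun hta => by rw [heq hta]; simp

lemma subdivide_toggle {w : Fin v} (hw : w ≠ Γ.head (Fin.last k) a) (hwa : ¬ Γ.Meets a w) :
    (Γ.toggle w).subdivide a = (Γ.subdivide a).toggle w.castSucc := by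
  have h1 : ∀ c, (Γ.toggle w).ori c a = Γ.ori c a := toggle_ori_of_not_meets hwa
  have h2 : (Γ.toggle w).head (Fin.last k) a = Γ.head (Fin.last k) a :=
    toggle_head_of_not_meets hwa _
  unfold subdivide
  simp only [h1, h2]
  refine ext_fields (fun b => rfl) (fun b => rfl) fun c b => ?_
  refine Fin.lastCases ?_ (fun b => ?_) b
  · rw [toggle_ori_of_not_meets (not_meets_expand_last hw), expand_ori_last, expand_ori_last]
  · have h3 := meets_expand_castSucc_iff (o := fun c => decide (c = Fin.last k) ||
      (Γ.ori c a ^^ Γ.ori (Fin.last k) a)) (Γ.subdivide_src_eq a) (Γ.subdivide_tgt_eq a) hw b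
    rw [expand_ori_castSucc]
    refine if_congr (and_congr Iff.rfl h3.symm) ?_ ?_ <;> rw [expand_ori_castSucc]

end Subdivide

lemma expand_contract_eq_subdivide (Γ : ColGraph (k + 1) (v + 1) (e + 1)) (t : Fin (e + 1))
    (a : Fin e) (h : Γ.src t ≠ Γ.tgt t) :
    (Γ.contract t h).expand
      (fun b => t.succAbove b = t.succAbove a ∧ Γ.ori (Fin.last k) (t.succAbove a) = false)
      (fun b => t.succAbove b = t.succAbove a ∧ Γ.ori (Fin.last k) (t.succAbove a) = true)
      (Γ.contractMap t h (Γ.head (Fin.last k) (t.succAbove a)))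
      (fun c => decide (c = Fin.last k) ||
        (Γ.ori c (t.succAbove a) ^^ Γ.ori (Fin.last k) (t.succAbove a))) =
      (Γ.contract t h).subdivide a := by
  unfold subdivide
  rw [(edgeMatch_contract a).head]
  simp only [t.succAbove_right_injective.eq_iff]
  rfl

end ColGraph

/-! ### Contractions of a subdivided graph. -/

section SubdivideTerms

open ColGraph

variable {K : Type u} [Field K] {k v e : ℕ} {n : ℤ}

lemma term_subdivide_of_ne (hn : ¬ Even n) (Γ : ColGraph (k + 1) (v + 1) (e + 1))
    (t : Fin (e + 1)) (a : Fin e) (h : Γ.src t ≠ Γ.tgt t) :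
    term K n (Γ.subdivide (t.succAbove a)) t.castSucc = - contractSign K n (Γ.tgt t) t •
      basisVecOrZero K ((Γ.contract t h).subdivide a) := by
  have hne := (Fin.succAbove_ne t a).symm
  rw [← expand_contract_eq_subdivide]
  exact term_expand_castSucc hn Γ _ _ _ _ t (fun h => hne h.1) (fun h => hne h.1) h

/-- The two edges obtained by subdivision of one of several parallel edges: contraction of the
old one creates an oriented cycle in the last colour. -/
lemma term_subdivide_self {Γ : ColGraph (k + 1) (v + 1) (e + 1)} (hΓ : Γ.IsAdmissible)
    {a b : Fin (e + 1)} (hba : b ≠ a)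
    (ht : Γ.tail (Fin.last k) b = Γ.tail (Fin.last k) a)
    (hh : Γ.head (Fin.last k) b = Γ.head (Fin.last k) a) :
    term K n (Γ.subdivide a) a.castSucc = 0 := by
  have hadm := admissible_subdivide (a := a) hΓ
  have hne := hadm.loopless a.castSucc
  obtain ⟨h1, h2, h3, h4⟩ := Γ.subdivide_last a
  rw [term_of_ne _ _ hne, basisVecOrZero_of_not_adm, smul_zero]
  intro hc
  obtain ⟨b', hb'⟩ := Fin.exists_succAbove_eq (x := b.castSucc) (y := a.castSucc)
    (fun h => hba (Fin.castSucc_injective _ h))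
  obtain ⟨l, hl⟩ := Fin.exists_succAbove_eq (x := Fin.last (e + 1)) (y := a.castSucc)
    (Fin.castSucc_lt_last a).ne'
  have e1 : (Γ.subdivide a).contractMap a.castSucc hne (Γ.tail (Fin.last k) a).castSucc =
      (Γ.subdivide a).contractMap a.castSucc hne (Fin.last (v + 1)) :=
    (Γ.subdivide_joins_last a).1.symm.contractMap_eq
  -- The new vertex is a sink. Once it is merged with the tail of `a`, the new edge runs from the
  -- head of `a` back to its tail and closes a cycle with `b`.
  refine hc.acyclic (Fin.last k) ⟨_, .trans (.single ⟨b', rfl, rfl⟩) (.single ⟨l, ?_, ?_⟩)⟩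
  · rw [(edgeMatch_contract l).tail, (edgeMatch_contract b').head, hl, hb', h3,
      subdivide_head_of_ne hba, hh]
  · rw [(edgeMatch_contract l).head, (edgeMatch_contract b').tail, hl, hb', h4,
      subdivide_tail_of_ne hba, ht, e1]

/-- A loop that is subdivided gives a tadpole. -/
lemma basisVecOrZero_subdivide_mem_of_loop {Γ : ColGraph (k + 1) v e} {a : Fin e}
    (h : Γ.src a = Γ.tgt a) : basisVecOrZero K (Γ.subdivide a) ∈ notadpRel K k n := by
  refine basisVecOrZero_mem_of_hasTadpole _ ⟨Fin.last v, (Γ.tail (Fin.last k) a).castSucc,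
    Γ.isWeaklyPassing_subdivide_last a, fun b hb => ?_⟩
  have hth : Γ.tail (Fin.last k) a = Γ.head (Fin.last k) a := by
    unfold tail head
    split_ifs <;> simp [h]
  rcases (Γ.meets_subdivide_last_iff a b).1 hb with rfl | rfl
  · exact (Γ.subdivide_joins_last a).1
  · rw [hth]
    exact (Γ.subdivide_joins_last a).2

end SubdivideTerms

/-! ### Parallel edges between non-inner vertices. -/

namespace ColGraph

variable {k v e : ℕ}

/-- The edge `a` joins two vertices that are not inner, and it is not the only such edge. -/
def IsParallel (Γ : ColGraph (k + 1) v e) (a : Fin e) : Prop :=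
  ¬ Γ.IsInner (Γ.src a) ∧ ¬ Γ.IsInner (Γ.tgt a) ∧
    ∃ b, b ≠ a ∧ Γ.Joins b (Γ.src a) (Γ.tgt a)

lemma Joins.iff_of_joins {Γ : ColGraph (k + 1) v e} {a : Fin e} {x y : Fin v} (h : Γ.Joins a x y)
    {b : Fin e} : Γ.Joins b (Γ.src a) (Γ.tgt a) ↔ Γ.Joins b x y := by
  unfold Joins at *
  grind

lemma Joins.isParallel_iff {Γ : ColGraph (k + 1) v e} {a : Fin e} {x y : Fin v}
    (h : Γ.Joins a x y) : Γ.IsParallel a ↔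
      ¬ Γ.IsInner x ∧ ¬ Γ.IsInner y ∧ ∃ b, b ≠ a ∧ Γ.Joins b x y := by
  unfold IsParallel
  simp only [h.iff_of_joins]
  rcases h with ⟨rfl, rfl⟩ | ⟨rfl, rfl⟩ <;> tauto

lemma joins_src_tgt (Γ : ColGraph (k + 1) v e) (a : Fin e) : Γ.Joins a (Γ.src a) (Γ.tgt a) :=
  Or.inl ⟨rfl, rfl⟩

lemma IsParallel.iso {Γ Γ' : ColGraph (k + 1) v e} {σ : Equiv.Perm (Fin v)}
    {τ : Equiv.Perm (Fin e)} (h : Iso Γ Γ' σ τ) {a : Fin e} (ha : Γ.IsParallel a) :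
    Γ'.IsParallel (τ a) := by
  obtain ⟨h1, h2, b, hb, hj⟩ := ha
  rw [((h.joins_iff a _ _).2 (Γ.joins_src_tgt a)).isParallel_iff, h.isInner_iff, h.isInner_iff]
  exact ⟨h1, h2, τ b, τ.injective.ne hb, (h.joins_iff b _ _).2 hj⟩

lemma Iso.isParallel_iff {Γ Γ' : ColGraph (k + 1) v e} {σ : Equiv.Perm (Fin v)}
    {τ : Equiv.Perm (Fin e)} (h : Iso Γ Γ' σ τ) {a : Fin e} :
    Γ'.IsParallel (τ a) ↔ Γ.IsParallel a :=
  ⟨fun ha => by simpa using ha.iso h.symm, fun ha => ha.iso h⟩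

lemma toggle_isParallel (Γ : ColGraph (k + 1) v e) (w : Fin v) (a : Fin e) :
    (Γ.toggle w).IsParallel a ↔ Γ.IsParallel a := by
  unfold IsParallel
  rw [toggle_isInner, toggle_isInner]
  rfl

lemma IsParallel.not_meets {Γ : ColGraph (k + 1) v e} {a : Fin e} (ha : Γ.IsParallel a) {z : Fin v}
    (hz : Γ.IsInner z) : ¬ Γ.Meets a z := by
  rintro (rfl | rfl)
  · exact ha.1 hz
  · exact ha.2.1 hz

lemma IsParallel.ne_head {Γ : ColGraph (k + 1) v e} {a : Fin e} (ha : Γ.IsParallel a) {z : Fin v}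
    (hz : Γ.IsInner z) (c : Fin (k + 1)) : z ≠ Γ.head c a := by
  rintro rfl
  exact ha.not_meets hz ((meets_iff_tail_or_head _ c _ _).2 (Or.inr rfl))

/-- In an admissible graph parallel edges have the same orientations. -/
lemma IsParallel.exists_tail_head {Γ : ColGraph (k + 1) v e} (hΓ : Γ.IsAdmissible) {a : Fin e}
    (ha : Γ.IsParallel a) : ∃ b, b ≠ a ∧ Γ.Joins b (Γ.src a) (Γ.tgt a) ∧
      ∀ c, Γ.tail c b = Γ.tail c a ∧ Γ.head c b = Γ.head c a := by
  obtain ⟨-, -, b, hb, hj⟩ := ha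
  exact ⟨b, hb, hj, fun c => joins_tail_head (hΓ.acyclic c) hj (Γ.joins_src_tgt a)⟩

end ColGraph

/-! ### The homotopy that subdivides parallel edges. -/

section SubdivideSum

open ColGraph

variable {K : Type u} [Field K] {k v e : ℕ} {n : ℤ}

open Classical in
/-- The edges that are not the only one joining two vertices that are not inner. -/
def parallelEdges (Γ : ColGraph (k + 1) v e) : Finset (Fin e) :=
  Finset.univ.filter Γ.IsParallel

lemma mem_parallelEdges {Γ : ColGraph (k + 1) v e} {a : Fin e} :
    a ∈ parallelEdges Γ ↔ Γ.IsParallel a := by simp [parallelEdges]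

/-- The sum of the subdivisions of the parallel edges. -/
def subdivideSum (K : Type u) [Field K] {k v e : ℕ} (Γ : ColGraph (k + 1) v e) :
    Chains K (k + 1) :=
  ∑ a ∈ parallelEdges Γ, basisVecOrZero K (Γ.subdivide a)

lemma subdivideSum_permVertices (hn : ¬ Even n) (Γ : ColGraph (k + 1) v e)
    (σ : Equiv.Perm (Fin v)) :
    subdivideSum K (Γ.permVertices σ) ≡ ((Equiv.Perm.sign σ : ℤ) : K) • subdivideSum K Γ
      [SMOD symSpan K (k + 1) n] := by
  have h1 : parallelEdges (Γ.permVertices σ) = parallelEdges Γ := by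
    ext a
    rw [mem_parallelEdges, mem_parallelEdges]
    exact (iso_permVertices Γ σ).isParallel_iff
  rw [subdivideSum, h1, subdivideSum, Finset.smul_sum]
  refine SModEq.sum fun a _ => ?_
  rw [subdivide_permVertices, ← sign_extendLast]
  exact basisVecOrZero_permVertices hn _ _

lemma subdivideSum_permEdges (hn : ¬ Even n) (Γ : ColGraph (k + 1) v e)
    (τ : Equiv.Perm (Fin e)) :
    subdivideSum K (Γ.permEdges τ) ≡ subdivideSum K Γ [SMOD symSpan K (k + 1) n] := by
  have h1 : subdivideSum K (Γ.permEdges τ) =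
      ∑ a ∈ parallelEdges Γ, basisVecOrZero K ((Γ.permEdges τ).subdivide (τ a)) := by
    symm
    refine Finset.sum_equiv τ (fun a => ?_) fun p _ => rfl
    rw [mem_parallelEdges, mem_parallelEdges]
    exact (iso_permEdges Γ τ).isParallel_iff.symm
  rw [h1, subdivideSum]
  refine SModEq.sum fun a _ => ?_
  rw [subdivide_permEdges]
  exact basisVecOrZero_permEdges hn _ _

lemma subdivideSum_reverse (hn : ¬ Even n) (Γ : ColGraph (k + 1) v e) (t : Fin e) :
    subdivideSum K (Γ.reverse t) ≡ - subdivideSum K Γ [SMOD symSpan K (k + 1) n] := by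
  have h1 : parallelEdges (Γ.reverse t) = parallelEdges Γ := by
    ext a
    rw [mem_parallelEdges, mem_parallelEdges]
    exact (iso_reverse Γ t).isParallel_iff
  rw [subdivideSum, h1, subdivideSum, ← Finset.sum_neg_distrib]
  refine SModEq.sum fun a _ => ?_
  rw [subdivide_reverse]
  exact basisVecOrZero_reverse hn _ _

/-- Parallel edges do not meet inner vertices, so subdivision leaves passing and weakly passing
vertices alone. Parallelism is expressed through `IsInner`, which toggling preserves, so both graphs
of a half-sum have the same parallel edges. -/
lemma graphMap_subdivideSum_sgcRel [CharZero K] (hn : ¬ Even n) :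
    ∀ x ∈ sgcRel K k n, graphMap (subdivideSum K) x ∈ sgcRel K k n := by
  refine map_sgcRel_le _ _ (fun x hx => ?_) ?_ ?_
  · refine symSpan_le_sgcRel (map_symSpan_le hn (graphMap (subdivideSum K)) _ ?_ ?_ ?_ x hx)
    · intro v e Γ σ h
      rw [graphMap_basisVecOrZero _ h,
        graphMap_basisVecOrZero _ ((iso_permVertices Γ σ).admissible h)]
      exact subdivideSum_permVertices hn Γ σ
    · intro v e Γ τ h
      rw [graphMap_basisVecOrZero _ h,
        graphMap_basisVecOrZero _ ((iso_permEdges Γ τ).admissible h)]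
      exact subdivideSum_permEdges hn Γ τ
    · intro v e Γ t h
      rw [graphMap_basisVecOrZero _ h,
        graphMap_basisVecOrZero _ ((iso_reverse Γ t).admissible h)]
      exact subdivideSum_reverse hn Γ t
  · intro v e Γ w h hw
    rw [graphMap_basisVecOrZero _ h]
    refine sum_mem fun a ha => ?_
    have hne := (mem_parallelEdges.1 ha).ne_head ((isPassing_iff _ _).1 hw).1 (Fin.last k)
    refine basisVecOrZero_mem_of_isPassing _ (z := w.castSucc) ?_
    have h1 := isPassing_contract_iff (h := expand_src_ne_tgt_last _ _ _ _ _)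
      (not_meets_expand_last (Γ := Γ) (p := fun b => b = a ∧ Γ.ori (Fin.last k) a = false)
        (q := fun b => b = a ∧ Γ.ori (Fin.last k) a = true)
        (o := fun c => decide (c = Fin.last k) || (Γ.ori c a ^^ Γ.ori (Fin.last k) a)) hne)
    rw [contractMap_expand_castSucc,
      contract_expand_last (Γ.subdivide_src_eq a) (Γ.subdivide_tgt_eq a)] at h1
    exact h1.1 hw
  · intro v e Γ w h hw
    rw [graphMap_basisVecOrZero _ h, graphMap_basisVecOrZero _ (admissible_toggle hw h)]
    have h0 : parallelEdges (Γ.toggle w) = parallelEdges Γ := by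
      ext a
      rw [mem_parallelEdges, mem_parallelEdges, toggle_isParallel]
    rw [subdivideSum, subdivideSum, h0, ← Finset.sum_add_distrib]
    refine sum_mem fun a ha => ?_
    have hne := (mem_parallelEdges.1 ha).ne_head hw.isInner (Fin.last k)
    rw [subdivide_toggle _ _ hne ((mem_parallelEdges.1 ha).not_meets hw.isInner)]
    refine basisVecOrZero_add_toggle_mem _ ?_
    have h1 := isWeaklyPassing_contract_iff (h := expand_src_ne_tgt_last _ _ _ _ _)
      (not_meets_expand_last (Γ := Γ) (p := fun b => b = a ∧ Γ.ori (Fin.last k) a = false)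
        (q := fun b => b = a ∧ Γ.ori (Fin.last k) a = true)
        (o := fun c => decide (c = Fin.last k) || (Γ.ori c a ^^ Γ.ori (Fin.last k) a)) hne)
    rw [contractMap_expand_castSucc,
      contract_expand_last (Γ.subdivide_src_eq a) (Γ.subdivide_tgt_eq a)] at h1
    exact h1.1 hw

/-- The middle vertex of a tadpole is inner, hence the edges of the tadpole are never subdivided. -/
lemma graphMap_subdivideSum_notadpRel [CharZero K] (hn : ¬ Even n) :
    ∀ x ∈ notadpRel K k n, graphMap (subdivideSum K) x ∈ notadpRel K k n := by
  refine map_notadpRel_le _ _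
    (fun x hx => sgcRel_le_notadpRel K k n (graphMap_subdivideSum_sgcRel hn x hx)) ?_
  rintro v e Γ h ⟨z, x, hz, hzx⟩
  rw [graphMap_basisVecOrZero _ h]
  refine sum_mem fun a ha => ?_
  have hne := (mem_parallelEdges.1 ha).ne_head hz.isInner (Fin.last k)
  refine basisVecOrZero_mem_of_hasTadpole _ ⟨z.castSucc, x.castSucc, ?_, fun b hb => ?_⟩
  · have h1 := isWeaklyPassing_contract_iff (h := expand_src_ne_tgt_last _ _ _ _ _)
      (not_meets_expand_last (Γ := Γ) (p := fun b => b = a ∧ Γ.ori (Fin.last k) a = false)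
        (q := fun b => b = a ∧ Γ.ori (Fin.last k) a = true)
        (o := fun c => decide (c = Fin.last k) || (Γ.ori c a ^^ Γ.ori (Fin.last k) a)) hne)
    rw [contractMap_expand_castSucc,
      contract_expand_last (Γ.subdivide_src_eq a) (Γ.subdivide_tgt_eq a)] at h1
    exact h1.1 hz
  · revert hb
    refine Fin.lastCases (fun hb => ?_) (fun b hb => ?_) b
    · exact absurd hb (not_meets_expand_last hne)
    · have hb' := (meets_expand_castSucc_iff (Γ.subdivide_src_eq a) (Γ.subdivide_tgt_eq a) hne b).1 hb
      have hba : b ≠ a := by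
        rintro rfl
        exact (mem_parallelEdges.1 ha).not_meets hz.isInner hb'
      exact (subdivide_joins_of_ne hba).2 (hzx b hb')

end SubdivideSum

namespace ColGraph

variable {k v e : ℕ}

/-! ### Inner vertices and parallel edges under contraction -/

section Contract

variable {Γ : ColGraph (k + 1) (v + 1) (e + 1)} {t : Fin (e + 1)} {h : Γ.src t ≠ Γ.tgt t}

lemma valence_contract_of_joins {x y : Fin (v + 1)} (hxy : Γ.Joins t x y) :
    (Γ.contract t h).valence (Γ.contractMap t h x) + 2 = Γ.valence x + Γ.valence y := by
  rcases hxy with ⟨rfl, rfl⟩ | ⟨rfl, rfl⟩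
  · exact valence_contract_src
  · rw [add_comm (Γ.valence _)]
    exact valence_contract_tgt

/-- A vertex with two further edges that is not inner stays so if an edge is contracted. -/
lemma not_isInner_contract (hΓ : Γ.IsAdmissible) {x : Fin (v + 1)} (hx : ¬ Γ.IsInner x)
    {a b : Fin (e + 1)} (hab : a ≠ b) (hat : a ≠ t) (hbt : b ≠ t) (ha : Γ.Meets a x)
    (hb : Γ.Meets b x) : ¬ (Γ.contract t h).IsInner (Γ.contractMap t h x) := by
  by_cases ht : Γ.Meets t x
  · obtain ⟨y, hy⟩ := ht.exists_joins
    have h1 := valence_contract_of_joins (h := h) hy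
    have h2 := hΓ.two_le_valence y
    have h3 := three_le_valence hΓ.loopless hab hat hbt ha hb ht
    intro h4
    have h5 := h4.1
    omega
  · rwa [isInner_contract_iff ht]

lemma IsParallel.not_admissible_contract (ht : Γ.IsParallel t) :
    ¬ (Γ.contract t h).IsAdmissible := by
  obtain ⟨-, -, b, hb, hj⟩ := ht
  obtain ⟨b, rfl⟩ := Fin.exists_succAbove_eq hb
  exact not_admissible_contract_of_joins (Γ.joins_src_tgt t) hj

/-- Neither parallel edge is contracted, as that would leave a loop. Both ends thus keep two edges
besides `t`, so a merged end has valence at least 3 and the other ends do not change. -/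
lemma IsParallel.contract (hΓ : Γ.IsAdmissible) (hadm : (Γ.contract t h).IsAdmissible) {a : Fin e}
    (ha : Γ.IsParallel (t.succAbove a)) : (Γ.contract t h).IsParallel a := by
  obtain ⟨h1, h2, b, hb, hj⟩ := ha
  have hja := Γ.joins_src_tgt (t.succAbove a)
  have hbt : b ≠ t := by
    rintro rfl
    exact not_admissible_contract_of_joins hj hja hadm
  have hat := Fin.succAbove_ne t a
  obtain ⟨b, rfl⟩ := Fin.exists_succAbove_eq hbt
  rw [(joins_contract hja).isParallel_iff]
  exact ⟨not_isInner_contract hΓ h1 hb hbt hat hj.meets_left hja.meets_left,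
    not_isInner_contract hΓ h2 hb hbt hat hj.meets_right hja.meets_right,
    b, fun hba => hb (congrArg _ hba), joins_contract hj⟩

end Contract

/-- Two edges at an inner vertex can only be parallel if there is just one colour. -/
lemma IsInner.false_of_joins {Γ : ColGraph (k + 1) v e} (hΓ : Γ.IsAdmissible) {x y : Fin v}
    (hx : Γ.IsInner x) {a b : Fin e} (hab : a ≠ b) (ha : Γ.Joins a x y) (hb : Γ.Joins b x y)
    (c : Fin k) : False := by
  have h1 : ∀ d, Γ.Meets d x ↔ d = a ∨ d = b := fun d =>
    ⟨eq_or_eq_of_meets hΓ.loopless hx.1 hab ha.meets_left hb.meets_left, by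
      rintro (rfl | rfl)
      · exact ha.meets_left
      · exact hb.meets_left⟩
  have h2 := (passesIn_iff_of_two_edges h1 (hΓ.loopless a) (hΓ.loopless b) c.castSucc).1 (hx.2 c)
  rw [(joins_tail_head (hΓ.acyclic c.castSucc) ha hb).2] at h2
  tauto

/-- The edge `a` joins two vertices that are not inner, and these are also connected by two edges
with an inner vertex between them. -/
def IsBypassed (Γ : ColGraph (k + 1) v e) (a : Fin e) : Prop :=
  ¬ Γ.IsInner (Γ.src a) ∧ ¬ Γ.IsInner (Γ.tgt a) ∧
    ∃ z, Γ.IsInner z ∧ (∃ s, Γ.Joins s z (Γ.src a)) ∧ ∃ t, Γ.Joins t z (Γ.tgt a)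

lemma Joins.isBypassed_iff {Γ : ColGraph (k + 1) v e} {a : Fin e} {x y : Fin v}
    (h : Γ.Joins a x y) : Γ.IsBypassed a ↔
      ¬ Γ.IsInner x ∧ ¬ Γ.IsInner y ∧
        ∃ z, Γ.IsInner z ∧ (∃ s, Γ.Joins s z x) ∧ ∃ t, Γ.Joins t z y := by
  unfold IsBypassed
  rcases h with ⟨rfl, rfl⟩ | ⟨rfl, rfl⟩
  · rfl
  · constructor
    · rintro ⟨h1, h2, z, hz, h3, h4⟩
      exact ⟨h2, h1, z, hz, h4, h3⟩
    · rintro ⟨h1, h2, z, hz, h3, h4⟩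
      exact ⟨h2, h1, z, hz, h4, h3⟩

lemma IsBypassed.iso {Γ Γ' : ColGraph (k + 1) v e} {σ : Equiv.Perm (Fin v)}
    {τ : Equiv.Perm (Fin e)} (h : Iso Γ Γ' σ τ) {a : Fin e} (ha : Γ.IsBypassed a) :
    Γ'.IsBypassed (τ a) := by
  obtain ⟨h1, h2, z, hz, ⟨s, hs⟩, t, ht⟩ := ha
  rw [((h.joins_iff a _ _).2 (Γ.joins_src_tgt a)).isBypassed_iff, h.isInner_iff, h.isInner_iff]
  exact ⟨h1, h2, σ z, (h.isInner_iff z).2 hz, ⟨_, (h.joins_iff s _ _).2 hs⟩,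
    _, (h.joins_iff t _ _).2 ht⟩

lemma toggle_isBypassed (Γ : ColGraph (k + 1) v e) (w : Fin v) (a : Fin e) :
    (Γ.toggle w).IsBypassed a ↔ Γ.IsBypassed a := by
  unfold IsBypassed
  simp only [toggle_isInner]
  rfl

/-- Contraction of one edge at the inner vertex of a bypass makes the other one parallel. -/
lemma isParallel_contract_of_bypass {Γ : ColGraph (k + 1) (v + 1) (e + 1)} {t : Fin (e + 1)}
    {h : Γ.src t ≠ Γ.tgt t} (hΓ : Γ.IsAdmissible) (hadm : (Γ.contract t h).IsAdmissible)
    {x y z : Fin (v + 1)} {a s : Fin e} (hx : ¬ Γ.IsInner x) (hy : ¬ Γ.IsInner y)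
    (hz : Γ.IsInner z) (ha : Γ.Joins (t.succAbove a) x y) (hs : Γ.Joins (t.succAbove s) z x)
    (ht : Γ.Joins t z y) : (Γ.contract t h).IsParallel a ∧ (Γ.contract t h).IsParallel s := by
  have hxz : x ≠ z := fun hxz => hx (hxz ▸ hz)
  have hyz : y ≠ z := fun hyz => hy (hyz ▸ hz)
  have hxy : x ≠ y := by
    rintro rfl
    have := hΓ.loopless (t.succAbove a)
    unfold Joins at ha
    grind
  have hja := joins_contract (h := h) ha
  have hjs := joins_contract (h := h) hs
  rw [ht.contractMap_eq] at hjs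
  have has : a ≠ s := by
    rintro rfl
    unfold Joins at ha hs
    grind
  have htx : ¬ Γ.Meets t x := by
    unfold Joins at ht
    unfold Meets
    grind
  have hx' : ¬ (Γ.contract t h).IsInner (Γ.contractMap t h x) := by
    rwa [isInner_contract_iff htx]
  have hy' : ¬ (Γ.contract t h).IsInner (Γ.contractMap t h y) := by
    intro hy'
    -- The two edges are now parallel, so an inner merged vertex forces `k = 0`. Then being inner
    -- only means being 2-valent, and absorbing the 2-valent `z` does not change the valence of `y`.
    have hk := hy'.false_of_joins hadm has hja.symm hjs
    refine hy ⟨?_, fun c => (hk c).elim⟩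
    have h1 := valence_contract_of_joins (h := h) ht.symm
    have h2 := hy'.1
    have h3 := hz.1
    omega
  rw [hja.isParallel_iff, hjs.isParallel_iff]
  exact ⟨⟨hx', hy', s, has.symm, hjs.symm⟩, hy', hx', a, has, hja.symm⟩

/-! ### Normalized graphs -/

/-- There is a passing vertex or a skeleton edge of length at least 3. -/
def IsDegenerate (Γ : ColGraph (k + 1) v e) : Prop :=
  (∃ z, Γ.IsPassing z) ∨ ∃ a y z, Γ.Joins a y z ∧ Γ.IsInner y ∧ Γ.IsInner z

/-- All edges at inner vertices point to them, intrinsically and in the last colour. -/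
def IsNormalized (Γ : ColGraph (k + 1) v e) : Prop :=
  ∀ a z, Γ.IsInner z → Γ.Meets a z → Γ.tgt a = z ∧ Γ.ori (Fin.last k) a = true

lemma reverse_isInner (Γ : ColGraph (k + 1) v e) (t : Fin e) (z : Fin v) :
    (Γ.reverse t).IsInner z ↔ Γ.IsInner z := (iso_reverse Γ t).isInner_iff z

lemma reverse_joins (Γ : ColGraph (k + 1) v e) (t a : Fin e) (x y : Fin v) :
    (Γ.reverse t).Joins a x y ↔ Γ.Joins a x y := (iso_reverse Γ t).joins_iff a x y

open Classical in
/-- A property of graphs may be proved by reversing edges and toggling weakly passing vertices. -/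
lemma induction_normalized {Q : ColGraph (k + 1) v e → Prop}
    (hrev : ∀ Γ t, Γ.IsAdmissible → Q (Γ.reverse t) → Q Γ)
    (htog : ∀ Γ z, Γ.IsAdmissible → Γ.IsWeaklyPassing z → Q (Γ.toggle z) → Q Γ)
    (hdeg : ∀ Γ, Γ.IsAdmissible → Γ.IsDegenerate → Q Γ)
    (hnorm : ∀ Γ, Γ.IsAdmissible → ¬ Γ.IsDegenerate → Γ.IsNormalized → Q Γ)
    (Γ : ColGraph (k + 1) v e) (hΓ : Γ.IsAdmissible) : Q Γ := by
  -- In a nondegenerate graph an edge has at most one inner end. Reversing an edge with inner source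
  -- replaces a weight of at least 2 by at most 1, and toggling then removes the remaining weights
  -- 1.
  let w : ColGraph (k + 1) v e → Fin e → ℕ := fun Γ a => (if Γ.IsInner (Γ.src a) then 2 else 0) +
    if Γ.IsInner (Γ.tgt a) ∧ Γ.ori (Fin.last k) a = false then 1 else 0
  induction hN : ∑ a, w Γ a using Nat.strong_induction_on generalizing Γ with
  | _ N ih =>
  by_cases hd : Γ.IsDegenerate
  · exact hdeg Γ hΓ hd
  unfold IsDegenerate at hd
  push Not at hd
  by_cases h1 : ∃ a, Γ.IsInner (Γ.src a)
  · obtain ⟨a, ha⟩ := h1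
    refine hrev Γ a hΓ (ih _ ?_ _ ((iso_reverse Γ a).admissible hΓ) rfl)
    rw [← hN]
    refine Finset.sum_lt_sum (fun b _ => ?_) ⟨a, Finset.mem_univ a, ?_⟩
    · by_cases hb : b = a
      · subst hb
        have h2 := hd.2 b _ _ (Γ.joins_src_tgt b) ha
        simp only [w, reverse_isInner]
        simp only [reverse, if_true, ha, h2, if_false]
        split_ifs <;> omega
      · simp only [w, reverse_isInner]
        simp only [reverse, if_neg hb, le_refl]
    · have h2 := hd.2 a _ _ (Γ.joins_src_tgt a) ha
      simp only [w, reverse_isInner]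
      simp only [reverse, if_true, ha, h2, if_false]
      split_ifs <;> omega
  push Not at h1
  have htgt : ∀ a z, Γ.IsInner z → Γ.Meets a z → Γ.tgt a = z := by
    rintro a z hz (rfl | h2)
    · exact absurd hz (h1 a)
    · exact h2
  by_cases h2 : ∃ a, Γ.IsInner (Γ.tgt a) ∧ Γ.ori (Fin.last k) a = false
  · obtain ⟨a, ha, hoa⟩ := h2
    have hwp : Γ.IsWeaklyPassing (Γ.tgt a) := ha.isWeaklyPassing_or.resolve_right (hd.1 _)
    -- Both edges point intrinsically to the vertex, which is not passing in the last colour, so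
    -- they have the same orientation there and a single toggle corrects both.
    have hall : ∀ b, Γ.Meets b (Γ.tgt a) → Γ.ori (Fin.last k) b = false := by
      intro b hb
      by_contra hob
      rw [Bool.not_eq_false] at hob
      refine hwp.2.2 ⟨⟨b, ?_⟩, a, ?_⟩
      · rw [head, if_pos hob, htgt b _ ha hb]
      · rw [tail, hoa]; rfl
    refine htog Γ _ hΓ hwp (ih _ ?_ _ (admissible_toggle hwp hΓ) rfl)
    rw [← hN]
    refine Finset.sum_lt_sum (fun b _ => ?_) ⟨a, Finset.mem_univ a, ?_⟩
    · simp only [w, toggle_isInner]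
      by_cases hb : Γ.Meets b (Γ.tgt a)
      · have h3 : (Γ.toggle (Γ.tgt a)).ori (Fin.last k) b = true := by
          have hb' : Γ.src b = Γ.tgt a ∨ Γ.tgt b = Γ.tgt a := hb
          simp [toggle, hb', hall b hb]
        rw [h3, if_neg (show ¬ Γ.IsInner ((Γ.toggle (Γ.tgt a)).src b) from h1 b), if_neg (h1 b)]
        simp
      · rw [toggle_ori_of_not_meets hb]
        rfl
    · simp only [w, toggle_isInner]
      have h3 : (Γ.toggle (Γ.tgt a)).ori (Fin.last k) a = true := by
        simp [toggle, hoa]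
      rw [h3, if_neg (show ¬ Γ.IsInner ((Γ.toggle (Γ.tgt a)).src a) from h1 a), if_neg (h1 a)]
      simp [ha, hoa]
  push Not at h2
  refine hnorm Γ hΓ ?_ fun a z hz ha => ?_
  · unfold IsDegenerate
    push Not
    exact hd
  · have h3 := htgt a z hz ha
    exact ⟨h3, Bool.eq_true_of_not_eq_false (h2 a (h3 ▸ hz))⟩

/-- In a normalized graph the orientations of the two edges at an inner vertex are opposite in all
colours except the last one. -/
lemma IsNormalized.ori_eq_not {Γ : ColGraph (k + 1) v e} (hΓ : Γ.IsAdmissible)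
    (hn : Γ.IsNormalized) {z : Fin v} (hz : Γ.IsInner z) {s t : Fin e} (hst : s ≠ t)
    (hs : Γ.Meets s z) (ht : Γ.Meets t z) (c : Fin k) :
    Γ.ori c.castSucc t = !Γ.ori c.castSucc s := by
  have h1 : ∀ d, Γ.Meets d z ↔ d = s ∨ d = t := fun d =>
    ⟨eq_or_eq_of_meets hΓ.loopless hz.1 hst hs ht, by rintro (rfl | rfl) <;> assumption⟩
  have h2 := (passesIn_iff_of_two_edges h1 (hΓ.loopless s) (hΓ.loopless t) c.castSucc).1 (hz.2 c)
  have h3 := (hn s z hz hs).1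
  have h4 := (hn t z hz ht).1
  have h5 := hΓ.loopless s
  have h6 := hΓ.loopless t
  unfold head at h2
  cases h7 : Γ.ori c.castSucc s <;> cases h8 : Γ.ori c.castSucc t <;> simp_all

end ColGraph

/-! ### Graphs with multiple edges: the vanishing of double dotted edges, and stability. -/

section MultipleEdges

open ColGraph

variable {K : Type u} [Field K] {k v e : ℕ} {n : ℤ}

lemma basisVecOrZero_mem_of_isDegenerate {Γ : ColGraph (k + 1) v e} (h : Γ.IsDegenerate) :
    basisVecOrZero K Γ ∈ sgcRel K k n := by
  rcases h with ⟨z, hz⟩ | ⟨a, y, z, ha, hy, hz⟩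
  · exact basisVecOrZero_mem_of_isPassing Γ hz
  · exact basisVecOrZero_mem_of_joins_inner Γ ha hy hz

/-- The chains of graphs in a submodule may be computed by reversing edges and toggling weakly
passing vertices. -/
lemma basisVecOrZero_mem_iff_reverse (hn : ¬ Even n) {B : Submodule K (Chains K (k + 1))}
    (hB : sgcRel K k n ≤ B) (Γ : ColGraph (k + 1) v e) (t : Fin e) :
    basisVecOrZero K (Γ.reverse t) ∈ B ↔ basisVecOrZero K Γ ∈ B := by
  have h1 := hB (symSpan_le_sgcRel (SModEq.sub_mem.1 (basisVecOrZero_reverse (K := K) hn Γ t)))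
  rw [sub_neg_eq_add] at h1
  exact ⟨fun h => (B.add_mem_iff_right h).1 h1, fun h => (B.add_mem_iff_left h).1 h1⟩

lemma basisVecOrZero_mem_iff_toggle [CharZero K] {B : Submodule K (Chains K (k + 1))}
    (hB : sgcRel K k n ≤ B) (Γ : ColGraph (k + 1) v e) {z : Fin v} (hz : Γ.IsWeaklyPassing z) :
    basisVecOrZero K (Γ.toggle z) ∈ B ↔ basisVecOrZero K Γ ∈ B := by
  have h1 := hB (basisVecOrZero_add_toggle_mem (K := K) (n := n) Γ hz)
  exact ⟨fun h => (B.add_mem_iff_left h).1 h1, fun h => (B.add_mem_iff_right h).1 h1⟩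

/-- Two skeleton edges of length 2 between the same vertices can be exchanged by an odd permutation
of the vertices. -/
lemma basisVecOrZero_mem_of_isNormalized [CharZero K] (hn : ¬ Even n) {Γ : ColGraph (k + 1) v e}
    (hΓ : Γ.IsAdmissible) (hdeg : ¬ Γ.IsDegenerate) (hnorm : Γ.IsNormalized) {x y z z' : Fin v}
    (hxy : x ≠ y) (hzz : z ≠ z') (hz : Γ.IsInner z) (hz' : Γ.IsInner z') {s t s' t' : Fin e}
    (hs : Γ.Joins s z x) (ht : Γ.Joins t z y) (hs' : Γ.Joins s' z' x) (ht' : Γ.Joins t' z' y) :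
    basisVecOrZero K Γ ∈ symSpan K (k + 1) n := by
  unfold IsDegenerate at hdeg
  push Not at hdeg
  have hx := hdeg.2 _ _ _ hs hz
  have hy := hdeg.2 _ _ _ ht hz
  have hxz : x ≠ z := fun h => hx (h ▸ hz)
  have hxz' : x ≠ z' := fun h => hx (h ▸ hz')
  have hyz : y ≠ z := fun h => hy (h ▸ hz)
  have hyz' : y ≠ z' := fun h => hy (h ▸ hz')
  obtain ⟨hs1, hs2⟩ := hnorm s z hz hs.meets_left
  obtain ⟨ht1, ht2⟩ := hnorm t z hz ht.meets_left
  obtain ⟨hs1', hs2'⟩ := hnorm s' z' hz' hs'.meets_left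
  obtain ⟨ht1', ht2'⟩ := hnorm t' z' hz' ht'.meets_left
  have hs3 : Γ.src s = x := by unfold Joins at hs; grind
  have ht3 : Γ.src t = y := by unfold Joins at ht; grind
  have hs3' : Γ.src s' = x := by unfold Joins at hs'; grind
  have ht3' : Γ.src t' = y := by unfold Joins at ht'; grind
  have hst : s ≠ t := by rintro rfl; exact hxy (hs3.symm.trans ht3)
  have hst' : s' ≠ t' := by rintro rfl; exact hxy (hs3'.symm.trans ht3')
  have hss : s ≠ s' := by rintro rfl; exact hzz (hs1.symm.trans hs1')
  have hst2 : s ≠ t' := by rintro rfl; exact hzz (hs1.symm.trans ht1')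
  have hts2 : t ≠ s' := by rintro rfl; exact hzz (ht1.symm.trans hs1')
  have htt : t ≠ t' := by rintro rfl; exact hzz (ht1.symm.trans ht1')
  have hoz := hnorm.ori_eq_not hΓ hz hst hs.meets_left ht.meets_left
  have hoz' := hnorm.ori_eq_not hΓ hz' hst' hs'.meets_left ht'.meets_left
  have hori : ∀ c : Fin k, Γ.ori c.castSucc s' = Γ.ori c.castSucc s := by
    intro c
    -- If the two strings ran in opposite directions in colour `c`, their four edges would form an
    -- oriented cycle.
    by_contra hne
    have h1 := hoz c
    have h2 := hoz' c
    refine hΓ.acyclic c.castSucc ⟨x, ?_⟩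
    cases h3 : Γ.ori c.castSucc s <;> cases h4 : Γ.ori c.castSucc s' <;>
      simp only [h3, h4, not_true, Bool.not_true, Bool.not_false] at hne h1 h2
    · refine .head (b := z') ⟨s', ?_, ?_⟩ (.head (b := y) ⟨t', ?_, ?_⟩
        (.head (b := z) ⟨t, ?_, ?_⟩ (.single ⟨s, ?_, ?_⟩))) <;> simp [tail, head, *]
    · refine .head (b := z) ⟨s, ?_, ?_⟩ (.head (b := y) ⟨t, ?_, ?_⟩
        (.head (b := z') ⟨t', ?_, ?_⟩ (.single ⟨s', ?_, ?_⟩))) <;> simp [tail, head, *]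
  have hmz : ∀ a, a ≠ s → a ≠ t → ¬ Γ.Meets a z := fun a h1 h2 h3 => by
    rcases eq_or_eq_of_meets hΓ.loopless hz.1 hst hs.meets_left ht.meets_left h3 with h | h <;>
      tauto
  have hmz' : ∀ a, a ≠ s' → a ≠ t' → ¬ Γ.Meets a z' := fun a h1 h2 h3 => by
    rcases eq_or_eq_of_meets hΓ.loopless hz'.1 hst' hs'.meets_left ht'.meets_left h3 with h | h <;>
      tauto
  -- Exchanging the two middle vertices, which is odd, has the same effect as a permutation of the
  -- edges, which is free. Hence `Γ` is equivalent to `-Γ`.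
  have key : Γ.permVertices (Equiv.swap z z') =
      Γ.permEdges (Equiv.swap s s' * Equiv.swap t t') := by
    have hτ : (Equiv.swap s s' * Equiv.swap t t').symm = Equiv.swap t t' * Equiv.swap s s' := by
      simp [← Equiv.Perm.inv_def]
    have e1 : (Equiv.swap t t' * Equiv.swap s s') s = s' := by
      simp [Equiv.swap_apply_of_ne_of_ne hts2.symm hst']
    have e2 : (Equiv.swap t t' * Equiv.swap s s') s' = s := by
      simp [Equiv.swap_apply_of_ne_of_ne hst hst2]
    have e3 : (Equiv.swap t t' * Equiv.swap s s') t = t' := by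
      simp [Equiv.swap_apply_of_ne_of_ne hst.symm hts2]
    have e4 : (Equiv.swap t t' * Equiv.swap s s') t' = t := by
      simp [Equiv.swap_apply_of_ne_of_ne hst2.symm hst'.symm]
    have e5 : ∀ a, a ≠ s → a ≠ s' → a ≠ t → a ≠ t' →
        (Equiv.swap t t' * Equiv.swap s s') a = a := by
      intro a h1 h2 h3 h4
      rw [Equiv.Perm.mul_apply, Equiv.swap_apply_of_ne_of_ne h1 h2,
        Equiv.swap_apply_of_ne_of_ne h3 h4]
    have hcases : ∀ a, a = s ∨ a = s' ∨ a = t ∨ a = t' ∨ (a ≠ s ∧ a ≠ s' ∧ a ≠ t ∧ a ≠ t') := by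
      intro a
      tauto
    refine ext_fields (fun a => ?_) (fun a => ?_) fun c a => ?_
    · simp only [permVertices, permEdges, hτ]
      rcases hcases a with rfl | rfl | rfl | rfl | ⟨h1, h2, h3, h4⟩
      · rw [e1, hs3, hs3', Equiv.swap_apply_of_ne_of_ne hxz hxz']
      · rw [e2, hs3, hs3', Equiv.swap_apply_of_ne_of_ne hxz hxz']
      · rw [e3, ht3, ht3', Equiv.swap_apply_of_ne_of_ne hyz hyz']
      · rw [e4, ht3, ht3', Equiv.swap_apply_of_ne_of_ne hyz hyz']
      · rw [e5 a h1 h2 h3 h4, Equiv.swap_apply_of_ne_of_ne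
          (fun h => hmz a h1 h3 (Or.inl h)) (fun h => hmz' a h2 h4 (Or.inl h))]
    · simp only [permVertices, permEdges, hτ]
      rcases hcases a with rfl | rfl | rfl | rfl | ⟨h1, h2, h3, h4⟩
      · rw [e1, hs1, hs1', Equiv.swap_apply_left]
      · rw [e2, hs1, hs1', Equiv.swap_apply_right]
      · rw [e3, ht1, ht1', Equiv.swap_apply_left]
      · rw [e4, ht1, ht1', Equiv.swap_apply_right]
      · rw [e5 a h1 h2 h3 h4, Equiv.swap_apply_of_ne_of_ne
          (fun h => hmz a h1 h3 (Or.inr h)) (fun h => hmz' a h2 h4 (Or.inr h))]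
    · simp only [permVertices, permEdges, hτ]
      have hos : Γ.ori c s' = Γ.ori c s := by
        refine Fin.lastCases ?_ hori c
        rw [hs2, hs2']
      have hot : Γ.ori c t' = Γ.ori c t := by
        refine Fin.lastCases ?_ (fun c => ?_) c
        · rw [ht2, ht2']
        · rw [hoz, hoz', hori]
      rcases hcases a with rfl | rfl | rfl | rfl | ⟨h1, h2, h3, h4⟩
      · rw [e1, hos]
      · rw [e2, hos]
      · rw [e3, hot]
      · rw [e4, hot]
      · rw [e5 a h1 h2 h3 h4]
  have h1 := basisVecOrZero_permVertices (K := K) hn Γ (Equiv.swap z z')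
  rw [key, Equiv.Perm.sign_swap hzz] at h1
  have h2 := SModEq.sub_mem.1 ((basisVecOrZero_permEdges (K := K) hn Γ _).symm.trans h1)
  have h3 : basisVecOrZero K Γ - (((-1 : ℤˣ) : ℤ) : K) • basisVecOrZero K Γ =
      (2 : K) • basisVecOrZero K Γ := by
    rw [two_smul]
    simp
  rw [h3] at h2
  exact (Submodule.smul_mem_iff _ two_ne_zero).1 h2

/-- A graph with two skeleton edges of length 2 between the same vertices vanishes. -/
lemma basisVecOrZero_mem_of_double_dotted [CharZero K] (hn : ¬ Even n) {Γ : ColGraph (k + 1) v e}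
    (hΓ : Γ.IsAdmissible) {x y z z' : Fin v} (hxy : x ≠ y) (hzz : z ≠ z') (hz : Γ.IsInner z)
    (hz' : Γ.IsInner z') (hs : ∃ s, Γ.Joins s z x) (ht : ∃ t, Γ.Joins t z y)
    (hs' : ∃ s, Γ.Joins s z' x) (ht' : ∃ t, Γ.Joins t z' y) :
    basisVecOrZero K Γ ∈ sgcRel K k n := by
  refine induction_normalized (Q := fun Γ : ColGraph (k + 1) v e => Γ.IsInner z → Γ.IsInner z' →
    (∃ s, Γ.Joins s z x) → (∃ t, Γ.Joins t z y) → (∃ s, Γ.Joins s z' x) →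
    (∃ t, Γ.Joins t z' y) → basisVecOrZero K Γ ∈ sgcRel K k n) ?_ ?_ ?_ ?_ Γ hΓ hz hz' hs ht hs' ht'
  · intro Γ r _ ih
    simp only [reverse_isInner, reverse_joins, basisVecOrZero_mem_iff_reverse hn le_rfl] at ih
    exact ih
  · intro Γ r _ hr ih
    simp only [toggle_isInner, basisVecOrZero_mem_iff_toggle le_rfl Γ hr] at ih
    exact ih
  · intro Γ _ hd _ _ _ _ _ _
    exact basisVecOrZero_mem_of_isDegenerate hd
  · rintro Γ hΓ hd hnorm hz hz' ⟨s, hs⟩ ⟨t, ht⟩ ⟨s', hs'⟩ ⟨t', ht'⟩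
    exact symSpan_le_sgcRel (basisVecOrZero_mem_of_isNormalized hn hΓ hd hnorm hxy hzz hz hz' hs ht
      hs' ht')

/-- The basis vectors of the graphs with a multiple edge that includes a solid one. -/
abbrev multipleGen (K : Type u) [Field K] {k : ℕ}
    (Γ : {Γ : AdmGraph (k + 1) // ∃ a, Γ.graph.IsParallel a ∨ Γ.graph.IsBypassed a}) :
    Chains K (k + 1) := basisVec K Γ.1.graph Γ.1.adm

/-- A degenerate graph is zero already. Otherwise inner vertices are weakly passing, so the bypass
counts as a dotted edge. -/
lemma basisVecOrZero_mem_nomulRel {Γ : ColGraph (k + 1) v e} {a : Fin e}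
    (ha : Γ.IsParallel a ∨ Γ.IsBypassed a) : basisVecOrZero K Γ ∈ nomulRel K k n := by
  by_cases hΓ : Γ.IsAdmissible
  swap
  · rw [basisVecOrZero_of_not_adm hΓ]
    exact zero_mem _
  by_cases hd : Γ.IsDegenerate
  · exact notadpRel_le_nomulRel K k n
      (sgcRel_le_notadpRel K k n (basisVecOrZero_mem_of_isDegenerate hd))
  rw [basisVecOrZero_of_adm hΓ]
  refine Submodule.mem_sup_right (Submodule.subset_span ⟨v, e, Γ, hΓ,
    ⟨Γ.src a, Γ.tgt a, hΓ.loopless a, ?_, ?_, ?_⟩, rfl⟩)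
  · intro h
    rcases ha with ha | ha <;> exact ha.1 h.isInner
  · intro h
    rcases ha with ha | ha <;> exact ha.2.1 h.isInner
  · rcases ha with ⟨-, -, b, hb, hj⟩ | ⟨-, -, z, hz, hs, ht⟩
    · refine le_add_right ?_
      rw [Nat.succ_le_iff, Set.one_lt_ncard]
      exact ⟨a, Γ.joins_src_tgt a, b, hj, hb.symm⟩
    · have h1 : 0 < (Γ.solidEdges (Γ.src a) (Γ.tgt a)).ncard :=
        (Set.ncard_pos).2 ⟨a, Γ.joins_src_tgt a⟩
      unfold IsDegenerate at hd
      push Not at hd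
      have h2 : 0 < (Γ.dottedEdges (Γ.src a) (Γ.tgt a)).ncard :=
        (Set.ncard_pos).2 ⟨z, hz.isWeaklyPassing_or.resolve_right (hd.1 z), hs, ht⟩
      omega

/-- A multiple edge contains two solid edges, a solid and a dotted one, or two dotted ones. The last
case vanishes by the odd symmetry. -/
lemma basisVecOrZero_mem_or_of_hasMultipleEdge [CharZero K] (hn : ¬ Even n)
    {Γ : ColGraph (k + 1) v e} (hΓ : Γ.IsAdmissible) (h : Γ.HasMultipleEdge) :
    basisVecOrZero K Γ ∈ sgcRel K k n ∨ ∃ a, Γ.IsParallel a ∨ Γ.IsBypassed a := by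
  by_cases hd : Γ.IsDegenerate
  · exact Or.inl (basisVecOrZero_mem_of_isDegenerate hd)
  unfold IsDegenerate at hd
  push Not at hd
  obtain ⟨x, y, hxy, hx, hy, hcard⟩ := h
  have hx' : ¬ Γ.IsInner x := fun h => hx (h.isWeaklyPassing_or.resolve_right (hd.1 x))
  have hy' : ¬ Γ.IsInner y := fun h => hy (h.isWeaklyPassing_or.resolve_right (hd.1 y))
  by_cases h2 : 1 < (Γ.solidEdges x y).ncard
  · obtain ⟨a, ha, b, hb, hab⟩ := (Set.one_lt_ncard).1 h2
    exact Or.inr ⟨a, Or.inl (ha.isParallel_iff.2 ⟨hx', hy', b, hab.symm, hb⟩)⟩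
  by_cases h3 : 0 < (Γ.solidEdges x y).ncard
  · have h4 : 0 < (Γ.dottedEdges x y).ncard := by omega
    obtain ⟨a, ha⟩ := (Set.ncard_pos).1 h3
    obtain ⟨z, hz, hs, ht⟩ := (Set.ncard_pos).1 h4
    exact Or.inr ⟨a, Or.inr (Joins.isBypassed_iff ha |>.2 ⟨hx', hy', z, hz.isInner, hs, ht⟩)⟩
  · have h4 : 1 < (Γ.dottedEdges x y).ncard := by omega
    obtain ⟨z, ⟨hz, hs, ht⟩, z', ⟨hz', hs', ht'⟩, hzz⟩ := (Set.one_lt_ncard).1 h4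
    exact Or.inl (basisVecOrZero_mem_of_double_dotted hn hΓ hxy hzz hz.isInner hz'.isInner hs ht
      hs' ht')

lemma nomulRel_le [CharZero K] (hn : ¬ Even n) :
    nomulRel K k n ≤ notadpRel K k n ⊔ Submodule.span K (Set.range (multipleGen K (k := k))) := by
  refine sup_le le_sup_left (Submodule.span_le.2 ?_)
  rintro _ ⟨v, e, Γ, hΓ, h, rfl⟩
  rcases basisVecOrZero_mem_or_of_hasMultipleEdge (K := K) hn hΓ h with h1 | h1
  · rw [← basisVecOrZero_of_adm hΓ]
    exact Submodule.mem_sup_left (sgcRel_le_notadpRel K k n h1)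
  · exact Submodule.mem_sup_right (Submodule.subset_span ⟨⟨⟨Γ, hΓ⟩, h1⟩, rfl⟩)

lemma map_nomulRel_le [CharZero K] (hn : ¬ Even n) {M : Type*} [AddCommGroup M] [Module K M]
    (f : Chains K (k + 1) →ₗ[K] M) (S : Submodule K M) (h₁ : ∀ x ∈ notadpRel K k n, f x ∈ S)
    (h₂ : ∀ {v e : ℕ} (Γ : ColGraph (k + 1) v e) (a : Fin e), Γ.IsAdmissible →
      Γ.IsParallel a ∨ Γ.IsBypassed a → f (basisVecOrZero K Γ) ∈ S) :
    ∀ x ∈ nomulRel K k n, f x ∈ S := by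
  suffices nomulRel K k n ≤ S.comap f from this
  refine (nomulRel_le hn).trans (sup_le h₁ (Submodule.span_le.2 ?_))
  rintro _ ⟨⟨⟨Γ, hΓ⟩, a, ha⟩, rfl⟩
  change f (basisVec K Γ hΓ) ∈ S
  rw [← basisVecOrZero_of_adm hΓ]
  exact h₂ Γ a hΓ ha

/-- A contraction elsewhere keeps the multiple edge. Contracting one of two parallel edges gives a
loop, and contracting half of a bypass gives two parallel edges. Contracting a solid edge next to
the bypass turns the bypass into a tadpole, so tadpoles have to be divided out first. -/
lemma delta_nomulRel [CharZero K] (hn : ¬ Even n) :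
    ∀ x ∈ nomulRel K k n, delta K (k + 1) n x ∈ nomulRel K k n := by
  refine map_nomulRel_le hn _ _
    (fun x hx => notadpRel_le_nomulRel K k n (delta_notadpRel hn x hx)) ?_
  intro v e Γ a hΓ ha
  obtain ⟨v, e, rfl, rfl⟩ := IsAdmissible.exists_succ hΓ
  rw [delta_basisVecOrZero hΓ]
  refine sum_mem fun t _ => term_mem Γ t fun hne hadm => ?_
  rcases ha with ha | ha
  · have hat : a ≠ t := by
      rintro rfl
      exact ha.not_admissible_contract hadm
    obtain ⟨a, rfl⟩ := Fin.exists_succAbove_eq hat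
    exact basisVecOrZero_mem_nomulRel (Or.inl (ha.contract hΓ hadm))
  have hja := Γ.joins_src_tgt a
  obtain ⟨hx, hy, z, hz, ⟨r, hr⟩, s, hs⟩ := ha
  have haz : ¬ Γ.Meets a z := by
    rintro (h | h)
    · exact hx (h ▸ hz)
    · exact hy (h ▸ hz)
  have hra : r ≠ a := fun h => haz (h ▸ hr.meets_left)
  have hsa : s ≠ a := fun h => haz (h ▸ hs.meets_left)
  have hxy := hΓ.loopless a
  have hrs : r ≠ s := by
    rintro rfl
    unfold Joins at hr hs
    grind
  have hmz : ∀ b, Γ.Meets b z → b = r ∨ b = s := fun b =>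
    eq_or_eq_of_meets hΓ.loopless hz.1 hrs hr.meets_left hs.meets_left
  by_cases htr : t = r
  · subst htr
    obtain ⟨a, rfl⟩ := Fin.exists_succAbove_eq hra.symm
    obtain ⟨s, rfl⟩ := Fin.exists_succAbove_eq hrs.symm
    exact basisVecOrZero_mem_nomulRel
      (Or.inl (isParallel_contract_of_bypass hΓ hadm hy hx hz hja.symm hs hr).1)
  by_cases hts : t = s
  · subst hts
    obtain ⟨a, rfl⟩ := Fin.exists_succAbove_eq hsa.symm
    obtain ⟨r, rfl⟩ := Fin.exists_succAbove_eq hrs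
    exact basisVecOrZero_mem_nomulRel
      (Or.inl (isParallel_contract_of_bypass hΓ hadm hx hy hz hja hr hs).1)
  have htz : ¬ Γ.Meets t z := fun h => by rcases hmz t h with h | h <;> tauto
  have hz' : (Γ.contract t hne).IsInner (Γ.contractMap t hne z) := (isInner_contract_iff htz).2 hz
  obtain ⟨r, rfl⟩ := Fin.exists_succAbove_eq (Ne.symm htr)
  obtain ⟨s, rfl⟩ := Fin.exists_succAbove_eq (Ne.symm hts)
  have hr' := joins_contract (h := hne) hr
  have hs' := joins_contract (h := hne) hs
  by_cases hta : Γ.Joins t (Γ.src a) (Γ.tgt a)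
  · rw [hta.contractMap_eq] at hr'
    rcases hz'.isWeaklyPassing_or with hw | hw
    · refine notadpRel_le_nomulRel K k n (basisVecOrZero_mem_of_hasTadpole _
        ⟨Γ.contractMap t hne z, Γ.contractMap t hne (Γ.tgt a), hw, fun b hb => ?_⟩)
      rcases hmz _ ((meets_contract_iff htz b).1 hb) with h | h
      · rw [Fin.succAbove_right_injective h]
        exact hr'
      · rw [Fin.succAbove_right_injective h]
        exact hs'
    · exact notadpRel_le_nomulRel K k n
        (sgcRel_le_notadpRel K k n (basisVecOrZero_mem_of_isPassing _ hw))
  · have hat : a ≠ t := by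
      rintro rfl
      exact hta hja
    obtain ⟨a, rfl⟩ := Fin.exists_succAbove_eq hat
    refine basisVecOrZero_mem_nomulRel (a := a) (Or.inr ?_)
    rw [(joins_contract hja).isBypassed_iff]
    exact ⟨not_isInner_contract hΓ hx hra (Fin.succAbove_ne t r) hat hr.meets_right hja.meets_left,
      not_isInner_contract hΓ hy hsa (Fin.succAbove_ne t s) hat hs.meets_right hja.meets_right,
      _, hz', ⟨r, hr'⟩, s, hs'⟩

lemma isBypassed_subdivide {Γ : ColGraph (k + 1) v e} {a : Fin e} (ha : Γ.IsParallel a) :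
    ∃ b, (Γ.subdivide a).IsBypassed b := by
  obtain ⟨h1, h2, b, hb, hj⟩ := ha
  have hj' : Γ.Joins b (Γ.tail (Fin.last k) a) (Γ.head (Fin.last k) a) ∧
      ¬ Γ.IsInner (Γ.tail (Fin.last k) a) ∧ ¬ Γ.IsInner (Γ.head (Fin.last k) a) := by
    rcases Γ.tail_eq (Fin.last k) a with ⟨h3, h4, -⟩ | ⟨h3, h4, -⟩ <;> rw [h3, h4]
    · exact ⟨hj, h1, h2⟩
    · exact ⟨hj.symm, h2, h1⟩
  refine ⟨b.castSucc, ((subdivide_joins_of_ne hb).2 hj'.1).isBypassed_iff.2 ?_⟩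
  rw [isInner_subdivide_castSucc, isInner_subdivide_castSucc]
  exact ⟨hj'.2.1, hj'.2.2, _, (Γ.isWeaklyPassing_subdivide_last a).isInner,
    ⟨_, (Γ.subdivide_joins_last a).1⟩, _, (Γ.subdivide_joins_last a).2⟩

lemma graphMap_subdivideSum_nomulRel [CharZero K] (hn : ¬ Even n) :
    ∀ x ∈ nomulRel K k n, graphMap (subdivideSum K) x ∈ nomulRel K k n := by
  refine map_nomulRel_le hn _ _
    (fun x hx => notadpRel_le_nomulRel K k n (graphMap_subdivideSum_notadpRel hn x hx)) ?_
  intro v e Γ _ hΓ _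
  rw [graphMap_basisVecOrZero _ hΓ]
  refine sum_mem fun a ha => ?_
  obtain ⟨b, hb⟩ := isBypassed_subdivide (mem_parallelEdges.1 ha)
  exact basisVecOrZero_mem_nomulRel (Or.inr hb)

end MultipleEdges

/-! ### Moving one label to the last place. -/

section MoveLast

variable {N : ℕ}

/-- The permutation that moves `p` to the last place. -/
def moveLast (p : Fin (N + 1)) : Equiv.Perm (Fin (N + 1)) :=
  (finSuccEquiv' p).trans finSuccEquivLast.symm

@[simp]
lemma moveLast_self (p : Fin (N + 1)) : moveLast p p = Fin.last N := by
  simp [moveLast]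

@[simp]
lemma moveLast_succAbove (p : Fin (N + 1)) (i : Fin N) :
    moveLast p (p.succAbove i) = i.castSucc := by
  simp [moveLast]

@[simp]
lemma moveLast_symm_last (p : Fin (N + 1)) : (moveLast p).symm (Fin.last N) = p := by
  rw [Equiv.symm_apply_eq, moveLast_self]

@[simp]
lemma moveLast_symm_castSucc (p : Fin (N + 1)) (i : Fin N) :
    (moveLast p).symm i.castSucc = p.succAbove i := by
  rw [Equiv.symm_apply_eq, moveLast_succAbove]

/-- The permutation induced on the other labels is the identity, so the sign follows from
`sign_removePerm`. -/
lemma sign_moveLast (p : Fin (N + 1)) :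
    (Equiv.Perm.sign (moveLast p) : ℤ) = (-1) ^ (N - (p : ℕ)) := by
  have h1 : removePerm (moveLast p) p = 1 := by
    refine Equiv.ext fun i => ?_
    have h2 := succAbove_removePerm (moveLast p) p i
    rw [moveLast_self, moveLast_succAbove, Fin.succAbove_last_apply] at h2
    exact Fin.castSucc_injective _ h2
  have h2 := sign_removePerm (moveLast p) p
  rw [h1, moveLast_self, Equiv.Perm.sign_one, Fin.val_last] at h2
  have h3 : (-1 : ℤ) ^ N = (-1) ^ (N - (p : ℕ)) * (-1) ^ (p : ℕ) := by
    rw [← pow_add, Nat.sub_add_cancel (Nat.lt_succ_iff.1 p.isLt)]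
  have h4 : ((-1 : ℤ) ^ (p : ℕ)) * (-1) ^ (p : ℕ) = 1 := by
    rw [← mul_pow]; simp
  have h5 : ((-1 : ℤ) ^ (N - (p : ℕ))) * (-1) ^ (N - (p : ℕ)) = 1 := by
    rw [← mul_pow]; simp
  rw [h3, Units.val_one] at h2
  linear_combination -(-1) ^ (N - (p : ℕ)) * h2 - (Equiv.Perm.sign (moveLast p) : ℤ) * h5 -
    (Equiv.Perm.sign (moveLast p) : ℤ) * ((-1) ^ (N - (p : ℕ)) * (-1) ^ (N - (p : ℕ))) * h4

end MoveLast

/-! ### Subdivision after contraction, and the new parallel edges of a contraction. -/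

namespace ColGraph

variable {k v e : ℕ}

/-- Contraction of an edge at an inner vertex of a normalized graph, followed by subdivision of the
other edge, gives back the graph. -/
lemma subdivide_contract {Γ : ColGraph (k + 1) (v + 1) (e + 1)} {t : Fin (e + 1)} {b : Fin e}
    {h : Γ.src t ≠ Γ.tgt t} (hΓ : Γ.IsAdmissible) (hnorm : Γ.IsNormalized)
    (hz : Γ.IsInner (Γ.tgt t)) (hb : Γ.Meets (t.succAbove b) (Γ.tgt t)) :
    (Γ.contract t h).subdivide b =
      (Γ.permVertices (moveLast (Γ.tgt t))).permEdges (moveLast t) := by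
  have hbt := Fin.succAbove_ne t b
  have hmt : Γ.Meets t (Γ.tgt t) := Or.inr rfl
  have hoff : ∀ d, d ≠ b → ¬ Γ.Meets (t.succAbove d) (Γ.tgt t) := by
    intro d hd hm
    rcases eq_or_eq_of_meets hΓ.loopless hz.1 hbt hb hmt hm with h1 | h1
    · exact hd (Fin.succAbove_right_injective h1)
    · exact Fin.succAbove_ne t d h1
  obtain ⟨hb1, hb2⟩ := hnorm _ _ hz hb
  obtain ⟨-, ht2⟩ := hnorm _ _ hz hmt
  have hσ : ∀ u w, (Γ.tgt t).succAbove u = w → u.castSucc = moveLast (Γ.tgt t) w := by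
    rintro u _ rfl
    rw [moveLast_succAbove]
  have hhead : (Γ.contract t h).head (Fin.last k) b = (Γ.contract t h).tgt b := if_pos hb2
  have hob : (Γ.contract t h).ori (Fin.last k) b = true := hb2
  refine ext_fields (fun a => ?_) (fun a => ?_) fun c a => ?_
  · refine Fin.lastCases ?_ (fun d => ?_) a
    · rw [subdivide, expand_src_last, hhead]
      simp only [permEdges, permVertices, moveLast_symm_last]
      refine hσ _ _ ?_
      rw [succAbove_contract_tgt, if_pos hb1]
    · simp only [permEdges, permVertices, moveLast_symm_castSucc]
      rw [subdivide, expand_src_castSucc, if_neg fun h => by simp [hob] at h]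
      refine hσ _ _ ?_
      rw [succAbove_contract_src, if_neg]
      intro hd
      by_cases hdb : d = b
      · subst hdb
        exact hΓ.loopless _ (hd.trans hb1.symm)
      · exact hoff d hdb (Or.inl hd)
  · refine Fin.lastCases ?_ (fun d => ?_) a
    · rw [subdivide, expand_tgt_last]
      simp only [permEdges, permVertices, moveLast_symm_last, moveLast_self]
    · simp only [permEdges, permVertices, moveLast_symm_castSucc]
      rw [subdivide, expand_tgt_castSucc]
      split_ifs with hd
      · rw [hd.1, hb1, moveLast_self]
      · have hdb : d ≠ b := fun h => hd ⟨h, hob⟩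
        refine hσ _ _ ?_
        rw [succAbove_contract_tgt, if_neg fun h => hoff d hdb (Or.inr h)]
  · refine Fin.lastCases ?_ (fun d => ?_) a
    · rw [subdivide, expand_ori_last, hob]
      simp only [permEdges, permVertices, moveLast_symm_last]
      refine Fin.lastCases ?_ (fun c => ?_) c
      · simp [ht2]
      · have h1 := hnorm.ori_eq_not hΓ hz hbt hb hmt c
        rw [h1]
        simp [contract, (Fin.castSucc_lt_last c).ne]
    · simp only [permEdges, permVertices, moveLast_symm_castSucc]
      rw [subdivide, expand_ori_castSucc]
      rfl

end ColGraph

section SubdivideContract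

open ColGraph

variable {K : Type u} [Field K] {k v e : ℕ} {n : ℤ}

/-- Contracting and subdividing moves the vertex and the edge to the last places. The sign of this
relabelling is the sign of the contraction, so the product is `+1`. -/
lemma contractSign_smul_subdivide_contract (hn : ¬ Even n)
    {Γ : ColGraph (k + 1) (v + 1) (e + 1)} {t : Fin (e + 1)} {b : Fin e}
    {h : Γ.src t ≠ Γ.tgt t} (hΓ : Γ.IsAdmissible) (hnorm : Γ.IsNormalized)
    (hz : Γ.IsInner (Γ.tgt t)) (hb : Γ.Meets (t.succAbove b) (Γ.tgt t)) :
    contractSign K n (Γ.tgt t) t • basisVecOrZero K ((Γ.contract t h).subdivide b) ≡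
      basisVecOrZero K Γ [SMOD symSpan K (k + 1) n] := by
  rw [subdivide_contract hΓ hnorm hz hb]
  have h1 := ((basisVecOrZero_permEdges (K := K) hn _ (moveLast t)).trans
    (basisVecOrZero_permVertices (K := K) hn Γ (moveLast (Γ.tgt t)))).smul
      (contractSign K n (Γ.tgt t) t)
  refine h1.trans ?_
  rw [smul_smul, contractSign_of_odd hn, sign_moveLast]
  push_cast
  rw [← mul_pow]
  simp

/-- Subdivisions of parallel edges are equivalent. -/
lemma basisVecOrZero_subdivide_of_joins (hn : ¬ Even n) {Γ : ColGraph (k + 1) v e}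
    (hΓ : Γ.IsAdmissible) {a b : Fin e} (hab : a ≠ b) (h : Γ.Joins a (Γ.src b) (Γ.tgt b)) :
    basisVecOrZero K (Γ.subdivide a) ≡ basisVecOrZero K (Γ.subdivide b)
      [SMOD symSpan K (k + 1) n] := by
  have hth := fun c => joins_tail_head (hΓ.acyclic c) h (Γ.joins_src_tgt b)
  have hla := hΓ.loopless a
  have hlb := hΓ.loopless b
  have h1 := Γ.subdivide_permEdges a (Equiv.swap a b)
  rw [Equiv.swap_apply_left] at h1
  have h2 := basisVecOrZero_permEdges (K := K) hn (Γ.subdivide a) (extendLast (Equiv.swap a b))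
  rw [← h1] at h2
  refine h2.symm.trans ?_
  have hcases : ∀ d, d = a ∨ d = b ∨ (d ≠ a ∧ d ≠ b) := fun d => by tauto
  rcases h with ⟨h3, h4⟩ | ⟨h3, h4⟩
  · have h5 : ∀ c, Γ.ori c a = Γ.ori c b := by
      intro c
      have h6 := (hth c).1
      unfold tail at h6
      cases h7 : Γ.ori c a <;> cases h8 : Γ.ori c b <;> simp_all
    have h6 : Γ.permEdges (Equiv.swap a b) = Γ := by
      refine ext_fields (fun d => ?_) (fun d => ?_) fun c d => ?_ <;>
        simp only [permEdges, Equiv.symm_swap] <;>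
        rcases hcases d with rfl | rfl | ⟨h7, h8⟩ <;>
        simp [*, Equiv.swap_apply_of_ne_of_ne]
    rw [h6]
  · have h5 : ∀ c, Γ.ori c a = !Γ.ori c b := by
      intro c
      have h6 := (hth c).1
      unfold tail at h6
      cases h7 : Γ.ori c a <;> cases h8 : Γ.ori c b <;> simp_all
    have h6 : Γ.permEdges (Equiv.swap a b) = (Γ.reverse a).reverse b := by
      have hba := hab.symm
      refine ext_fields (fun d => ?_) (fun d => ?_) fun c d => ?_ <;>
        simp only [permEdges, Equiv.symm_swap] <;>
        rcases hcases d with rfl | rfl | ⟨h7, h8⟩ <;>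
        simp [reverse, *, Equiv.swap_apply_of_ne_of_ne]
    rw [h6, subdivide_reverse, subdivide_reverse]
    have h7 := (basisVecOrZero_reverse (K := K) hn ((Γ.subdivide b).reverse a.castSucc)
      b.castSucc).trans (basisVecOrZero_reverse (K := K) hn (Γ.subdivide b) a.castSucc).neg
    rwa [neg_neg] at h7

open Classical in
/-- The parallel edges of a contraction that do not come from parallel edges. -/
def newParallelEdges (Γ : ColGraph (k + 1) (v + 1) (e + 1)) (t : Fin (e + 1))
    (h : Γ.src t ≠ Γ.tgt t) : Finset (Fin e) :=
  parallelEdges (Γ.contract t h) \ Finset.univ.filter fun a => Γ.IsParallel (t.succAbove a)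

lemma mem_newParallelEdges {Γ : ColGraph (k + 1) (v + 1) (e + 1)} {t : Fin (e + 1)}
    {h : Γ.src t ≠ Γ.tgt t} {a : Fin e} : a ∈ newParallelEdges Γ t h ↔
      (Γ.contract t h).IsParallel a ∧ ¬ Γ.IsParallel (t.succAbove a) := by
  simp [newParallelEdges, mem_parallelEdges]

/-- If an edge at an inner vertex is contracted then the new parallel edges are the other edge at
this vertex and the edge parallel to it. -/
lemma eq_or_joins_of_mem_newParallelEdges {Γ : ColGraph (k + 1) (v + 1) (e + 1)} {t : Fin (e + 1)}
    {h : Γ.src t ≠ Γ.tgt t} (hΓ : Γ.IsAdmissible) (hdeg : ¬ Γ.IsDegenerate)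
    (hz : Γ.IsInner (Γ.tgt t)) {a b : Fin e} (hb : Γ.Meets (t.succAbove b) (Γ.tgt t))
    (ha : a ∈ newParallelEdges Γ t h) :
    a = b ∨ (a ≠ b ∧ (Γ.contract t h).Joins a ((Γ.contract t h).src b)
      ((Γ.contract t h).tgt b)) := by
  unfold IsDegenerate at hdeg
  push Not at hdeg
  rw [mem_newParallelEdges] at ha
  by_contra hne
  push Not at hne
  have hab := hne.1
  have hne := hne.2 hab
  have hoff : ∀ d, d ≠ b → ¬ Γ.Meets (t.succAbove d) (Γ.tgt t) := by
    intro d hd hm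
    rcases eq_or_eq_of_meets hΓ.loopless hz.1 (Fin.succAbove_ne t b) hb (Or.inr rfl) hm with h1 | h1
    · exact hd (Fin.succAbove_right_injective h1)
    · exact Fin.succAbove_ne t d h1
  obtain ⟨⟨h1, h2, c, hca, hc⟩, h3⟩ := ha
  have hcb : c ≠ b := by
    rintro rfl
    refine hne ?_
    have h4 := (Γ.contract t h).joins_src_tgt a
    unfold Joins at hc ⊢
    grind
  -- Away from the deleted vertex the contraction is injective on vertices. An edge and its parallel
  -- partner that both avoid that vertex were therefore already parallel in `Γ`.
  have hinj : ∀ u w, u ≠ Γ.tgt t → w ≠ Γ.tgt t →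
      Γ.contractMap t h u = Γ.contractMap t h w → u = w := by
    intro u w hu hw huw
    rw [contractMap_eq_iff] at huw
    tauto
  have ha' := hoff a hab
  have hc' := hoff c hcb
  unfold Meets at ha' hc'
  push Not at ha' hc'
  -- The source of `t` is adjacent to an inner vertex, so it is not inner by nondegeneracy. Other
  -- vertices do not change.
  have hinner : ∀ u, u ≠ Γ.tgt t → ¬ (Γ.contract t h).IsInner (Γ.contractMap t h u) →
      ¬ Γ.IsInner u := by
    intro u hu h4
    by_cases htu : Γ.Meets t u
    · refine hdeg.2 t (Γ.tgt t) u (Or.inr ⟨?_, rfl⟩) hz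
      exact htu.resolve_right fun h => hu h.symm
    · rwa [isInner_contract_iff htu] at h4
  refine h3 ⟨hinner _ ha'.1 h1, hinner _ ha'.2 h2, t.succAbove c,
    fun h => hca (Fin.succAbove_right_injective h), ?_⟩
  rcases hc with ⟨h4, h5⟩ | ⟨h4, h5⟩
  · exact Or.inl ⟨hinj _ _ hc'.1 ha'.1 h4, hinj _ _ hc'.2 ha'.2 h5⟩
  · exact Or.inr ⟨hinj _ _ hc'.1 ha'.2 h4, hinj _ _ hc'.2 ha'.1 h5⟩

/-- Each new parallel edge is the other half of the string or parallel to it, and subdivisions of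
parallel edges agree. So every one contributes `+1` to the diagonal, and no cancellation can occur.
-/
lemma contractSign_smul_subdivide_of_mem (hn : ¬ Even n)
    {Γ : ColGraph (k + 1) (v + 1) (e + 1)} {t : Fin (e + 1)} {h : Γ.src t ≠ Γ.tgt t}
    (hΓ : Γ.IsAdmissible) (hdeg : ¬ Γ.IsDegenerate) (hnorm : Γ.IsNormalized)
    (hadm : (Γ.contract t h).IsAdmissible) (hz : Γ.IsInner (Γ.tgt t)) {a : Fin e}
    (ha : a ∈ newParallelEdges Γ t h) :
    contractSign K n (Γ.tgt t) t • basisVecOrZero K ((Γ.contract t h).subdivide a) ≡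
      basisVecOrZero K Γ [SMOD symSpan K (k + 1) n] := by
  obtain ⟨b, hbt, hb⟩ : ∃ b, b ≠ t ∧ Γ.Meets b (Γ.tgt t) := by
    obtain ⟨r, s, hrs, h1⟩ := exists_two_edges hΓ.loopless hz.1
    by_cases hrt : r = t
    · exact ⟨s, fun hst => hrs (hrt.trans hst.symm), (h1 s).2 (Or.inr rfl)⟩
    · exact ⟨r, hrt, (h1 r).2 (Or.inl rfl)⟩
  obtain ⟨b, rfl⟩ := Fin.exists_succAbove_eq hbt
  refine SModEq.trans ?_ (contractSign_smul_subdivide_contract hn (h := h) hΓ hnorm hz hb)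
  refine SModEq.smul ?_ _
  rcases eq_or_joins_of_mem_newParallelEdges hΓ hdeg hz hb ha with rfl | ⟨hab, hj⟩
  · exact SModEq.rfl
  · exact basisVecOrZero_subdivide_of_joins hn hadm hab hj

end SubdivideContract

/-! ### The number of non-inner vertices, and contractions of a bypass. -/

section Rank

open ColGraph

variable {K : Type u} [Field K] {k v e : ℕ} {n : ℤ}

open Classical in
/-- The vertices that are not inner. -/
def outerVertices (Γ : ColGraph (k + 1) v e) : Finset (Fin v) :=
  Finset.univ.filter fun x => ¬ Γ.IsInner x

lemma mem_outerVertices {Γ : ColGraph (k + 1) v e} {x : Fin v} :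
    x ∈ outerVertices Γ ↔ ¬ Γ.IsInner x := by simp [outerVertices]

lemma card_outerVertices_subdivide (Γ : ColGraph (k + 1) v e) (a : Fin e) :
    (outerVertices (Γ.subdivide a)).card = (outerVertices Γ).card := by
  rw [← Finset.card_image_of_injective _ (Fin.castSucc_injective v)]
  congr 1
  ext x
  refine Fin.lastCases ?_ (fun x => ?_) x
  · rw [mem_outerVertices, Finset.mem_image]
    refine iff_of_false (fun h => h (Γ.isWeaklyPassing_subdivide_last a).isInner) ?_
    rintro ⟨y, -, hy⟩
    exact (Fin.castSucc_lt_last y).ne hy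
  · rw [mem_outerVertices, isInner_subdivide_castSucc, Finset.mem_image]
    constructor
    · exact fun h => ⟨x, mem_outerVertices.2 h, rfl⟩
    · rintro ⟨y, hy, hyx⟩
      rw [← Fin.castSucc_injective v hyx]
      exact mem_outerVertices.1 hy

/-- The outer vertices of the contraction come from outer vertices other than the deleted target,
since an inner vertex does not meet `t` and stays inner. -/
lemma card_outerVertices_contract_lt {Γ : ColGraph (k + 1) (v + 1) (e + 1)} {t : Fin (e + 1)}
    {h : Γ.src t ≠ Γ.tgt t} (hs : ¬ Γ.IsInner (Γ.src t)) (ht : ¬ Γ.IsInner (Γ.tgt t)) :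
    (outerVertices (Γ.contract t h)).card < (outerVertices Γ).card := by
  refine lt_of_le_of_lt ?_
    (Finset.card_erase_lt_of_mem (mem_outerVertices.2 ht))
  refine (Finset.card_le_card fun y hy => ?_).trans (Finset.card_image_le (f := Γ.contractMap t h))
  rw [mem_outerVertices] at hy
  have h1 := mergeVertex_succAbove _ _ h y
  refine Finset.mem_image.2 ⟨(Γ.tgt t).succAbove y, Finset.mem_erase.2
    ⟨Fin.succAbove_ne _ _, mem_outerVertices.2 fun h2 => ?_⟩, h1⟩
  by_cases h3 : Γ.Meets t ((Γ.tgt t).succAbove y)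
  · rcases h3 with h3 | h3
    · exact hs (h3 ▸ h2)
    · exact ht (h3 ▸ h2)
  · rw [← h1] at hy
    exact hy ((isInner_contract_iff h3).2 h2)

/-- The number of vertices that are not inner. -/
def outerRank {k : ℕ} (Γ : AdmGraph (k + 1)) : ℕ := (outerVertices Γ.graph).card

/-- The contraction of the edge from the inner vertex of a bypass to the head, in the last
colour, of the bypassed edge is admissible. -/
lemma admissible_contract_of_bypass {Γ : ColGraph (k + 1) (v + 1) (e + 1)} {a r s : Fin (e + 1)}
    {h : Γ.src s ≠ Γ.tgt s} (hΓ : Γ.IsAdmissible) (hnorm : Γ.IsNormalized) {z : Fin (v + 1)}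
    (hz : Γ.IsInner z) (hr : Γ.Joins r z (Γ.tail (Fin.last k) a))
    (hs : Γ.Joins s z (Γ.head (Fin.last k) a)) : (Γ.contract s h).IsAdmissible := by
  refine admissible_contract hΓ fun c hc => hΓ.acyclic c ?_
  set x := Γ.tail (Fin.last k) a with hx
  set y := Γ.head (Fin.last k) a with hy
  have hxy : x ≠ y := tail_ne_head (hΓ.loopless a) _
  obtain ⟨hr1, hr2⟩ := hnorm r z hz hr.meets_left
  obtain ⟨hs1, hs2⟩ := hnorm s z hz hs.meets_left
  have hr3 : Γ.src r = x := by
    have := hΓ.loopless r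
    unfold Joins at hr; grind
  have hs3 : Γ.src s = y := by
    have := hΓ.loopless s
    unfold Joins at hs; grind
  have hrs : r ≠ s := by
    rintro rfl
    exact hxy (hr3.symm.trans hs3)
  have hxz : x ≠ z := by
    rw [← hr3, ← hr1]
    exact hΓ.loopless r
  have hajoins : (Γ.tail c a = x ∧ Γ.head c a = y) ∨ (Γ.tail c a = y ∧ Γ.head c a = x) := by
    rcases Γ.tail_eq c a with ⟨h1, h2, -⟩ | ⟨h1, h2, -⟩ <;>
      rcases Γ.tail_eq (Fin.last k) a with ⟨h3, h4, -⟩ | ⟨h3, h4, -⟩ <;> grind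
  have key : ∀ d, ∃ d', Γ.tail c d' = (Γ.tgt s).succAbove ((Γ.contract s h).tail c d) ∧
      Γ.head c d' = (Γ.tgt s).succAbove ((Γ.contract s h).head c d) := by
    intro d
    have hsucc : ∀ w, (Γ.tgt s).succAbove (Γ.contractMap s h w) =
        if w = z then y else w := by
      intro w
      rw [← hs3, ← hs1]
      exact succAbove_mergeVertex _ _ h w
    rw [(edgeMatch_contract d).tail, (edgeMatch_contract d).head, hsucc, hsucc]
    -- The surviving half `r` of the string is represented by `a`, every other edge by itself. In
    -- this way a cycle of the contraction lifts to `Γ`.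
    by_cases hd : s.succAbove d = r
    · rw [hd]
      refine ⟨a, ?_⟩
      refine Fin.lastCases (motive := fun c => (Γ.tail c a = x ∧ Γ.head c a = y) ∨
        (Γ.tail c a = y ∧ Γ.head c a = x) → ¬ Γ.HasCycle c →
        Γ.tail c a = (if Γ.tail c r = z then y else Γ.tail c r) ∧
          Γ.head c a = if Γ.head c r = z then y else Γ.head c r) ?_ (fun c => ?_) c hajoins
          (hΓ.acyclic c)
      -- It matters that `s` ends at the head of `a`: after the contraction `r` runs from `x` to
      -- `y`, just as `a` does.
      · intro _ _
        have h1 : Γ.tail (Fin.last k) r = x := by rw [tail, if_pos hr2, hr3]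
        have h2 : Γ.head (Fin.last k) r = z := by rw [head, if_pos hr2, hr1]
        rw [h1, h2, if_neg hxz, if_pos rfl]
        exact ⟨rfl, rfl⟩
      -- In the other colours the string passes through `z`. If `a` were directed against it, the
      -- three edges would form an oriented cycle.
      · intro hj hac
        have ho := hnorm.ori_eq_not hΓ hz hrs hr.meets_left hs.meets_left c
        cases h1 : Γ.ori c.castSucc r
        · rw [h1, Bool.not_false] at ho
          have h2 : Γ.tail c.castSucc r = z := by simp [tail, h1, hr1]
          have h3 : Γ.head c.castSucc r = x := by simp [head, h1, hr3]
          have h4 : Γ.tail c.castSucc s = y := by simp [tail, ho, hs3]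
          have h5 : Γ.head c.castSucc s = z := by simp [head, ho, hs1]
          rw [h2, h3, if_neg hxz, if_pos rfl]
          refine hj.resolve_left fun hj => hac ⟨x, ?_⟩
          exact .head (b := y) ⟨a, hj⟩ (.head (b := z) ⟨s, h4, h5⟩ (.single ⟨r, h2, h3⟩))
        · rw [h1, Bool.not_true] at ho
          have h2 : Γ.tail c.castSucc r = x := by simp [tail, h1, hr3]
          have h3 : Γ.head c.castSucc r = z := by simp [head, h1, hr1]
          have h4 : Γ.tail c.castSucc s = z := by simp [tail, ho, hs1]
          have h5 : Γ.head c.castSucc s = y := by simp [head, ho, hs3]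
          rw [h2, h3, if_neg hxz, if_pos rfl]
          refine hj.resolve_right fun hj => hac ⟨x, ?_⟩
          exact .head (b := z) ⟨r, h2, h3⟩ (.head (b := y) ⟨s, h4, h5⟩ (.single ⟨a, hj⟩))
    · have hm : ¬ Γ.Meets (s.succAbove d) z := by
        intro hm
        rcases eq_or_eq_of_meets hΓ.loopless hz.1 hrs hr.meets_left hs.meets_left hm with h1 | h1
        · exact hd h1
        · exact Fin.succAbove_ne s d h1
      rw [meets_iff_tail_or_head _ c] at hm
      push Not at hm
      rw [if_neg hm.1, if_neg hm.2]
      exact ⟨_, rfl, rfl⟩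
  obtain ⟨w, hw⟩ := hc
  refine ⟨_, hw.lift (Γ.tgt s).succAbove ?_⟩
  rintro _ _ ⟨d, rfl, rfl⟩
  exact key d

/-- A graph with a bypassed edge has a contraction with new parallel edges. -/
lemma exists_mem_newParallelEdges {Γ : ColGraph (k + 1) (v + 1) (e + 1)} (hΓ : Γ.IsAdmissible)
    (hnorm : Γ.IsNormalized) {a : Fin (e + 1)} (ha : Γ.IsBypassed a) :
    ∃ t, Γ.IsInner (Γ.tgt t) ∧ ∃ h : Γ.src t ≠ Γ.tgt t, (Γ.contract t h).IsAdmissible ∧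
      (newParallelEdges Γ t h).Nonempty := by
  have hja : Γ.Joins a (Γ.tail (Fin.last k) a) (Γ.head (Fin.last k) a) := by
    unfold Joins
    rcases Γ.tail_eq (Fin.last k) a with ⟨h3, h4, -⟩ | ⟨h3, h4, -⟩ <;> rw [h3, h4] <;> simp
  obtain ⟨hx, hy, z, hz, ⟨r, hr⟩, s, hs⟩ := hja.isBypassed_iff.1 ha
  have hne := hΓ.loopless s
  have hadm := admissible_contract_of_bypass (h := hne) hΓ hnorm hz hr hs
  have has : a ≠ s := by
    rintro rfl
    rcases hs.meets_left with h | h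
    · exact ha.1 (h ▸ hz)
    · exact ha.2.1 (h ▸ hz)
  have hrs : r ≠ s := by
    rintro rfl
    have h1 := tail_ne_head (hΓ.loopless a) (Fin.last k)
    unfold Joins at hr hs
    grind
  obtain ⟨a, rfl⟩ := Fin.exists_succAbove_eq has
  obtain ⟨r, rfl⟩ := Fin.exists_succAbove_eq hrs
  refine ⟨s, (hnorm s z hz hs.meets_left).1 ▸ hz, hne, hadm, r, mem_newParallelEdges.2
    ⟨(isParallel_contract_of_bypass hΓ hadm hx hy hz hja hr hs).2, fun h => ?_⟩⟩
  exact h.not_meets hz hr.meets_left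

end Rank

/-! ### Triangularity of the Laplacian of the subdivision homotopy. -/

section SubdivideHomotopy

open ColGraph

variable {K : Type u} [Field K] {k v e : ℕ} {n : ℤ}

/-- If `t` is `a` itself, a cycle in the last colour appears. If `t` is parallel to `a`, then `a`
becomes a loop and its subdivision a tadpole. Otherwise the parallel edge replaces `a` in any cycle
of the contraction, so the cycle persists. -/
lemma term_subdivide_mem (hn : ¬ Even n) {Γ : ColGraph (k + 1) (v + 1) (e + 1)}
    (hΓ : Γ.IsAdmissible) {a t : Fin (e + 1)} {h : Γ.src t ≠ Γ.tgt t} (ha : Γ.IsParallel a)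
    (hadm : ¬ (Γ.contract t h).IsAdmissible) :
    term K n (Γ.subdivide a) t.castSucc ∈ notadpRel K k n := by
  obtain ⟨b, hba, hj, hb⟩ := ha.exists_tail_head hΓ
  by_cases hat : a = t
  · subst hat
    rw [term_subdivide_self hΓ hba (hb _).1 (hb _).2]
    exact zero_mem _
  obtain ⟨a, rfl⟩ := Fin.exists_succAbove_eq hat
  rw [term_subdivide_of_ne hn Γ t a h]
  refine Submodule.smul_mem _ _ ?_
  by_cases hl : (Γ.contract t h).src a = (Γ.contract t h).tgt a
  · exact basisVecOrZero_subdivide_mem_of_loop hl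
  have hbt : b ≠ t := by
    rintro rfl
    exact hl hj.contractMap_eq
  obtain ⟨b, rfl⟩ := Fin.exists_succAbove_eq hbt
  obtain ⟨c, hc⟩ := exists_hasCycle_contract hΓ hadm
  have hcyc := hasCycle_subdivide (a := a) (b := b) (fun hab => hba (congrArg _ hab))
    (by rw [(edgeMatch_contract b).tail, (edgeMatch_contract a).tail, (hb c).1])
    (by rw [(edgeMatch_contract b).head, (edgeMatch_contract a).head, (hb c).2]) hc
  rw [basisVecOrZero_of_not_adm fun h => h.acyclic c hcyc]
  exact zero_mem _

open Classical in
/-- The sum of the subdivisions of the new parallel edges of a contraction. -/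
def newSubdivideSum (K : Type u) [Field K] (Γ : ColGraph (k + 1) (v + 1) (e + 1))
    (t : Fin (e + 1)) (h : Γ.src t ≠ Γ.tgt t) : Chains K (k + 1) :=
  if (Γ.contract t h).IsAdmissible then
    ∑ a ∈ newParallelEdges Γ t h, basisVecOrZero K ((Γ.contract t h).subdivide a) else 0

-- In an admissible contraction the parallel edges of `Γ` all survive as parallel edges, and their
-- terms in `δ h` and `h δ` cancel by the sign of `term_subdivide_of_ne`. Only the new parallel
-- edges are left.
open Classical in
lemma sum_term_subdivide_mem (hn : ¬ Even n) {Γ : ColGraph (k + 1) (v + 1) (e + 1)}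
    (hΓ : Γ.IsAdmissible) (t : Fin (e + 1)) :
    ∑ a ∈ parallelEdges Γ, term K n (Γ.subdivide a) t.castSucc +
      graphMap (subdivideSum K) (term K n Γ t) -
        contractSign K n (Γ.tgt t) t • newSubdivideSum K Γ t (hΓ.loopless t) ∈
      notadpRel K k n := by
  have hne := hΓ.loopless t
  rw [term_of_ne Γ t hne, map_smul]
  by_cases hadm : (Γ.contract t hne).IsAdmissible
  · rw [graphMap_basisVecOrZero _ hadm, newSubdivideSum, if_pos hadm]
    set D := Finset.univ.filter fun a => Γ.IsParallel (t.succAbove a) with hD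
    have h1 : parallelEdges Γ = D.image t.succAbove := by
      ext a
      rw [mem_parallelEdges, Finset.mem_image]
      constructor
      · intro ha
        have hat : a ≠ t := by
          rintro rfl
          exact ha.not_admissible_contract hadm
        obtain ⟨a, rfl⟩ := Fin.exists_succAbove_eq hat
        exact ⟨a, by simpa [hD] using ha, rfl⟩
      · rintro ⟨a, ha, rfl⟩
        simpa [hD] using ha
    have h2 : D ⊆ parallelEdges (Γ.contract t hne) := fun a ha =>
      mem_parallelEdges.2 (IsParallel.contract hΓ hadm (by simpa [hD] using ha))
    rw [h1, Finset.sum_image fun a _ b _ hab => Fin.succAbove_right_injective hab,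
      Finset.sum_congr rfl fun a _ => term_subdivide_of_ne hn Γ t a hne, ← Finset.smul_sum,
      subdivideSum, ← Finset.sum_sdiff h2, newParallelEdges]
    convert (notadpRel K k n).zero_mem using 1
    module
  · rw [basisVecOrZero_of_not_adm hadm, newSubdivideSum, if_neg hadm, map_zero, smul_zero,
      add_zero, sub_zero]
    exact sum_mem fun a ha => term_subdivide_mem hn hΓ (mem_parallelEdges.1 ha) hadm

/-- The operator `δ h + h δ` for the homotopy `h` that subdivides parallel edges. -/
abbrev subdivideLaplacian (K : Type u) [Field K] (k : ℕ) (n : ℤ) :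
    Chains K (k + 1) →ₗ[K] Chains K (k + 1) :=
  delta K (k + 1) n ∘ₗ graphMap (subdivideSum K) + graphMap (subdivideSum K) ∘ₗ delta K (k + 1) n

lemma subdivideLaplacian_sub_mem (hn : ¬ Even n) {Γ : ColGraph (k + 1) (v + 1) (e + 1)}
    (hΓ : Γ.IsAdmissible) :
    subdivideLaplacian K k n (basisVecOrZero K Γ) -
      (((parallelEdges Γ).card : K) • basisVecOrZero K Γ +
        ∑ t, contractSign K n (Γ.tgt t) t • newSubdivideSum K Γ t (hΓ.loopless t)) ∈
      notadpRel K k n := by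
  have h1 : ∀ a, delta K (k + 1) n (basisVecOrZero K (Γ.subdivide a)) = basisVecOrZero K Γ +
      ∑ t : Fin (e + 1), term K n (Γ.subdivide a) t.castSucc := fun a =>
    delta_basisVecOrZero_expand hn (Γ.subdivide_src_eq a) (Γ.subdivide_tgt_eq a)
      (admissible_subdivide hΓ)
  have h2 : subdivideLaplacian K k n (basisVecOrZero K Γ) -
      (((parallelEdges Γ).card : K) • basisVecOrZero K Γ +
        ∑ t, contractSign K n (Γ.tgt t) t • newSubdivideSum K Γ t (hΓ.loopless t)) =
      ∑ t, (∑ a ∈ parallelEdges Γ, term K n (Γ.subdivide a) t.castSucc +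
        graphMap (subdivideSum K) (term K n Γ t) -
        contractSign K n (Γ.tgt t) t • newSubdivideSum K Γ t (hΓ.loopless t)) := by
    rw [LinearMap.add_apply, LinearMap.comp_apply, LinearMap.comp_apply,
      graphMap_basisVecOrZero _ hΓ, delta_basisVecOrZero hΓ, subdivideSum, map_sum, map_sum,
      Finset.sum_congr rfl fun a _ => h1 a, Finset.sum_add_distrib, Finset.sum_const,
      Finset.sum_sub_distrib, Finset.sum_add_distrib, Finset.sum_comm, Nat.cast_smul_eq_nsmul]
    abel
  rw [h2]
  exact sum_mem fun t _ => sum_term_subdivide_mem hn hΓ t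

/-- The span of the graphs with parallel or bypassed edges that have few vertices that are not
inner. -/
abbrev multipleSpan (K : Type u) [Field K] (k r : ℕ) : Submodule K (Chains K (k + 1)) :=
  Submodule.span K (multipleGen K (k := k) '' {j | outerRank j.1 < r})

/-- If the target of `t` is inner, each new parallel edge returns `Γ`. Otherwise normalization makes
both ends of `t` non-inner, and the contraction lowers the rank, which subdivision does not change.
-/
lemma exists_contractSign_smul_newSubdivideSum_sub_mem (hn : ¬ Even n)
    {Γ : ColGraph (k + 1) (v + 1) (e + 1)} (hΓ : Γ.IsAdmissible) (hdeg : ¬ Γ.IsDegenerate)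
    (hnorm : Γ.IsNormalized) (t : Fin (e + 1)) : ∃ N : ℕ,
      (Γ.IsInner (Γ.tgt t) → (Γ.contract t (hΓ.loopless t)).IsAdmissible →
        (newParallelEdges Γ t (hΓ.loopless t)).Nonempty → N ≠ 0) ∧
      contractSign K n (Γ.tgt t) t • newSubdivideSum K Γ t (hΓ.loopless t) -
        (N : K) • basisVecOrZero K Γ ∈
        notadpRel K k n ⊔ multipleSpan K k (outerVertices Γ).card := by
  have hne := hΓ.loopless t
  by_cases hadm : (Γ.contract t hne).IsAdmissible
  swap
  · refine ⟨0, fun _ h => absurd h hadm, ?_⟩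
    rw [newSubdivideSum, if_neg hadm, smul_zero, Nat.cast_zero, zero_smul, sub_zero]
    exact zero_mem _
  by_cases hz : Γ.IsInner (Γ.tgt t)
  · refine ⟨(newParallelEdges Γ t hne).card, fun _ _ h => Finset.card_ne_zero.2 h,
      Submodule.mem_sup_left (sgcRel_le_notadpRel K k n (symSpan_le_sgcRel ?_))⟩
    rw [newSubdivideSum, if_pos hadm, Finset.smul_sum, Nat.cast_smul_eq_nsmul, ← Finset.sum_const,
      ← Finset.sum_sub_distrib]
    exact sum_mem fun a ha => SModEq.sub_mem.1
      (contractSign_smul_subdivide_of_mem hn hΓ hdeg hnorm hadm hz ha)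
  · have hs : ¬ Γ.IsInner (Γ.src t) := fun hs =>
      hne (hnorm t _ hs (Or.inl rfl)).1.symm
    refine ⟨0, fun h => absurd h hz, Submodule.mem_sup_right ?_⟩
    rw [newSubdivideSum, if_pos hadm, Nat.cast_zero, zero_smul, sub_zero]
    refine Submodule.smul_mem _ _ (sum_mem fun a ha => ?_)
    rw [mem_newParallelEdges] at ha
    have hadm' := admissible_subdivide (a := a) hadm
    obtain ⟨b, hb⟩ := isBypassed_subdivide ha.1
    rw [basisVecOrZero_of_adm hadm']
    refine Submodule.subset_span ⟨⟨⟨_, hadm'⟩, b, Or.inr hb⟩, ?_, rfl⟩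
    exact (card_outerVertices_subdivide _ _).trans_lt (card_outerVertices_contract_lt hs hz)

/-- The triangularity of `δ h + h δ` for a vector. -/
def IsTriangularAt (K : Type u) [Field K] (k : ℕ) (n : ℤ) (r : ℕ) (x : Chains K (k + 1)) : Prop :=
  ∃ N : ℕ, N ≠ 0 ∧
    subdivideLaplacian K k n x - (N : K) • x ∈ notadpRel K k n ⊔ multipleSpan K k r

lemma isTriangularAt_of_isNormalized (hn : ¬ Even n) {Γ : ColGraph (k + 1) v e}
    (hΓ : Γ.IsAdmissible) (hdeg : ¬ Γ.IsDegenerate) (hnorm : Γ.IsNormalized)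
    (h : ∃ a, Γ.IsParallel a ∨ Γ.IsBypassed a) :
    IsTriangularAt K k n (outerVertices Γ).card (basisVecOrZero K Γ) := by
  obtain ⟨v, e, rfl, rfl⟩ := IsAdmissible.exists_succ hΓ
  choose N hN0 hN using
    exists_contractSign_smul_newSubdivideSum_sub_mem (K := K) hn hΓ hdeg hnorm
  -- All contributions are nonnegative. A parallel edge makes the first summand positive, and a
  -- bypassed edge makes some `N t` positive.
  refine ⟨(parallelEdges Γ).card + ∑ t, N t, ?_, ?_⟩
  · obtain ⟨a, ha | ha⟩ := h
    · have := Finset.card_ne_zero_of_mem (mem_parallelEdges.2 ha)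
      omega
    · obtain ⟨t, hz, hne, hadm, hnew⟩ := exists_mem_newParallelEdges hΓ hnorm ha
      have h1 := hN0 t hz hadm hnew
      have h2 := Finset.single_le_sum (f := N) (fun _ _ => Nat.zero_le _) (Finset.mem_univ t)
      omega
  · have h1 := add_mem (Submodule.mem_sup_left (subdivideLaplacian_sub_mem (K := K) hn hΓ))
      (sum_mem fun t (_ : t ∈ Finset.univ) => hN t)
    rw [Finset.sum_sub_distrib, ← Finset.sum_smul] at h1
    convert h1 using 1
    push_cast
    module

/-- The Laplacian preserves `notadpRel`, so triangularity passes from `x` to `-x` modulo this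
subspace with the same `N`. This is the form in which reversals and toggles relate two graphs. -/
lemma IsTriangularAt.of_add_mem [CharZero K] (hn : ¬ Even n) {r : ℕ} {x y : Chains K (k + 1)}
    (hxy : x + y ∈ notadpRel K k n) (hx : IsTriangularAt K k n r x) :
    IsTriangularAt K k n r y := by
  obtain ⟨N, hN, h⟩ := hx
  refine ⟨N, hN, ?_⟩
  have h1 : subdivideLaplacian K k n (x + y) - (N : K) • (x + y) ∈ notadpRel K k n :=
    sub_mem (add_mem (delta_notadpRel hn _ (graphMap_subdivideSum_notadpRel hn _ hxy))
      (graphMap_subdivideSum_notadpRel hn _ (delta_notadpRel hn _ hxy)))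
      (Submodule.smul_mem _ _ hxy)
  have h2 := sub_mem (Submodule.mem_sup_left (T := multipleSpan K k r) h1) h
  convert h2 using 1
  rw [map_add]
  module

/-- Reversing an edge and toggling a weakly passing vertex preserve inner vertices, hence the rank
and the parallel and bypassed edges. So normalized graphs suffice. -/
lemma mem_or_isTriangularAt [CharZero K] (hn : ¬ Even n) {Γ : ColGraph (k + 1) v e}
    (hΓ : Γ.IsAdmissible) (h : ∃ a, Γ.IsParallel a ∨ Γ.IsBypassed a) :
    basisVecOrZero K Γ ∈ notadpRel K k n ∨
      IsTriangularAt K k n (outerVertices Γ).card (basisVecOrZero K Γ) := by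
  refine induction_normalized (Q := fun Γ : ColGraph (k + 1) v e =>
    (∃ a, Γ.IsParallel a ∨ Γ.IsBypassed a) → basisVecOrZero K Γ ∈ notadpRel K k n ∨
      IsTriangularAt K k n (outerVertices Γ).card (basisVecOrZero K Γ)) ?_ ?_ ?_ ?_ Γ hΓ h
  · rintro Γ t _ ih ⟨a, ha⟩
    have h1 : outerVertices (Γ.reverse t) = outerVertices Γ := by
      ext x
      rw [mem_outerVertices, mem_outerVertices, reverse_isInner]
    have h2 := sgcRel_le_notadpRel K k n
      (symSpan_le_sgcRel (SModEq.sub_mem.1 (basisVecOrZero_reverse (K := K) hn Γ t)))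
    rw [sub_neg_eq_add] at h2
    rw [basisVecOrZero_mem_iff_reverse hn (sgcRel_le_notadpRel K k n), h1] at ih
    exact (ih ⟨a, ha.imp (fun ha => ha.iso (iso_reverse Γ t))
      fun ha => ha.iso (iso_reverse Γ t)⟩).imp_right fun h => h.of_add_mem hn h2
  · rintro Γ z _ hz ih ⟨a, ha⟩
    have h1 : outerVertices (Γ.toggle z) = outerVertices Γ := by
      ext x
      rw [mem_outerVertices, mem_outerVertices, toggle_isInner]
    have h2 := sgcRel_le_notadpRel K k n (basisVecOrZero_add_toggle_mem (K := K) (n := n) Γ hz)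
    rw [add_comm (basisVecOrZero K Γ)] at h2
    rw [basisVecOrZero_mem_iff_toggle (sgcRel_le_notadpRel K k n) Γ hz, h1] at ih
    exact (ih ⟨a, ha.imp (Γ.toggle_isParallel z a).2 (Γ.toggle_isBypassed z a).2⟩).imp_right
      fun h => h.of_add_mem hn h2
  · exact fun Γ _ hdeg _ =>
      Or.inl (sgcRel_le_notadpRel K k n (basisVecOrZero_mem_of_isDegenerate hdeg))
  · exact fun Γ hΓ hdeg hnorm h => Or.inr (isTriangularAt_of_isNormalized hn hΓ hdeg hnorm h)

/-- The graphs with multiple edges form an acyclic subcomplex. -/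
theorem quotientIsQuasiIso_multipleEdges [CharZero K] (hn : ¬ Even n) :
    QuotientIsQuasiIso (delta K (k + 1) n) (degreePart K (k + 1) n) (notadpRel K k n)
      (nomulRel K k n) (notadpRel_le_nomulRel K k n) := by
  have hle := sgcRel_le_notadpRel K k n
  refine quotientIsQuasiIso_of_homotopy (multipleGen K) (fun Γ => outerRank Γ.1)
    (graphMap (subdivideSum K)) (isSubquotientComplex_of_stable hn _ hle (delta_notadpRel hn))
    (isSubquotientComplex_of_stable hn _ (hle.trans (notadpRel_le_nomulRel K k n))
      (delta_nomulRel hn))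
    (notadpRel_le_nomulRel K k n) (graphMap_subdivideSum_notadpRel hn)
    (graphMap_subdivideSum_nomulRel hn)
    (graphMap_mem_degreePart _ fun Γ d hd =>
      sum_mem fun a _ => basisVecOrZero_mem_degreePart _ hd) (nomulRel_le hn) ?_
  rintro ⟨⟨Γ, hΓ⟩, h⟩
  have h1 := mem_or_isTriangularAt (K := K) hn hΓ h
  rw [basisVecOrZero_of_adm hΓ] at h1
  exact h1

end SubdivideHomotopy

end OrientedGraphComplex
end

theorem proposition4p2 {K : Type*} [Field K] [CharZero K] (n : ℤ) (hn : Odd n) :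
    OrientedGraphComplex.QuotientIsQuasiIso
        (OrientedGraphComplex.delta K 1 n) (OrientedGraphComplex.degreePart K 1 n)
        (OrientedGraphComplex.sgcRel K 0 n) (OrientedGraphComplex.notadpRel K 0 n)
        (OrientedGraphComplex.sgcRel_le_notadpRel K 0 n) ∧
      ∀ k : ℕ, OrientedGraphComplex.QuotientIsQuasiIso
        (OrientedGraphComplex.delta K (k + 1) n) (OrientedGraphComplex.degreePart K (k + 1) n)
        (OrientedGraphComplex.notadpRel K k n) (OrientedGraphComplex.nomulRel K k n)
        (OrientedGraphComplex.notadpRel_le_nomulRel K k n) := by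
  have hn' : ¬ Even n := Int.not_even_iff_odd.2 hn
  exact ⟨OrientedGraphComplex.quotientIsQuasiIso_tadpoles hn', fun k =>
    OrientedGraphComplex.quotientIsQuasiIso_multipleEdges hn'⟩
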